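/- All graphs are finite and simple. A graph $G$ is $H$-free if no induced subgraph of $G$ is isomorphic to $H$. An induced minor of $G$ is a graph obtained from an induced subgraph of $G$ by repeatedly contracting edges (deleting all arising loops and parallel edges), and $G$ has an induced $H$-minor if some induced minor of $G$ is isomorphic to $H$. Let $\mathrm{cl}(G)$ denote the number of distinct induced cycle lengths in $G$, that is, the number of positive integers $l$ such that $G$ has an induced cycle of length $l$. For all positive integers $c, t$ there is a constant $f = f(c,t)$ such that if a $K_{t,t}$-free graph $G$ has an induced $K_{f,f}$-minor, then $\mathrm{cl}(G) \ge c$. -/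

import Mathlib

universe u v

namespace InducedCycles

/-- The graph `G / uv` obtained from `G` by contracting the edge `uv`: the vertex `v` is merged
into `u`. Loops and parallel edges that arise are deleted. -/
def contractEdge {V : Type u} (G : SimpleGraph V) (u v : V) : SimpleGraph {w : V // w ≠ v} where
  Adj a b := a ≠ b ∧
    (G.Adj a b ∨ ((a : V) = u ∧ G.Adj v b) ∨ ((b : V) = u ∧ G.Adj a v))
  symm := ⟨by
    rintro a b ⟨hne, h | ⟨ha, h⟩ | ⟨hb, h⟩⟩
    · exact ⟨hne.symm, Or.inl h.symm⟩
    · exact ⟨hne.symm, Or.inr (Or.inr ⟨ha, h.symm⟩)⟩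
    · exact ⟨hne.symm, Or.inr (Or.inl ⟨hb, h.symm⟩)⟩⟩
  loopless := ⟨fun _ h => h.1 rfl⟩

/-- `ContractsTo H G`: a graph isomorphic to `H` is obtained from `G` by contracting edges
repeatedly (possibly zero times). -/
inductive ContractsTo {W : Type v} (H : SimpleGraph W) : {V : Type u} → SimpleGraph V → Prop
  | iso {V : Type u} (G : SimpleGraph V) (e : G ≃g H) : ContractsTo H G
  | contract {V : Type u} (G : SimpleGraph V) (x y : V) (hxy : G.Adj x y)
      (h : ContractsTo H (contractEdge G x y)) : ContractsTo H G

/-- `G` has an induced `H`-minor: a graph isomorphic to `H` is obtained from an induced subgraph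
of `G` by repeatedly contracting edges. -/
def HasInducedMinor {V : Type u} {W : Type v} (G : SimpleGraph V) (H : SimpleGraph W) : Prop :=
  ∃ X : Set V, ContractsTo H (G.induce X)

/-- `G` is `H`-free: no induced subgraph of `G` is isomorphic to `H`. -/
def IndFree {V : Type u} {W : Type v} (G : SimpleGraph V) (H : SimpleGraph W) : Prop :=
  ¬ H.IsIndContained G

/-- The set of lengths of induced cycles of `G`. Cycles have at least three vertices. -/
def inducedCycleLengths {V : Type u} (G : SimpleGraph V) : Set ℕ :=
  {l | 3 ≤ l ∧ (SimpleGraph.cycleGraph l).IsIndContained G}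

/-- The number of distinct induced cycle lengths of a finite graph `G`. -/
noncomputable def cl {V : Type u} (G : SimpleGraph V) : ℕ :=
  (inducedCycleLengths G).ncard

/-- The complete bipartite graph `K_{n,n}`. -/
abbrev biclique (n : ℕ) : SimpleGraph (Fin n ⊕ Fin n) :=
  completeBipartiteGraph (Fin n) (Fin n)

end InducedCycles

/-!
Suppose that a `K_{t,t}`-free graph has few induced cycle lengths but a huge induced biclique minor.
A model of the minor is a grid of connected *rows* and *columns*: every row touches every column,
while rows are pairwise anticomplete and so are columns. The proof simplifies the grid until induced
cycles of many lengths are visible.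

*Reaching many sets from a connected set.* Let a connected set `H` meet many terminal sets, and take
a subset of `H` that is minimal with these properties. The order in which its vertices separate
others from a root shows that many terminal sets can be reached from `H` along pairwise anticomplete
private legs that start either at the vertices of a clique or on an induced path (`exists_type`). In
the second case look at where the legs attach to the path. Either a single vertex sees many of them,
or many separated stretches of the path are seen by many of them, which contradicts
`exists_constellation_bound`, or many of them attach to disjoint stretches
(`exists_position_structure`).

*Hubs.* Suppose that a row reaches many columns along disjoint stretches of a path. The columns can
be linked in pairs through a second row so that the lengths of the links satisfy a four-point
inequality (`exists_linkage`). Closing the links up along the first row adds lengths that satisfy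
this inequality strictly, whereas by Ramsey's theorem the lengths of the resulting cycles may be
assumed to be all equal. Hence a row reaches many columns from a *hub*, that is, from a clique or a
single vertex (`exists_hub`). Doing this for many rows one after the other, and adding the legs to
the columns, makes a hub out of every row (`exists_hubs`). If the hubs are single vertices, then the
same lemma with the roles of rows and columns exchanged shows that a column either has a vertex
adjacent to many hubs, which happens for fewer than `t` columns, or links the hubs in pairs away
from the other hubs (`exists_rich_or_links`). If the hubs are cliques, such links exist because a
port of a clique sees only its own column.

*Many cycle lengths.* So there are segments from hub to hub through every column. Two segments
between the same hubs through different columns close up to an induced cycle. Since the pairwise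
sums of three numbers determine them, the segments take boundedly many lengths, and by Ramsey's
theorem they may be assumed to have the same length `d`. Going around `2, 3, …, c + 1` hubs through
different columns gives induced cycles of lengths `2 * d, 3 * d, …, (c + 1) * d`
(`exists_segments_bound`).
-/

universe w

namespace InducedCycles

open Relation

/-! ### Connected sets, contact and induced paths -/

/-- No vertex of `X` equals or is adjacent to a vertex of `Y`. -/
def Anticomplete {V : Type u} (G : SimpleGraph V) (X Y : Set V) : Prop :=
  ∀ x ∈ X, ∀ y ∈ Y, x ≠ y ∧ ¬ G.Adj x y

/-- Some edge of `G` joins `X` to `Y`. -/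
def Touches {V : Type u} (G : SimpleGraph V) (X Y : Set V) : Prop :=
  ∃ x ∈ X, ∃ y ∈ Y, G.Adj x y

/-- `y` can be reached from `x` by a walk all of whose edges have both ends in `X`. The trivial
walk is allowed even if its vertex is not in `X`. -/
def Reach {V : Type u} (G : SimpleGraph V) (X : Set V) : V → V → Prop :=
  ReflTransGen (fun a b => G.Adj a b ∧ a ∈ X ∧ b ∈ X)

/-- `X` induces a connected (possibly empty) subgraph. -/
def Conn {V : Type u} (G : SimpleGraph V) (X : Set V) : Prop :=
  ∀ x ∈ X, ∀ y ∈ X, Reach G X x y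

/-- The list `l` enumerates, in order, the vertices of an induced path of `G`. The empty list is
allowed. -/
def IsInducedPath {V : Type u} (G : SimpleGraph V) : List V → Prop
  | [] => True
  | x :: l => (∀ y ∈ l, x ≠ y ∧ (G.Adj x y ↔ l.head? = some y)) ∧ IsInducedPath G l

/-- The list `l` enumerates, in cyclic order, the vertices of an induced cycle of `G`: its tail is
an induced path whose ends are exactly the neighbours of its head. -/
def IsInducedCycle {V : Type u} (G : SimpleGraph V) (l : List V) : Prop :=
  ∃ z m, l = z :: m ∧ IsInducedPath G m ∧ 2 ≤ m.length ∧
    ∀ u ∈ m, z ≠ u ∧ (G.Adj z u ↔ m.head? = some u ∨ m.getLast? = some u)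

section
variable {V : Type u} {G : SimpleGraph V}

theorem Anticomplete.symm {X Y : Set V} (h : Anticomplete G X Y) : Anticomplete G Y X :=
  fun y hy x hx => ⟨(h x hx y hy).1.symm, fun e => (h x hx y hy).2 e.symm⟩

theorem Anticomplete.mono {X Y X' Y' : Set V} (h : Anticomplete G X Y) (hX : X' ⊆ X)
    (hY : Y' ⊆ Y) : Anticomplete G X' Y' :=
  fun x hx y hy => h x (hX hx) y (hY hy)

theorem Anticomplete.union_left {X X' Y : Set V} (h : Anticomplete G X Y)
    (h' : Anticomplete G X' Y) : Anticomplete G (X ∪ X') Y := by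
  rintro x (hx | hx) y hy
  · exact h x hx y hy
  · exact h' x hx y hy

theorem Anticomplete.union_right {X Y Y' : Set V} (h : Anticomplete G X Y)
    (h' : Anticomplete G X Y') : Anticomplete G X (Y ∪ Y') :=
  (h.symm.union_left h'.symm).symm

theorem Touches.symm {X Y : Set V} (h : Touches G X Y) : Touches G Y X := by
  obtain ⟨x, hx, y, hy, e⟩ := h
  exact ⟨y, hy, x, hx, e.symm⟩

theorem Touches.mono {X Y X' Y' : Set V} (h : Touches G X Y) (hX : X ⊆ X')
    (hY : Y ⊆ Y') : Touches G X' Y' := by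
  obtain ⟨x, hx, y, hy, e⟩ := h
  exact ⟨x, hX hx, y, hY hy, e⟩

theorem Reach.mono {X Y : Set V} (h : X ⊆ Y) {a b : V} (r : Reach G X a b) : Reach G Y a b := by
  induction r with
  | refl => exact ReflTransGen.refl
  | tail _ e ih => exact ih.tail ⟨e.1, h e.2.1, h e.2.2⟩

theorem Reach.symm {X : Set V} {a b : V} (r : Reach G X a b) : Reach G X b a := by
  induction r with
  | refl => exact ReflTransGen.refl
  | tail _ e ih => exact ReflTransGen.head ⟨e.1.symm, e.2.2, e.2.1⟩ ih

theorem Reach.trans {X : Set V} {a b c : V} (r : Reach G X a b) (s : Reach G X b c) :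
    Reach G X a c := ReflTransGen.trans r s

theorem Reach.of_adj {X : Set V} {a b : V} (h : G.Adj a b) (ha : a ∈ X) (hb : b ∈ X) :
    Reach G X a b := ReflTransGen.single ⟨h, ha, hb⟩

theorem Conn.of_root {X : Set V} (r : V) (h : ∀ x ∈ X, Reach G X r x) : Conn G X :=
  fun x hx y hy => (h x hx).symm.trans (h y hy)

theorem conn_singleton (x : V) : Conn G {x} := by
  rintro a rfl b rfl
  exact ReflTransGen.refl

theorem Conn.union {X Y : Set V} (hX : Conn G X) (hY : Conn G Y) (h : Touches G X Y) :
    Conn G (X ∪ Y) := by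
  obtain ⟨x, hx, y, hy, e⟩ := h
  refine Conn.of_root x ?_
  rintro z (hz | hz)
  · exact (hX x hx z hz).mono Set.subset_union_left
  · exact (Reach.of_adj e (Or.inl hx) (Or.inr hy)).trans
      ((hY y hy z hz).mono Set.subset_union_right)

theorem Conn.union_of_mem {X Y : Set V} (hX : Conn G X) (hY : Conn G Y) {x : V} (hx : x ∈ X)
    (hy : x ∈ Y) : Conn G (X ∪ Y) := by
  refine Conn.of_root x ?_
  rintro z (hz | hz)
  · exact (hX x hx z hz).mono Set.subset_union_left
  · exact (hY x hy z hz).mono Set.subset_union_right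

/-- A connected set has an edge leaving any of its nonempty proper subsets. -/
theorem Conn.exists_edge {X Y : Set V} (hX : Conn G X) {a b : V} (ha : a ∈ X) (hb : b ∈ X)
    (haY : a ∈ Y) (hbY : b ∉ Y) : ∃ x ∈ X, ∃ y ∈ X, x ∈ Y ∧ y ∉ Y ∧ G.Adj x y := by
  have key : ∀ z, Reach G X a z → z ∉ Y → ∃ x ∈ X, ∃ y ∈ X, x ∈ Y ∧ y ∉ Y ∧ G.Adj x y := by
    intro z r
    induction r with
    | refl => exact fun h => absurd haY h
    | @tail p q _ e ih =>
      intro hq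
      by_cases hp : p ∈ Y
      · exact ⟨p, e.2.1, q, e.2.2, hp, hq, e.1⟩
      · exact ih hp
  exact key b (hX a ha b hb) hbY

theorem head?_mem {l : List V} {x : V} (h : l.head? = some x) : x ∈ l := by
  cases l with
  | nil => simp at h
  | cons a l => simp at h; simp [h]

theorem getLast?_mem {l : List V} {x : V} (h : l.getLast? = some x) : x ∈ l :=
  List.mem_of_getLast? h

theorem exists_split_last {α : Type*} (p : α → Prop) {l : List α} (h : ∃ x ∈ l, p x) :
    ∃ l₁ x l₂, l = l₁ ++ x :: l₂ ∧ p x ∧ ∀ y ∈ l₂, ¬ p y := by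
  induction l with
  | nil => simp at h
  | cons a l ih =>
    by_cases hl : ∃ x ∈ l, p x
    · obtain ⟨l₁, x, l₂, rfl, hx, h2⟩ := ih hl
      exact ⟨a :: l₁, x, l₂, by simp, hx, h2⟩
    · obtain ⟨x, hx, px⟩ := h
      rcases List.mem_cons.1 hx with rfl | hx
      · exact ⟨[], x, l, by simp, px, fun y hy py => hl ⟨y, hy, py⟩⟩
      · exact absurd ⟨x, hx, px⟩ hl

theorem IsInducedPath.right {l₁ l₂ : List V} (h : IsInducedPath G (l₁ ++ l₂)) :
    IsInducedPath G l₂ := by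
  induction l₁ with
  | nil => exact h
  | cons a l ih => exact ih h.2

theorem IsInducedPath.append {l₁ l₂ : List V} (h₁ : IsInducedPath G l₁) (h₂ : IsInducedPath G l₂)
    (h : ∀ x ∈ l₁, ∀ y ∈ l₂, x ≠ y ∧
      (G.Adj x y ↔ l₁.getLast? = some x ∧ l₂.head? = some y)) :
    IsInducedPath G (l₁ ++ l₂) := by
  induction l₁ with
  | nil => exact h₂
  | cons a l ih =>
    refine ⟨?_, ?_⟩
    · intro y hy
      rcases List.mem_append.1 hy with hy₁ | hy₂
      · replace hy := hy₁
        refine ⟨(h₁.1 y hy).1, ?_⟩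
        rw [(h₁.1 y hy).2]
        cases l with
        | nil => simp at hy
        | cons b l => simp
      · refine ⟨(h a (by simp) y hy₂).1, ?_⟩
        rw [(h a (by simp) y hy₂).2]
        cases l with
        | nil => simp
        | cons b l =>
          have : a ∉ b :: l := fun hm => (h₁.1 a hm).1 rfl
          constructor
          · rintro ⟨h3, -⟩
            rw [List.getLast?_cons_cons] at h3
            exact absurd (getLast?_mem h3) this
          · intro h3
            simp at h3
            subst h3
            exact absurd rfl (h b (by simp) b hy₂).1
    · refine ih h₁.2 fun x hx y hy => ⟨(h x (by simp [hx]) y hy).1, ?_⟩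
      rw [(h x (by simp [hx]) y hy).2]
      cases l with
      | nil => simp at hx
      | cons b l => simp [List.getLast?_cons_cons]

theorem IsInducedPath.nodup {l : List V} (h : IsInducedPath G l) : l.Nodup := by
  induction l with
  | nil => simp
  | cons a l ih =>
    exact List.nodup_cons.2 ⟨fun hm => (h.1 a hm).1 rfl, ih h.2⟩

theorem isInducedPath_singleton (x : V) : IsInducedPath G [x] := by simp [IsInducedPath]

theorem IsInducedPath.reverse {l : List V} (h : IsInducedPath G l) :
    IsInducedPath G l.reverse := by
  induction l with
  | nil => exact h
  | cons a l ih =>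
    rw [List.reverse_cons]
    refine (ih h.2).append (isInducedPath_singleton a) fun x hx y hy => ?_
    rw [List.mem_singleton] at hy
    subst hy
    have := h.1 x (List.mem_reverse.1 hx)
    refine ⟨this.1.symm, ?_⟩
    rw [G.adj_comm, this.2]
    simp

theorem IsInducedPath.left {l₁ l₂ : List V} (h : IsInducedPath G (l₁ ++ l₂)) :
    IsInducedPath G l₁ := by
  have := h.reverse
  rw [List.reverse_append] at this
  simpa using this.right.reverse

theorem IsInducedPath.getElem_adj {l : List V} (h : IsInducedPath G l) :
    ∀ (i j : ℕ) (hi : i < l.length) (hj : j < l.length),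
      G.Adj l[i] l[j] ↔ i + 1 = j ∨ j + 1 = i := by
  induction l with
  | nil => intro i j hi; simp at hi
  | cons a l ih =>
    have aux : ∀ (j : ℕ) (hj : j < l.length), G.Adj a l[j] ↔ j = 0 := by
      intro j hj
      rw [(h.1 l[j] (List.getElem_mem _)).2]
      cases l with
      | nil => simp at hj
      | cons b l =>
        simp only [List.head?_cons, Option.some.injEq]
        constructor
        · intro e
          have := (List.Nodup.getElem_inj_iff h.2.nodup (i := 0) (j := j)
            (hi := by simp) (hj := hj)).1 (by simpa using e)
          exact this.symm
        · rintro rfl; rfl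
    intro i j hi hj
    rcases i with _ | i <;> rcases j with _ | j
    · simp
    · simp only [List.getElem_cons_zero, List.getElem_cons_succ]
      rw [aux]; omega
    · simp only [List.getElem_cons_zero, List.getElem_cons_succ]
      rw [G.adj_comm, aux]; omega
    · simp only [List.getElem_cons_succ]
      rw [ih h.2 i j (by simpa using hi) (by simpa using hj)]; omega

theorem IsInducedPath.conn {l : List V} (h : IsInducedPath G l) : Conn G {x | x ∈ l} := by
  induction l with
  | nil => intro x hx; simp at hx
  | cons a l ih =>
    refine Conn.of_root a ?_
    intro x hx
    rcases List.mem_cons.1 hx with rfl | hx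
    · exact ReflTransGen.refl
    · cases l with
      | nil => simp at hx
      | cons b l =>
        have e : G.Adj a b := (h.1 b (by simp)).2.2 (by simp)
        exact (Reach.of_adj e (by simp) (by simp)).trans
          ((ih h.2 b (by simp) x hx).mono (by intro y; simp; tauto))

/-- Between two sets that meet a connected set `X` there is an induced path inside `X` that
touches the two sets only at its ends. -/
theorem Conn.exists_path {X : Set V} (hX : Conn G X) {S T : Set V} (hS : ∃ x ∈ X, x ∈ S)
    (hT : ∃ x ∈ X, x ∈ T) : ∃ (l : List V) (a b : V), IsInducedPath G l ∧ (∀ x ∈ l, x ∈ X) ∧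
      l.head? = some a ∧ l.getLast? = some b ∧ a ∈ S ∧ b ∈ T ∧
      (∀ x ∈ l, x ∈ S → x = a) ∧ (∀ x ∈ l, x ∈ T → x = b) := by
  obtain ⟨s, hs, hsS⟩ := hS
  obtain ⟨t, ht, htT⟩ := hT
  have key : s ∈ X → ∃ (l : List V) (b : V), IsInducedPath G l ∧ (∀ x ∈ l, x ∈ X) ∧
      l.head? = some s ∧ l.getLast? = some b ∧ b ∈ T ∧ (∀ x ∈ l, x ∈ T → x = b) := by
    have r := hX s hs t ht
    clear hsS hs
    induction r using ReflTransGen.head_induction_on with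
    | refl =>
      exact fun _ => ⟨[t], t, isInducedPath_singleton t, by simpa using ht, rfl, rfl, htT,
        by simp⟩
    | @head p q e _ ih =>
      intro hp
      obtain ⟨l, b, hl, hlX, hh, hb, hbT, hu⟩ := ih e.2.2
      by_cases hpT : p ∈ T
      · exact ⟨[p], p, isInducedPath_singleton p, by simpa using hp, rfl, rfl, hpT, by simp⟩
      by_cases hpl : p ∈ l
      · obtain ⟨l₁, l₂, rfl⟩ := List.append_of_mem hpl
        exact ⟨p :: l₂, b, hl.right, fun x hx => hlX x (List.mem_append_right _ hx), rfl,
          by simpa using hb, hbT, fun x hx => hu x (List.mem_append_right _ hx)⟩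
      · obtain ⟨l₁, y, l₂, rfl, hy, h2⟩ := exists_split_last (G.Adj p)
          ⟨q, head?_mem hh, e.1⟩
        refine ⟨p :: y :: l₂, b, ⟨?_, hl.right⟩, ?_, rfl, ?_, hbT, ?_⟩
        · intro x hx
          refine ⟨fun e => hpl (e ▸ List.mem_append_right _ hx), ?_⟩
          simp only [List.head?_cons, Option.some.injEq]
          constructor
          · intro hpx
            rcases List.mem_cons.1 hx with rfl | hx
            · rfl
            · exact absurd hpx (h2 x hx)
          · rintro rfl; exact hy
        · intro x hx
          rcases List.mem_cons.1 hx with rfl | hx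
          · exact hp
          · exact hlX x (List.mem_append_right _ hx)
        · simpa using hb
        · intro x hx hxT
          rcases List.mem_cons.1 hx with rfl | hx
          · exact absurd hxT hpT
          · exact hu x (List.mem_append_right _ hx) hxT
  obtain ⟨l, b, hl, hlX, hh, hb, hbT, hu⟩ := key hs
  obtain ⟨l₁, a, l₂, rfl, ha, h2⟩ := exists_split_last (· ∈ S) ⟨s, head?_mem hh, hsS⟩
  refine ⟨a :: l₂, a, b, hl.right, fun x hx => hlX x (List.mem_append_right _ hx), rfl,
    by simpa using hb, ha, hbT, ?_, fun x hx => hu x (List.mem_append_right _ hx)⟩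
  intro x hx hxS
  rcases List.mem_cons.1 hx with rfl | hx
  · rfl
  · exact absurd hxS (h2 x hx)

/-- Two disjoint induced paths joined by exactly the edges between last and first vertices (and
first and last vertices) form an induced cycle. -/
theorem IsInducedPath.exists_cycle {l₁ l₂ : List V} (h₁ : IsInducedPath G l₁)
    (h₂ : IsInducedPath G l₂) (hlen : 2 ≤ l₁.length) (hne : l₂ ≠ [])
    (h : ∀ x ∈ l₁, ∀ y ∈ l₂, x ≠ y ∧ (G.Adj x y ↔
      (l₁.getLast? = some x ∧ l₂.head? = some y) ∨ (l₁.head? = some x ∧ l₂.getLast? = some y))) :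
    ∃ l, IsInducedCycle G l ∧ l.length = l₁.length + l₂.length := by
  obtain ⟨z, l₂, rfl⟩ := List.exists_cons_of_ne_nil hne
  refine ⟨z :: (l₂ ++ l₁), ⟨z, l₂ ++ l₁, rfl, ?_, by simp; omega, ?_⟩, by simp; omega⟩
  · refine h₂.2.append h₁ fun x hx y hy => ?_
    have hzx := (h₂.1 x hx).1
    obtain ⟨h3, h4⟩ := h y hy x (by simp [hx])
    refine ⟨h3.symm, ?_⟩
    rw [G.adj_comm, h4]
    cases l₂ with
    | nil => simp at hx
    | cons b l =>
      simp only [List.head?_cons, Option.some.injEq, List.getLast?_cons_cons]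
      tauto
  · intro u hu
    rcases List.mem_append.1 hu with hu₂ | hu₁
    · refine ⟨(h₂.1 u hu₂).1, ?_⟩
      rw [(h₂.1 u hu₂).2]
      cases l₂ with
      | nil => simp at hu₂
      | cons b l =>
        simp only [List.head?_cons, List.cons_append]
        constructor
        · exact Or.inl
        · rintro (h3 | h3)
          · exact h3
          · exfalso
            cases l₁ with
            | nil => simp at hlen
            | cons c l₁ =>
              have : u ∈ c :: l₁ := by
                rw [← List.cons_append, List.getLast?_append] at h3
                have hc : ((c :: l₁).getLast?).isSome := by simp
                obtain ⟨w, hw⟩ := Option.isSome_iff_exists.1 hc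
                rw [hw] at h3
                simp at h3
                subst h3
                exact getLast?_mem hw
              exact (h u this u (List.mem_cons_of_mem _ hu₂)).1 rfl
    · obtain ⟨h3, h4⟩ := h u hu₁ z (by simp)
      refine ⟨h3.symm, ?_⟩
      rw [G.adj_comm, h4]
      have hl : (l₂ ++ l₁).getLast? = l₁.getLast? := by
        rw [List.getLast?_append]
        cases l₁ with
        | nil => simp at hlen
        | cons c l => 
          obtain ⟨w, hw⟩ := Option.isSome_iff_exists.1 (show ((c :: l).getLast?).isSome by simp)
          rw [hw]; simp
      rw [hl]
      cases l₂ with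
      | nil => simp; tauto
      | cons b l =>
        simp only [List.head?_cons, List.getLast?_cons_cons, List.cons_append]
        constructor
        · rintro (h5 | h5)
          · exact Or.inr h5.1
          · exact absurd rfl (h₂.1 z (getLast?_mem h5.2)).1
        · rintro (h5 | h5)
          · simp at h5; subst h5
            exact absurd rfl (h b hu₁ b (by simp)).1
          · exact Or.inl ⟨h5, by simp⟩

theorem IsInducedCycle.length_mem {l : List V} (h : IsInducedCycle G l) :
    l.length ∈ inducedCycleLengths G := by
  obtain ⟨z, m, rfl, hm, hlen, hz⟩ := h
  have hnd : (z :: m).Nodup := List.nodup_cons.2 ⟨fun hx => (hz z hx).1 rfl, hm.nodup⟩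
  refine ⟨by simp; omega, ⟨⟨⟨fun i => (z :: m)[i], fun i j e => ?_⟩, ?_⟩⟩⟩
  · exact Fin.ext ((List.Nodup.getElem_inj_iff hnd).1 e)
  · have aux : ∀ (j : ℕ) (hj : j < m.length), G.Adj z m[j] ↔ j = 0 ∨ j + 1 = m.length := by
      intro j hj
      rw [(hz m[j] (List.getElem_mem _)).2, List.head?_eq_getElem?, List.getLast?_eq_getElem?,
        List.getElem?_eq_getElem (by omega), List.getElem?_eq_getElem (by omega),
        Option.some.injEq, Option.some.injEq, List.Nodup.getElem_inj_iff hm.nodup,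
        List.Nodup.getElem_inj_iff hm.nodup]
      omega
    intro ⟨i, hi⟩ ⟨j, hj⟩
    simp only [List.length_cons] at hi hj
    simp only [Function.Embedding.coeFn_mk, Fin.getElem_fin]
    rw [SimpleGraph.cycleGraph_adj']
    have sub : ∀ (a b : ℕ) (ha : a < m.length + 1) (hb : b < m.length + 1),
        ((⟨a, ha⟩ : Fin (m.length + 1)) - ⟨b, hb⟩).val = 1 ↔
          a = b + 1 ∨ (a = 0 ∧ b = m.length) := by
      intro a b ha hb
      rw [Fin.sub_def]
      simp only
      by_cases hab : b ≤ a
      · have : m.length + 1 - b + a = (a - b) + (m.length + 1) := by omega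
        rw [this, Nat.add_mod_right, Nat.mod_eq_of_lt (by omega)]
        omega
      · rw [Nat.mod_eq_of_lt (by omega)]
        omega
    refine Iff.trans ?_ (or_congr (sub i j hi hj) (sub j i hj hi)).symm
    rcases i with _ | i <;> rcases j with _ | j
    · simp; omega
    · simp only [List.getElem_cons_zero, List.getElem_cons_succ]
      rw [aux j (by omega)]; simp only [true_and]; omega
    · simp only [List.getElem_cons_zero, List.getElem_cons_succ]
      rw [G.adj_comm, aux i (by omega)]; simp only [true_and]; omega
    · simp only [List.getElem_cons_succ]
      rw [hm.getElem_adj]; omega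

end

/-! ### Branch sets of an induced minor -/

/-- The projection of the vertices of `G` onto those of `G / xy`: it sends `y` to `x`. -/
noncomputable def contractMap {V : Type u} (x y : V) (h : x ≠ y) (v : V) : {w : V // w ≠ y} :=
  open Classical in if hv : v = y then ⟨x, h⟩ else ⟨v, hv⟩

section
variable {V : Type u} {G : SimpleGraph V}

theorem contractMap_eq_iff {x y : V} (h : x ≠ y) {v : V} {a : {w : V // w ≠ y}} :
    contractMap x y h v = a ↔ v = a ∨ (v = y ∧ (a : V) = x) := by
  unfold contractMap
  split_ifs with hv
  · subst hv
    rw [Subtype.ext_iff]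
    constructor
    · intro e; exact Or.inr ⟨rfl, e.symm⟩
    · rintro (e | e)
      · exact absurd e.symm a.2
      · exact e.2.symm
  · rw [Subtype.ext_iff]
    constructor
    · exact Or.inl
    · rintro (e | e)
      · exact e
      · exact absurd e.1 hv

theorem exists_adj_of_contractEdge_adj {x y : V} (hxy : G.Adj x y) {a b : {w : V // w ≠ y}}
    (h : (contractEdge G x y).Adj a b) : ∃ u v, contractMap x y hxy.ne u = a ∧
      contractMap x y hxy.ne v = b ∧ G.Adj u v := by
  obtain ⟨-, h | ⟨ha, h⟩ | ⟨hb, h⟩⟩ := h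
  · exact ⟨a, b, by simp [contractMap_eq_iff], by simp [contractMap_eq_iff], h⟩
  · exact ⟨y, b, by simp [contractMap_eq_iff, ha], by simp [contractMap_eq_iff], h⟩
  · exact ⟨a, y, by simp [contractMap_eq_iff], by simp [contractMap_eq_iff, hb], h⟩

theorem contractEdge_adj_of_adj {x y : V} (hxy : G.Adj x y) {u v : V} (h : G.Adj u v)
    (hne : contractMap x y hxy.ne u ≠ contractMap x y hxy.ne v) :
    (contractEdge G x y).Adj (contractMap x y hxy.ne u) (contractMap x y hxy.ne v) := by
  refine ⟨hne, ?_⟩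
  by_cases hu : u = y
  · have e1 : contractMap x y hxy.ne u = ⟨x, hxy.ne⟩ := by simp [contractMap_eq_iff, hu]
    have hv : v ≠ y := fun hv => h.ne (hu.trans hv.symm)
    have e2 : contractMap x y hxy.ne v = ⟨v, hv⟩ := by simp [contractMap_eq_iff]
    rw [e1, e2]
    exact Or.inr (Or.inl ⟨rfl, hu ▸ h⟩)
  · have e1 : contractMap x y hxy.ne u = ⟨u, hu⟩ := by simp [contractMap_eq_iff]
    by_cases hv : v = y
    · have e2 : contractMap x y hxy.ne v = ⟨x, hxy.ne⟩ := by simp [contractMap_eq_iff, hv]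
      rw [e1, e2]
      exact Or.inr (Or.inr ⟨rfl, hv ▸ h⟩)
    · have e2 : contractMap x y hxy.ne v = ⟨v, hv⟩ := by simp [contractMap_eq_iff]
      rw [e1, e2]
      exact Or.inl h

theorem Reach.of_contractEdge {x y : V} (hxy : G.Adj x y) {X : Set {w : V // w ≠ y}}
    {a b : {w : V // w ≠ y}} (r : Reach (contractEdge G x y) X a b) (ha : a ∈ X) :
    ∀ u v, contractMap x y hxy.ne u = a → contractMap x y hxy.ne v = b →
      Reach G (contractMap x y hxy.ne ⁻¹' X) u v := by
  have fib : ∀ a ∈ X, ∀ u v, contractMap x y hxy.ne u = a → contractMap x y hxy.ne v = a →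
      Reach G (contractMap x y hxy.ne ⁻¹' X) u v := by
    intro a ha u v hu hv
    have hu' : u ∈ contractMap x y hxy.ne ⁻¹' X := by rw [Set.mem_preimage, hu]; exact ha
    have hv' : v ∈ contractMap x y hxy.ne ⁻¹' X := by rw [Set.mem_preimage, hv]; exact ha
    rw [contractMap_eq_iff] at hu hv
    rcases hu with hu | ⟨hu, hu2⟩ <;> rcases hv with hv | ⟨hv, hv2⟩
    · rw [hu, hv]; exact ReflTransGen.refl
    · refine Reach.of_adj ?_ hu' hv'
      rw [hu, hv, hv2]; exact hxy
    · refine Reach.of_adj ?_ hu' hv'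
      rw [hu, hv, hu2]; exact hxy.symm
    · rw [hu, hv]; exact ReflTransGen.refl
  induction r with
  | refl => exact fib a ha
  | @tail p q _ e ih =>
    intro u v hu hv
    obtain ⟨p', q', hp, hq, e'⟩ := exists_adj_of_contractEdge_adj hxy e.1
    refine (ih u p' hu hp).trans ((Reach.of_adj e' ?_ ?_).trans (fib q e.2.2 q' v hq hv))
    · rw [Set.mem_preimage, hp]; exact e.2.1
    · rw [Set.mem_preimage, hq]; exact e.2.2

end

/-- `φ` assigns to the vertices of `H` disjoint nonempty connected sets of vertices of `G`, and two
of them are joined by an edge exactly when the vertices of `H` are adjacent. -/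
def IsModel {V : Type u} {W : Type v} (G : SimpleGraph V) (H : SimpleGraph W)
    (φ : W → Set V) : Prop :=
  (∀ w, (φ w).Nonempty ∧ Conn G (φ w)) ∧
    ∀ a b, a ≠ b → Disjoint (φ a) (φ b) ∧ (Touches G (φ a) (φ b) ↔ H.Adj a b)

theorem ContractsTo.exists_model {V : Type u} {W : Type v} {G : SimpleGraph V}
    {H : SimpleGraph W} (h : ContractsTo H G) : ∃ φ : W → Set V, IsModel G H φ := by
  induction h with
  | iso G e =>
    refine ⟨fun w => {e.symm w}, fun w => ⟨Set.singleton_nonempty _, conn_singleton _⟩, ?_⟩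
    intro a b hab
    refine ⟨by simpa using hab, ?_⟩
    simp only [Touches, Set.mem_singleton_iff, exists_eq_left]
    exact e.symm.map_adj_iff
  | contract G x y hxy _ ih =>
    obtain ⟨φ, h1, h2⟩ := ih
    have sec : ∀ a, ∃ u, contractMap x y hxy.ne u = a :=
      fun a => ⟨a, by simp [contractMap_eq_iff]⟩
    refine ⟨fun w => contractMap x y hxy.ne ⁻¹' φ w, fun w => ⟨?_, ?_⟩, fun a b hab => ⟨?_, ?_⟩⟩
    · obtain ⟨a, ha⟩ := (h1 w).1
      obtain ⟨u, rfl⟩ := sec a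
      exact ⟨u, ha⟩
    · intro u hu v hv
      exact Reach.of_contractEdge hxy ((h1 w).2 _ hu _ hv) hu u v rfl rfl
    · exact (h2 a b hab).1.preimage _
    · rw [← (h2 a b hab).2]
      constructor
      · rintro ⟨u, hu, v, hv, e⟩
        refine ⟨_, hu, _, hv, contractEdge_adj_of_adj hxy e ?_⟩
        intro he
        exact Set.disjoint_left.1 (h2 a b hab).1 hu (by rw [he]; exact hv)
      · rintro ⟨p, hp, q, hq, e⟩
        obtain ⟨u, v, rfl, rfl, e'⟩ := exists_adj_of_contractEdge_adj hxy e
        exact ⟨u, hp, v, hq, e'⟩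

theorem Reach.of_induce {V : Type u} {G : SimpleGraph V} {X : Set V} {Y : Set X} {a b : X}
    (r : Reach (G.induce X) Y a b) : Reach G (Subtype.val '' Y) a b := by
  induction r with
  | refl => exact ReflTransGen.refl
  | tail _ e ih => exact ih.tail ⟨e.1, ⟨_, e.2.1, rfl⟩, ⟨_, e.2.2, rfl⟩⟩

theorem HasInducedMinor.exists_model {V : Type u} {W : Type v} {G : SimpleGraph V}
    {H : SimpleGraph W} (h : HasInducedMinor G H) : ∃ φ : W → Set V, IsModel G H φ := by
  obtain ⟨X, h⟩ := h
  obtain ⟨φ, h1, h2⟩ := h.exists_model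
  refine ⟨fun w => Subtype.val '' φ w, fun w => ⟨(h1 w).1.image _, ?_⟩, fun a b hab => ⟨?_, ?_⟩⟩
  · rintro _ ⟨u, hu, rfl⟩ _ ⟨v, hv, rfl⟩
    exact ((h1 w).2 u hu v hv).of_induce
  · exact (Set.disjoint_image_iff Subtype.val_injective).2 (h2 a b hab).1
  · rw [← (h2 a b hab).2]
    constructor
    · rintro ⟨_, ⟨u, hu, rfl⟩, _, ⟨v, hv, rfl⟩, e⟩
      exact ⟨u, hu, v, hv, e⟩
    · rintro ⟨u, hu, v, hv, e⟩
      exact ⟨_, ⟨u, hu, rfl⟩, _, ⟨v, hv, rfl⟩, e⟩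

/-! ### Pigeonhole and Ramsey -/

theorem exists_common_value {α : Type*} {β : Type*} {K : Finset α} {E : Finset β}
    {R : α → β → Prop} {c n : ℕ} (hE : E.card ≤ c) (h : ∀ k ∈ K, ∃ j ∈ E, R k j)
    (hK : c * n < K.card) : ∃ j ∈ E, ∃ K' ⊆ K, K'.card = n ∧ ∀ k ∈ K', R k j := by
  classical
  obtain ⟨k₀, hk₀⟩ : K.Nonempty := Finset.card_pos.1 (by omega)
  have : Nonempty β := ⟨(h k₀ hk₀).choose⟩
  choose! f hf hR using h
  obtain ⟨j, hj, hc⟩ := Finset.exists_lt_card_fiber_of_mul_lt_card_of_maps_to (s := K) (t := E)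
    (f := f) (n := n) hf (lt_of_le_of_lt (Nat.mul_le_mul_right _ hE) hK)
  obtain ⟨K', hK', hn⟩ := Finset.exists_subset_card_eq hc.le
  refine ⟨j, hj, K', hK'.trans (Finset.filter_subset _ _), hn, fun k hk => ?_⟩
  have := Finset.mem_filter.1 (hK' hk)
  exact this.2 ▸ hR k this.1

/-- First step to Ramsey's theorem: a list in which the colour of a pair depends on the first entry
only. -/
theorem exists_endhomogeneous_list (m c : ℕ) : ∃ F : ℕ, ∀ {α : Type u} {β : Type v}
    (K : Finset α) (f : α → α → β) (C : Finset β), C.card ≤ c →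
    (∀ a ∈ K, ∀ b ∈ K, a ≠ b → f a b ∈ C) → F ≤ K.card →
    ∃ l : List α, l.Nodup ∧ l.length = m ∧ (∀ x ∈ l, x ∈ K) ∧ ∃ g : α → β, (∀ x ∈ l, g x ∈ C) ∧
      l.Pairwise (fun a b => f a b = g a) := by
  classical
  induction m with
  | zero =>
    refine ⟨2, fun K f C _ h hK => ⟨[], by simp, rfl, by simp, ?_⟩⟩
    obtain ⟨a, ha, b, hb, hab⟩ := Finset.one_lt_card.1 hK
    exact ⟨fun _ => f a b, by simp, by simp⟩
  | succ m ih =>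
    obtain ⟨F, hF⟩ := ih
    refine ⟨c * F + 2, fun {α β} K f C hC h hK => ?_⟩
    obtain ⟨a, ha⟩ : K.Nonempty := Finset.card_pos.1 (by omega)
    have hKa : (K.erase a).card = K.card - 1 := Finset.card_erase_of_mem ha
    obtain ⟨j, hj, K', hK', hcard, hR⟩ := exists_common_value (K := K.erase a)
      (R := fun k j => f a k = j) (n := F) hC
      (fun k hk => ⟨f a k, h a ha k (Finset.mem_of_mem_erase hk) (Finset.ne_of_mem_erase hk).symm,
        rfl⟩) (by omega)
    have hK'K : K' ⊆ K := hK'.trans (Finset.erase_subset _ _)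
    obtain ⟨l, hl, hlen, hlK, g, hg, hp⟩ := hF K' f C hC
      (fun x hx y hy => h x (hK'K hx) y (hK'K hy)) hcard.ge
    have hal : a ∉ l := fun hm => Finset.notMem_erase a K (hK' (hlK a hm))
    refine ⟨a :: l, List.nodup_cons.2 ⟨hal, hl⟩, by simp [hlen], ?_, Function.update g a j, ?_, ?_⟩
    · intro x hx
      rcases List.mem_cons.1 hx with rfl | hx
      · exact ha
      · exact hK'K (hlK x hx)
    · intro x hx
      rcases List.mem_cons.1 hx with rfl | hxl
      · simpa using hj
      · rw [Function.update_of_ne (by rintro rfl; exact hal hxl)]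
        exact hg x hxl
    · refine List.pairwise_cons.2 ⟨fun b hb => by simpa using hR b (hlK b hb), ?_⟩
      refine hp.imp_of_mem fun {x y} hx _ e => ?_
      rw [Function.update_of_ne (by rintro rfl; exact hal hx)]
      exact e

/-- Ramsey's theorem for pairs. The colour of a pair may depend on the order, so the homogeneous
set comes as a list, and only pairs in the order of the list are constrained. -/
theorem exists_homogeneous_list (n c : ℕ) : ∃ F : ℕ, ∀ {α : Type u} {β : Type v}
    (K : Finset α) (f : α → α → β) (C : Finset β), C.card ≤ c →
    (∀ a ∈ K, ∀ b ∈ K, a ≠ b → f a b ∈ C) → F ≤ K.card →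
    ∃ l : List α, l.Nodup ∧ l.length = n ∧ (∀ x ∈ l, x ∈ K) ∧ ∃ j : β,
      l.Pairwise (fun a b => f a b = j) := by
  classical
  obtain ⟨F, hF⟩ := exists_endhomogeneous_list.{u, v} (c * n + 1) c
  refine ⟨F, fun {α β} K f C hC h hK => ?_⟩
  obtain ⟨l, hl, hlen, hlK, g, hg, hp⟩ := hF K f C hC h hK
  obtain ⟨j, -, K', hK', hcard, hR⟩ := exists_common_value (K := l.toFinset)
    (R := fun k j => g k = j) (n := n) hC (fun k hk => ⟨g k, hg k (by simpa using hk), rfl⟩)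
    (by rw [List.toFinset_card_of_nodup hl]; omega)
  have hsub : (l.filter (· ∈ K')).Sublist l := List.filter_sublist
  have hlen' : (l.filter (· ∈ K')).length = n := by
    rw [← List.toFinset_card_of_nodup (hl.sublist hsub), ← hcard]
    congr 1
    ext x
    simp only [List.mem_toFinset, List.mem_filter, decide_eq_true_eq]
    exact ⟨fun e => e.2, fun e => ⟨by simpa using hK' e, e⟩⟩
  refine ⟨l.filter (· ∈ K'), hl.sublist hsub, hlen', fun x hx => hlK x (hsub.subset hx), j, ?_⟩
  refine (hp.sublist hsub).imp_of_mem fun {x y} hx _ e => ?_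
  rw [e]
  exact hR x (by simpa using (List.mem_filter.1 hx).2)

/-! ### Domination from a root -/

/-- The vertices of `H` that cannot be reached inside `H` from the root `r` without passing
through `v`. -/
def dominated {V : Type u} (G : SimpleGraph V) (H : Set V) (r v : V) : Set V :=
  {w | w ∈ H ∧ ¬ Reach G (H \ {v}) r w}

section
variable {V : Type u} {G : SimpleGraph V} {H : Set V} {r : V}

theorem Reach.eq_or_mem {X : Set V} {a b : V} (h : Reach G X a b) : a = b ∨ b ∈ X := by
  cases h with
  | refl => exact Or.inl rfl
  | tail _ e => exact Or.inr e.2.2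

theorem Reach.avoid {X : Set V} {a b x : V} (h : Reach G X a b) (hx : ¬ Reach G X a x) :
    Reach G (X \ {x}) a b := by
  induction h with
  | refl => exact ReflTransGen.refl
  | @tail p q hp e ih =>
    refine ih.tail ⟨e.1, ⟨e.2.1, ?_⟩, e.2.2, ?_⟩
    · rintro rfl; exact hx hp
    · rintro rfl; exact hx (hp.tail e)

theorem dominated_subset (v : V) : dominated G H r v ⊆ H := fun _ h => h.1

theorem mem_dominated_self {v : V} (hv : v ∈ H) (hvr : v ≠ r) : v ∈ dominated G H r v := by
  refine ⟨hv, fun h => ?_⟩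
  rcases h.eq_or_mem with h | h
  · exact hvr h.symm
  · exact h.2 rfl

theorem root_notMem_dominated (v : V) : r ∉ dominated G H r v :=
  fun h => h.2 ReflTransGen.refl

theorem dominated_trans {x w : V} (hx : x ∈ dominated G H r w) :
    dominated G H r x ⊆ dominated G H r w := by
  refine fun y hy => ⟨hy.1, fun h => hy.2 ?_⟩
  exact (h.avoid hx.2).mono (Set.sdiff_subset_sdiff_left Set.sdiff_subset)

theorem eq_of_adj_dominated {v x y : V} (hx : x ∈ H) (hxv : x ∉ dominated G H r v) (hne : x ≠ v)
    (hy : y ∈ dominated G H r v) (e : G.Adj x y) : y = v := by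
  by_contra hyv
  have hr : Reach G (H \ {v}) r x := by
    by_contra h; exact hxv ⟨hx, h⟩
  exact hy.2 (hr.trans (Reach.of_adj e ⟨hx, hne⟩ ⟨hy.1, hyv⟩))

theorem reach_dominated (hH : Conn G H) (hr : r ∈ H) {v w : V} (hv : v ∈ H) (hvr : v ≠ r)
    (hw : w ∈ dominated G H r v) : Reach G (dominated G H r v) v w := by
  by_contra hcon
  have hvv : v ∈ dominated G H r v := mem_dominated_self hv hvr
  obtain ⟨x, hx, y, -, hxY, hyY, e⟩ := hH.exists_edge hr hw.1
    (Y := {z | z ∈ dominated G H r v → Reach G (dominated G H r v) v z})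
    (fun h => absurd h (root_notMem_dominated v)) (fun h => hcon (h hw))
  simp only [Set.mem_ofPred_eq, Classical.not_imp] at hxY hyY
  by_cases hxd : x ∈ dominated G H r v
  · exact hyY.2 ((hxY hxd).trans (Reach.of_adj e hxd hyY.1))
  · have := eq_of_adj_dominated hx hxd (by rintro rfl; exact hxd hvv) hyY.1 e
    subst this
    exact hyY.2 ReflTransGen.refl

theorem conn_dominated (hH : Conn G H) (hr : r ∈ H) {v : V} (hv : v ∈ H) (hvr : v ≠ r) :
    Conn G (dominated G H r v) :=
  Conn.of_root v fun _ hw => reach_dominated hH hr hv hvr hw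

theorem dominated_antisymm (hH : Conn G H) (hr : r ∈ H) {w x : V} (hw : w ∈ H) (hwr : w ≠ r)
    (hx : x ∈ dominated G H r w) (hxw : x ≠ w) : w ∉ dominated G H r x := by
  rintro ⟨-, hcon⟩
  have hww : w ∈ dominated G H r w := mem_dominated_self hw hwr
  obtain ⟨p, hp, q, hq, hpY, hqY, e⟩ := hH.exists_edge hr hw
    (Y := {z | z ∉ dominated G H r w}) (root_notMem_dominated w) (fun h => h hww)
  simp only [Set.mem_ofPred_eq, not_not] at hpY hqY
  have := eq_of_adj_dominated hp hpY (by rintro rfl; exact hpY hww) hqY e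
  subst this
  have hr' : Reach G (H \ {q}) r p := by
    by_contra h; exact hpY ⟨hp, h⟩
  refine hcon (((hr'.avoid hx.2).mono (Set.sdiff_subset_sdiff_left Set.sdiff_subset)).trans
    (Reach.of_adj e ⟨hp, ?_⟩ ⟨hq, hxw.symm⟩))
  rintro rfl
  exact hpY hx

/-- The dominated sets form a laminar family: two of them that meet are nested. -/
theorem dominated_laminar (hH : Conn G H) (hr : r ∈ H) {c c' x : V} (hc : c ∈ H) (hcr : c ≠ r)
    (hx : x ∈ dominated G H r c) (hx' : x ∈ dominated G H r c') :
    c ∈ dominated G H r c' ∨ c' ∈ dominated G H r c := by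
  by_contra hcon
  push Not at hcon
  have h1 : Reach G (H \ {c'}) r c := by
    by_contra h; exact hcon.1 ⟨hc, h⟩
  have hsub : dominated G H r c ⊆ H \ {c'} := by
    refine fun y hy => ⟨hy.1, ?_⟩
    rintro rfl
    exact hcon.2 hy
  exact hx'.2 (h1.trans ((reach_dominated hH hr hc hcr hx).mono hsub))

theorem conn_diff_dominated (v : V) : Conn G (H \ dominated G H r v) := by
  refine Conn.of_root r ?_
  have key : ∀ x, Reach G (H \ {v}) r x → Reach G (H \ dominated G H r v) r x := by
    intro x h
    induction h with
    | refl => exact ReflTransGen.refl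
    | @tail p q hp e ih =>
      exact ih.tail ⟨e.1, ⟨e.2.1.1, fun h => h.2 hp⟩, e.2.2.1, fun h => h.2 (hp.tail e)⟩
  rintro x ⟨hx, hxd⟩
  refine key x ?_
  by_contra h; exact hxd ⟨hx, h⟩

/-- Domination from `r` passes to domination from `c` inside the set dominated by `c`, which is what
makes recursion on dominated sets possible. -/
theorem dominated_subset_dominated_dominated (hH : Conn G H) (hr : r ∈ H) {c v : V} (hc : c ∈ H)
    (hcr : c ≠ r) (hv : v ∈ dominated G H r c) (hvc : v ≠ c) :
    dominated G H r v ⊆ dominated G (dominated G H r c) c v := by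
  intro w hw
  refine ⟨dominated_trans hv hw, fun h => hw.2 ?_⟩
  have h1 : Reach G (H \ {v}) r c := by
    by_contra h1
    exact dominated_antisymm hH hr hc hcr hv hvc ⟨hc, h1⟩
  exact h1.trans (h.mono (Set.sdiff_subset_sdiff_left (dominated_subset c)))

/-- The maximal elements of the domination order below the root. -/
def topSet (G : SimpleGraph V) (H : Set V) (r : V) : Set V :=
  {c | c ∈ H ∧ c ≠ r ∧ ∀ v ∈ H, v ≠ r → c ∈ dominated G H r v → v = c}

theorem exists_topSet [Finite V] (hH : Conn G H) (hr : r ∈ H) {x : V} (hx : x ∈ H)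
    (hxr : x ≠ r) : ∃ c ∈ topSet G H r, x ∈ dominated G H r c := by
  obtain ⟨c, hc, hmax⟩ := Set.exists_max_image {v | v ∈ H ∧ v ≠ r ∧ x ∈ dominated G H r v}
    (fun v => (dominated G H r v).ncard) (Set.toFinite _) ⟨x, hx, hxr, mem_dominated_self hx hxr⟩
  refine ⟨c, ⟨hc.1, hc.2.1, fun v hv hvr hcv => ?_⟩, hc.2.2⟩
  have hsub := dominated_trans hcv
  have heq := Set.eq_of_subset_of_ncard_le hsub (hmax v ⟨hv, hvr, hsub hc.2.2⟩) (Set.toFinite _)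
  by_contra hne
  exact dominated_antisymm hH hr hv hvr hcv (Ne.symm hne)
    (heq ▸ mem_dominated_self hv hvr)

theorem topSet_disjoint (hH : Conn G H) (hr : r ∈ H) {c c' : V} (hc : c ∈ topSet G H r)
    (hc' : c' ∈ topSet G H r) (hne : c ≠ c') {x : V} (hx : x ∈ dominated G H r c) :
    x ∉ dominated G H r c' := by
  intro hx'
  rcases dominated_laminar hH hr hc.1 hc.2.1 hx hx' with h | h
  · exact hne (hc.2.2 c' hc'.1 hc'.2.1 h).symm
  · exact hne (hc'.2.2 c hc.1 hc.2.1 h)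

theorem topSet_not_adj (hH : Conn G H) (hr : r ∈ H) {c c' : V} (hc : c ∈ topSet G H r)
    (hc' : c' ∈ topSet G H r) (hne : c ≠ c') {x y : V} (hx : x ∈ dominated G H r c)
    (hxc : x ≠ c) (hy : y ∈ dominated G H r c') : x ≠ y ∧ ¬ G.Adj x y := by
  have hyc := topSet_disjoint hH hr hc' hc hne.symm hy
  refine ⟨by rintro rfl; exact hyc hx, fun e => hxc ?_⟩
  exact eq_of_adj_dominated hy.1 hyc
    (by rintro rfl; exact hyc (mem_dominated_self hc.1 hc.2.1)) hx e.symm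

theorem conn_insert_topSet [Finite V] (hH : Conn G H) (hr : r ∈ H) :
    Conn G (insert r (topSet G H r)) := by
  -- Each edge of `H` stays inside one of the sets dominated by a top vertex or is an edge between
  -- the root and top vertices, so reachability from the root projects to the top set.
  have key : ∀ x, Reach G H r x → (x = r ∨ ∀ c ∈ topSet G H r, x ∈ dominated G H r c →
      Reach G (insert r (topSet G H r)) r c) := by
    intro x h
    induction h with
    | refl => exact Or.inl rfl
    | @tail p q _ e ih =>
      right
      intro c hc hq
      have hcc := mem_dominated_self (G := G) hc.1 hc.2.1
      have hcm : c ∈ insert r (topSet G H r) := Or.inr hc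
      rcases ih with rfl | ih
      · have := eq_of_adj_dominated e.2.1 (root_notMem_dominated c) hc.2.1.symm hq e.1
        subst this
        exact Reach.of_adj e.1 (Or.inl rfl) hcm
      · by_cases hpc : p ∈ dominated G H r c
        · exact ih c hc hpc
        have := eq_of_adj_dominated e.2.1 hpc (by rintro rfl; exact hpc hcc) hq e.1
        subst this
        by_cases hpr : p = r
        · subst hpr
          exact Reach.of_adj e.1 (Or.inl rfl) hcm
        obtain ⟨d, hd, hpd⟩ := exists_topSet hH hr e.2.1 hpr
        have hdq : d ≠ q := by rintro rfl; exact hpc hpd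
        have hpd' : p = d := by
          by_contra hne
          exact (topSet_not_adj hH hr hd hc hdq hpd hne hcc).2 e.1
        subst hpd'
        exact (ih p hd hpd).trans (Reach.of_adj e.1 (Or.inr hd) hcm)
  refine Conn.of_root r ?_
  rintro x (rfl | hx)
  · exact ReflTransGen.refl
  · rcases key x (hH r hr x hx.1) with rfl | h
    · exact ReflTransGen.refl
    · exact h x hx (mem_dominated_self hx.1 hx.2.1)

/-- A connected graph with many vertices has a vertex of large degree or a long induced path. -/
theorem Conn.exists_degree_or_path [Finite V] {X : Set V} (hX : Conn G X) (hr : r ∈ X) (n D : ℕ)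
    (hc : n * (D + 1) ^ n < X.ncard) :
    (∃ v ∈ X, D < {u | u ∈ X ∧ G.Adj v u}.ncard) ∨
      ∃ l : List V, IsInducedPath G l ∧ (∀ x ∈ l, x ∈ X) ∧ l.head? = some r ∧ n < l.length := by
  classical
  have := Fintype.ofFinite V
  by_contra hcon
  push Not at hcon
  obtain ⟨hdeg, hpath⟩ := hcon
  let Z : ℕ → Finset V := fun m => Finset.univ.filter fun x => ∃ l : List V,
    IsInducedPath G l ∧ (∀ x ∈ l, x ∈ X) ∧ l.head? = some r ∧ l.getLast? = some x ∧
      l.length = m + 1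
  have hZ : ∀ m, (Z m).card ≤ (D + 1) ^ m := by
    intro m
    induction m with
    | zero =>
      refine (Finset.card_le_card (t := {r}) fun x hx => ?_).trans (by simp)
      obtain ⟨l, -, -, h1, h2, h3⟩ := (Finset.mem_filter.1 hx).2
      obtain ⟨a, rfl⟩ := List.length_eq_one_iff.1 h3
      simp at h1 h2 ⊢
      rw [← h2, h1]
    | succ m ih =>
      have hsub : Z (m + 1) ⊆ (Z m).biUnion
          fun y => Finset.univ.filter fun u => u ∈ X ∧ y ∈ X ∧ G.Adj y u := by
        intro x hx
        obtain ⟨l, hl, hlX, h1, h2, h3⟩ := (Finset.mem_filter.1 hx).2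
        have hne : l ≠ [] := by rintro rfl; simp at h3
        obtain ⟨l, z, rfl⟩ := (List.eq_nil_or_concat l).resolve_left hne
        rw [List.concat_eq_append] at *
        simp at h2
        subst h2
        have hne' : l ≠ [] := by rintro rfl; simp at h3
        obtain ⟨l, y, rfl⟩ := (List.eq_nil_or_concat l).resolve_left hne'
        rw [List.concat_eq_append] at *
        have hyz : G.Adj y z := by
          have : IsInducedPath G (l ++ [y, z]) := by simpa using hl
          exact (this.right.1 z (by simp)).2.2 rfl
        refine Finset.mem_biUnion.2 ⟨y, Finset.mem_filter.2 ⟨Finset.mem_univ _, l ++ [y], hl.left,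
          fun x hx => hlX x (List.mem_append_left _ hx), ?_, by simp, by simpa using h3⟩,
          Finset.mem_filter.2 ⟨Finset.mem_univ _, hlX z (by simp), hlX y (by simp), hyz⟩⟩
        rw [← h1]
        cases l <;> simp
      refine (Finset.card_le_card hsub).trans
        ((Finset.card_biUnion_le_card_mul _ _ (D + 1) fun y _ => ?_).trans ?_)
      · by_cases hy : y ∈ X
        · have h1 := hdeg y hy
          rw [Set.ncard_eq_toFinset_card'] at h1
          refine (Finset.card_le_card ?_).trans (h1.trans (Nat.le_succ D))
          intro u hu
          have := (Finset.mem_filter.1 hu).2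
          simpa using ⟨this.1, this.2.2⟩
        · rw [Finset.filter_false_of_mem]
          · simp
          · rintro u - ⟨-, h, -⟩
            exact hy h
      · rw [pow_succ]
        exact Nat.mul_le_mul_right _ ih
  have hcov : X.toFinset ⊆ (Finset.range n).biUnion Z := by
    intro x hx
    rw [Set.mem_toFinset] at hx
    obtain ⟨l, a, b, hl, hlX, h1, h2, rfl, rfl, -⟩ :=
      hX.exists_path (S := {r}) (T := {x}) ⟨r, hr, rfl⟩ ⟨x, hx, rfl⟩
    have hlen := hpath l hl hlX h1
    have hpos : 0 < l.length := List.length_pos_of_mem (head?_mem h1)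
    exact Finset.mem_biUnion.2 ⟨l.length - 1, Finset.mem_range.2 (by omega),
      Finset.mem_filter.2 ⟨Finset.mem_univ _, l, hl, hlX, h1, h2, by omega⟩⟩
  have h1 := (Finset.card_le_card hcov).trans (Finset.card_biUnion_le_card_mul _ _ ((D + 1) ^ n)
    fun m hm => (hZ m).trans (Nat.pow_le_pow_right (Nat.succ_pos _) (Finset.mem_range.1 hm).le))
  rw [Finset.card_range, ← Set.ncard_eq_toFinset_card'] at h1
  omega

end

/-! ### Connected sets reaching many terminal sets -/

/-- The connected set `H` reaches the terminal sets `T k`, `k ∈ S`, through a clique: the vertices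
`p k` are pairwise adjacent, and from `p k` a private connected leg `L k` leads to `T k`. The leg
is empty when `p k` itself lies in `T k`. -/
structure CliqueType {V : Type u} {κ : Type v} (G : SimpleGraph V) (H : Set V) (T : κ → Set V)
    (S : Finset κ) (p : κ → V) (L : κ → Set V) : Prop where
  port_mem : ∀ k ∈ S, p k ∈ H
  leg_sub : ∀ k ∈ S, L k ⊆ H
  leg : ∀ k ∈ S, (L k = ∅ ∧ p k ∈ T k) ∨
    (Conn G (L k) ∧ Touches G {p k} (L k) ∧ ∃ x ∈ L k, x ∈ T k)
  port_notMem : ∀ k ∈ S, p k ∉ L k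
  adj : ∀ k ∈ S, ∀ l ∈ S, k ≠ l → G.Adj (p k) (p l)
  port_leg : ∀ k ∈ S, ∀ l ∈ S, k ≠ l → Anticomplete G {p k} (L l)
  leg_leg : ∀ k ∈ S, ∀ l ∈ S, k ≠ l → Anticomplete G (L k) (L l)
  port_private : ∀ k ∈ S, ∀ l ∈ S, k ≠ l → p k ∉ T l
  leg_private : ∀ k ∈ S, ∀ l ∈ S, k ≠ l → ∀ x ∈ L k, x ∉ T l

/-- The connected set `H` reaches the terminal sets `T k`, `k ∈ S`, from an induced path `Q`: a
private connected leg `L k` attached to `Q` leads to `T k`. The leg is empty when `Q` itself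
meets `T k`. -/
structure PathType {V : Type u} {κ : Type v} (G : SimpleGraph V) (H : Set V) (T : κ → Set V)
    (S : Finset κ) (Q : List V) (L : κ → Set V) : Prop where
  path : IsInducedPath G Q
  path_sub : ∀ x ∈ Q, x ∈ H
  leg_sub : ∀ k ∈ S, L k ⊆ H
  leg : ∀ k ∈ S, (L k = ∅ ∧ ∃ x ∈ Q, x ∈ T k) ∨
    (Conn G (L k) ∧ Touches G {x | x ∈ Q} (L k) ∧ ∃ x ∈ L k, x ∈ T k)
  path_notMem : ∀ k ∈ S, ∀ x ∈ Q, x ∉ L k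
  leg_leg : ∀ k ∈ S, ∀ l ∈ S, k ≠ l → Anticomplete G (L k) (L l)
  leg_private : ∀ k ∈ S, ∀ l ∈ S, k ≠ l → ∀ x ∈ L k, x ∉ T l

section
variable {V : Type u} {G : SimpleGraph V} {H : Set V} {r : V} {κ : Type v} {ι : Type w}

theorem CliqueType.mono {H' : Set V} {T T' : κ → Set V} {S : Finset κ} {p : κ → V}
    {L : κ → Set V} (h : CliqueType G H T S p L) (hH : H ⊆ H')
    (hT : ∀ k ∈ S, ∀ x ∈ H, x ∈ T k ↔ x ∈ T' k) : CliqueType G H' T' S p L where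
  port_mem k hk := hH (h.port_mem k hk)
  leg_sub k hk := (h.leg_sub k hk).trans hH
  leg k hk := by
    rcases h.leg k hk with ⟨h1, h2⟩ | ⟨h1, h2, x, h3, h4⟩
    · exact Or.inl ⟨h1, (hT k hk _ (h.port_mem k hk)).1 h2⟩
    · exact Or.inr ⟨h1, h2, x, h3, (hT k hk _ (h.leg_sub k hk h3)).1 h4⟩
  port_notMem := h.port_notMem
  adj := h.adj
  port_leg := h.port_leg
  leg_leg := h.leg_leg
  port_private k hk l hl hne hx :=
    h.port_private k hk l hl hne ((hT l hl _ (h.port_mem k hk)).2 hx)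
  leg_private k hk l hl hne x hx hxT :=
    h.leg_private k hk l hl hne x hx ((hT l hl _ (h.leg_sub k hk hx)).2 hxT)

theorem PathType.mono {H' : Set V} {T T' : κ → Set V} {S : Finset κ} {Q : List V}
    {L : κ → Set V} (h : PathType G H T S Q L) (hH : H ⊆ H')
    (hT : ∀ k ∈ S, ∀ x ∈ H, x ∈ T k ↔ x ∈ T' k) : PathType G H' T' S Q L where
  path := h.path
  path_sub x hx := hH (h.path_sub x hx)
  leg_sub k hk := (h.leg_sub k hk).trans hH
  leg k hk := by
    rcases h.leg k hk with ⟨h1, x, h2, h3⟩ | ⟨h1, h2, x, h3, h4⟩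
    · exact Or.inl ⟨h1, x, h2, (hT k hk _ (h.path_sub x h2)).1 h3⟩
    · exact Or.inr ⟨h1, h2, x, h3, (hT k hk _ (h.leg_sub k hk h3)).1 h4⟩
  path_notMem := h.path_notMem
  leg_leg := h.leg_leg
  leg_private k hk l hl hne x hx hxT :=
    h.leg_private k hk l hl hne x hx ((hT l hl _ (h.leg_sub k hk hx)).2 hxT)

theorem CliqueType.subset {T : κ → Set V} {S K' : Finset κ} {p : κ → V} {L : κ → Set V}
    (h : CliqueType G H T S p L) (hK' : K' ⊆ S) : CliqueType G H T K' p L := by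
  constructor
  · exact fun k hk => h.port_mem k (hK' hk)
  · exact fun k hk => h.leg_sub k (hK' hk)
  · exact fun k hk => h.leg k (hK' hk)
  · exact fun k hk => h.port_notMem k (hK' hk)
  · exact fun k hk l hl => h.adj k (hK' hk) l (hK' hl)
  · exact fun k hk l hl => h.port_leg k (hK' hk) l (hK' hl)
  · exact fun k hk l hl => h.leg_leg k (hK' hk) l (hK' hl)
  · exact fun k hk l hl => h.port_private k (hK' hk) l (hK' hl)
  · exact fun k hk l hl => h.leg_private k (hK' hk) l (hK' hl)

theorem exists_section [DecidableEq κ] [Nonempty ι] (U : Finset ι) (f : ι → κ) :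
    ∃ g : κ → ι, ∀ k ∈ U.image f, g k ∈ U ∧ f (g k) = k := by
  have : ∀ k, ∃ i, k ∈ U.image f → i ∈ U ∧ f i = k := by
    intro k
    by_cases hk : k ∈ U.image f
    · obtain ⟨i, hi, e⟩ := Finset.mem_image.1 hk
      exact ⟨i, fun _ => ⟨hi, e⟩⟩
    · exact ⟨Classical.arbitrary ι, fun h => absurd h hk⟩
  choose g hg using this
  exact ⟨g, hg⟩

/-- Of several indices with the same terminal set, one is kept. -/
theorem CliqueType.reindex [DecidableEq κ] [Nonempty ι] {T : κ → Set V} {U : Finset ι} {f : ι → κ}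
    {p : ι → V} {L : ι → Set V} (h : CliqueType G H (fun i => T (f i)) U p L) :
    ∃ p' L', CliqueType G H T (U.image f) p' L' := by
  obtain ⟨g, hg⟩ := exists_section U f
  have hne : ∀ {k l : κ}, k ∈ U.image f → l ∈ U.image f → k ≠ l → g k ≠ g l := by
    intro k l hk hl hkl e
    exact hkl (by rw [← (hg k hk).2, ← (hg l hl).2, e])
  refine ⟨fun k => p (g k), fun k => L (g k), ?_⟩
  constructor
  · exact fun k hk => h.port_mem _ (hg k hk).1
  · exact fun k hk => h.leg_sub _ (hg k hk).1
  · intro k hk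
    simpa [(hg k hk).2] using h.leg _ (hg k hk).1
  · exact fun k hk => h.port_notMem _ (hg k hk).1
  · exact fun k hk l hl e => h.adj _ (hg k hk).1 _ (hg l hl).1 (hne hk hl e)
  · exact fun k hk l hl e => h.port_leg _ (hg k hk).1 _ (hg l hl).1 (hne hk hl e)
  · exact fun k hk l hl e => h.leg_leg _ (hg k hk).1 _ (hg l hl).1 (hne hk hl e)
  · intro k hk l hl e
    simpa [(hg l hl).2] using h.port_private _ (hg k hk).1 _ (hg l hl).1 (hne hk hl e)
  · intro k hk l hl e
    simpa [(hg l hl).2] using h.leg_private _ (hg k hk).1 _ (hg l hl).1 (hne hk hl e)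

theorem PathType.reindex [DecidableEq κ] [Nonempty ι] {T : κ → Set V} {U : Finset ι} {f : ι → κ}
    {Q : List V} {L : ι → Set V} (h : PathType G H (fun i => T (f i)) U Q L) :
    ∃ L', PathType G H T (U.image f) Q L' := by
  obtain ⟨g, hg⟩ := exists_section U f
  have hne : ∀ {k l : κ}, k ∈ U.image f → l ∈ U.image f → k ≠ l → g k ≠ g l := by
    intro k l hk hl hkl e
    exact hkl (by rw [← (hg k hk).2, ← (hg l hl).2, e])
  refine ⟨fun k => L (g k), ?_⟩
  constructor
  · exact h.path
  · exact h.path_sub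
  · exact fun k hk => h.leg_sub _ (hg k hk).1
  · intro k hk
    simpa [(hg k hk).2] using h.leg _ (hg k hk).1
  · exact fun k hk => h.path_notMem _ (hg k hk).1
  · exact fun k hk l hl e => h.leg_leg _ (hg k hk).1 _ (hg l hl).1 (hne hk hl e)
  · intro k hk l hl e
    simpa [(hg l hl).2] using h.leg_private _ (hg k hk).1 _ (hg l hl).1 (hne hk hl e)

theorem PathType.insert_leg [DecidableEq κ] {T : κ → Set V} {S : Finset κ} {Q : List V}
    {L : κ → Set V} (h : PathType G H T S Q L) {k₀ : κ} (hk₀ : k₀ ∉ S) {M : Set V} (hM : M ⊆ H)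
    (hleg : (M = ∅ ∧ ∃ x ∈ Q, x ∈ T k₀) ∨
      (Conn G M ∧ Touches G {x | x ∈ Q} M ∧ ∃ x ∈ M, x ∈ T k₀))
    (hQ : ∀ x ∈ Q, x ∉ M) (hL : ∀ k ∈ S, Anticomplete G M (L k))
    (hMT : ∀ k ∈ S, ∀ x ∈ M, x ∉ T k) (hLT : ∀ k ∈ S, ∀ x ∈ L k, x ∉ T k₀) :
    PathType G H T (Insert.insert k₀ S) Q (Function.update L k₀ M) := by
  have hu : ∀ k ∈ S, Function.update L k₀ M k = L k :=
    fun k hk => Function.update_of_ne (by rintro rfl; exact hk₀ hk) _ _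
  have hu₀ : Function.update L k₀ M k₀ = M := Function.update_self _ _ _
  constructor
  · exact h.path
  · exact h.path_sub
  · intro k hk
    rcases Finset.mem_insert.1 hk with rfl | hk
    · rwa [hu₀]
    · rw [hu k hk]; exact h.leg_sub k hk
  · intro k hk
    rcases Finset.mem_insert.1 hk with rfl | hk
    · rwa [hu₀]
    · rw [hu k hk]; exact h.leg k hk
  · intro k hk
    rcases Finset.mem_insert.1 hk with rfl | hk
    · rwa [hu₀]
    · rw [hu k hk]; exact h.path_notMem k hk
  · intro k hk l hl hne
    rcases Finset.mem_insert.1 hk with rfl | hkS <;> rcases Finset.mem_insert.1 hl with rfl | hlS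
    · exact absurd rfl hne
    · rw [hu₀, hu l hlS]; exact hL l hlS
    · rw [hu₀, hu k hkS]; exact (hL k hkS).symm
    · rw [hu k hkS, hu l hlS]; exact h.leg_leg k hkS l hlS hne
  · intro k hk l hl hne
    rcases Finset.mem_insert.1 hk with rfl | hkS <;> rcases Finset.mem_insert.1 hl with rfl | hlS
    · exact absurd rfl hne
    · rw [hu₀]; exact hMT l hlS
    · rw [hu k hkS]; exact hLT k hkS
    · rw [hu k hkS]; exact h.leg_private k hkS l hlS hne

/-- From a top vertex `c` a leg runs inside the set dominated by `c` to any of its vertices. -/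
theorem exists_leg (hH : Conn G H) (hr : r ∈ H) {c t : V} (hc : c ∈ H) (hcr : c ≠ r)
    (ht : t ∈ dominated G H r c) : ∃ L ⊆ dominated G H r c, c ∉ L ∧
      ((L = ∅ ∧ c = t) ∨ (Conn G L ∧ Touches G {c} L ∧ t ∈ L)) := by
  obtain ⟨l, a, b, hl, hlX, h1, h2, rfl, rfl, -⟩ := (conn_dominated hH hr hc hcr).exists_path
    (S := {c}) (T := {t}) ⟨c, mem_dominated_self hc hcr, rfl⟩ ⟨t, ht, rfl⟩
  cases l with
  | nil => simp at h1
  | cons d l =>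
    simp only [List.head?_cons, Option.some.injEq] at h1
    subst h1
    refine ⟨{x | x ∈ l}, fun x hx => hlX x (List.mem_cons_of_mem _ hx),
      fun hm => (hl.1 d hm).1 rfl, ?_⟩
    cases l with
    | nil => left; simpa using h2
    | cons e l =>
      right
      rw [List.getLast?_cons_cons] at h2
      exact ⟨hl.2.conn, ⟨d, rfl, e, by simp, (hl.1 e (by simp)).2.2 rfl⟩, getLast?_mem h2⟩

/-- If many vertices are maximal in the domination order and each of them dominates a terminal,
then many terminals are reached through a clique or from an induced path. -/
theorem exists_type_of_topSet_large (n : ℕ) : ∃ M : ℕ, ∀ {V : Type u} [Finite V]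
    {G : SimpleGraph V} {H : Set V} {r : V} {κ : Type v} (K : Finset κ) (t : κ → V),
    Conn G H → r ∈ H → (∀ v ∈ H, v ≠ r → ∃ k ∈ K, t k ∈ dominated G H r v) →
    M ≤ (topSet G H r).ncard →
    (∃ S ⊆ K, S.card = n ∧ ∃ p L, CliqueType G H (fun k => {t k}) S p L) ∨
      ∃ S ⊆ K, S.card = n ∧ ∃ Q L, PathType G H (fun k => {t k}) S Q L := by
  classical
  obtain ⟨D, hD⟩ := exists_homogeneous_list.{u, 0} n 2
  refine ⟨n * (D + 1 + 1) ^ n, ?_⟩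
  intro V _ G H r κ K t hH hr hess hM
  have := Fintype.ofFinite V
  have hrtop : r ∉ topSet G H r := fun h => h.2.1 rfl
  have hX := conn_insert_topSet hH hr
  have hXcard : n * (D + 1 + 1) ^ n < (insert r (topSet G H r)).ncard := by
    rw [Set.ncard_insert_of_notMem hrtop]; omega
  have : Nonempty V := ⟨r⟩
  have hk : ∀ u ∈ topSet G H r, ∃ k ∈ K, t k ∈ dominated G H r u :=
    fun u hu => hess u hu.1 hu.2.1
  by_cases hκ : Nonempty κ
  swap
  · have hn : n = 0 := by
      by_contra hn
      have : (topSet G H r).Nonempty := by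
        apply Set.nonempty_of_ncard_ne_zero
        have : 0 < n * (D + 1 + 1) ^ n := by positivity
        omega
      obtain ⟨u, hu⟩ := this
      exact hκ ⟨(hk u hu).choose⟩
    subst hn
    exact Or.inr ⟨∅, by simp, rfl, [], fun _ => ∅, by constructor <;> simp [IsInducedPath]⟩
  choose! k hkK hkt using hk
  have hinj : ∀ U : Finset V, (∀ u ∈ U, u ∈ topSet G H r) → Set.InjOn k U := by
    intro U hU u hu u' hu' e
    by_contra hne
    exact topSet_disjoint hH hr (hU u hu) (hU u' hu') hne (hkt u (hU u hu))
      (e ▸ hkt u' (hU u' hu'))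
  have hlegs : ∀ u ∈ topSet G H r, ∃ L ⊆ dominated G H r u, u ∉ L ∧
      ((L = ∅ ∧ u = t (k u)) ∨ (Conn G L ∧ Touches G {u} L ∧ t (k u) ∈ L)) :=
    fun u hu => exists_leg hH hr hu.1 hu.2.1 (hkt u hu)
  choose! L hLsub hLnot hL using hlegs
  have himg : ∀ U : Finset V, (∀ u ∈ U, u ∈ topSet G H r) → U.card = n →
      U.image k ⊆ K ∧ (U.image k).card = n := by
    intro U hU hn
    refine ⟨?_, by rw [Finset.card_image_of_injOn (hinj U hU), hn]⟩
    intro x hx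
    obtain ⟨u, hu, rfl⟩ := Finset.mem_image.1 hx
    exact hkK u (hU u hu)
  have hself : ∀ u ∈ topSet G H r, u ∈ dominated G H r u :=
    fun u hu => mem_dominated_self hu.1 hu.2.1
  rcases hX.exists_degree_or_path (Or.inl rfl) n (D + 1) hXcard with ⟨v, hv, hdeg⟩ |
    ⟨l, hl, hlX, -, hlen⟩
  · -- A vertex of large degree: homogeneous neighbours give a clique or a star.
    let N : Finset V := Finset.univ.filter fun u => u ∈ topSet G H r ∧ G.Adj v u
    have hN : D ≤ N.card := by
      have hsub : {u | u ∈ insert r (topSet G H r) ∧ G.Adj v u} ⊆ insert r (N : Set V) := by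
        rintro u ⟨rfl | hu, e⟩
        · exact Or.inl rfl
        · exact Or.inr (by simpa [N] using ⟨hu, e⟩)
      have h1 := Set.ncard_le_ncard hsub (Set.toFinite _)
      have h2 := Set.ncard_insert_le r (N : Set V)
      rw [Set.ncard_coe_finset] at h2
      omega
    obtain ⟨l, hnd, hlen, hlN, col, hcol⟩ := hD N (fun a b => G.Adj a b) {True, False}
      (by simp) (fun a _ b _ _ => by by_cases h : G.Adj a b <;> simp [h]) hN
    have hall : ∀ a ∈ l, ∀ b ∈ l, a ≠ b → G.Adj a b = col := by
      have hs : Std.Symm (fun a b => G.Adj a b = col) :=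
        ⟨fun a b h => by rw [← h, G.adj_comm]⟩
      exact fun a ha b hb hab => hcol.forall ha hb hab
    let U := l.toFinset
    have hUtop : ∀ u ∈ U, u ∈ topSet G H r := fun u hu =>
      (Finset.mem_filter.1 (hlN u (List.mem_toFinset.1 hu))).2.1
    have hUadj : ∀ u ∈ U, G.Adj v u := fun u hu =>
      (Finset.mem_filter.1 (hlN u (List.mem_toFinset.1 hu))).2.2
    have hUn : U.card = n := by rw [List.toFinset_card_of_nodup hnd, hlen]
    obtain ⟨hS, hSn⟩ := himg U hUtop hUn
    by_cases hc : col
    · left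
      have hc' : CliqueType G H (fun u => {t (k u)}) U id L := by
        constructor
        · exact fun u hu => (hUtop u hu).1
        · exact fun u hu => (hLsub u (hUtop u hu)).trans (dominated_subset _)
        · intro u hu
          rcases hL u (hUtop u hu) with h | ⟨h1, h2, h3⟩
          · exact Or.inl h
          · exact Or.inr ⟨h1, h2, _, h3, rfl⟩
        · exact fun u hu => hLnot u (hUtop u hu)
        · intro u hu u' hu' hne
          have := hall u (List.mem_toFinset.1 hu) u' (List.mem_toFinset.1 hu') hne
          simpa [this] using hc
        · rintro u hu u' hu' hne _ rfl y hy
          have := topSet_not_adj hH hr (hUtop u' hu') (hUtop _ hu) hne.symm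
            (hLsub u' (hUtop u' hu') hy) (by rintro rfl; exact hLnot _ (hUtop _ hu') hy)
            (hself _ (hUtop _ hu))
          exact ⟨this.1.symm, fun e => this.2 e.symm⟩
        · intro u hu u' hu' hne x hx y hy
          exact topSet_not_adj hH hr (hUtop u hu) (hUtop _ hu') hne
            (hLsub u (hUtop u hu) hx) (by rintro rfl; exact hLnot _ (hUtop _ hu) hx)
            (hLsub u' (hUtop u' hu') hy)
        · intro u hu u' hu' hne hx
          exact topSet_disjoint hH hr (hUtop _ hu) (hUtop _ hu') hne (hself _ (hUtop _ hu))
            ((show u = t (k u') from hx) ▸ hkt _ (hUtop _ hu'))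
        · intro u hu u' hu' hne x hx hxt
          exact topSet_disjoint hH hr (hUtop _ hu) (hUtop _ hu') hne (hLsub u (hUtop u hu) hx)
            (by rw [Set.mem_singleton_iff.1 hxt]; exact hkt _ (hUtop _ hu'))
      obtain ⟨p', L', h⟩ := CliqueType.reindex (T := fun k => {t k}) (f := k) hc'
      exact ⟨_, hS, hSn, p', L', h⟩
    · right
      have hc' : PathType G H (fun u => {t (k u)}) U [v] (fun u => dominated G H r u) := by
        constructor
        · exact isInducedPath_singleton v
        · intro x hx
          rw [List.mem_singleton.1 hx]
          rcases hv with rfl | hv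
          · exact hr
          · exact hv.1
        · exact fun u _ => dominated_subset u
        · intro u hu
          exact Or.inr ⟨conn_dominated hH hr (hUtop u hu).1 (hUtop u hu).2.1,
            ⟨v, by simp, u, hself u (hUtop u hu), hUadj u hu⟩, _, hkt u (hUtop u hu), rfl⟩
        · intro u hu x hx hxd
          rw [List.mem_singleton.1 hx] at hxd
          rcases hv with rfl | hv
          · exact root_notMem_dominated _ hxd
          · exact topSet_disjoint hH hr hv (hUtop u hu) (hUadj u hu).ne (hself v hv) hxd
        · intro u hu u' hu' hne x hx y hy
          by_cases hxu : x = u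
          · by_cases hyu : y = u'
            · rw [hxu, hyu]
              have := hall u (List.mem_toFinset.1 hu) u' (List.mem_toFinset.1 hu') hne
              exact ⟨hne, by rw [this]; exact hc⟩
            · have := topSet_not_adj hH hr (hUtop u' hu') (hUtop _ hu) hne.symm hy hyu hx
              exact ⟨this.1.symm, fun e => this.2 e.symm⟩
          · exact topSet_not_adj hH hr (hUtop u hu) (hUtop _ hu') hne hx hxu hy
        · intro u hu u' hu' hne x hx hxt
          exact topSet_disjoint hH hr (hUtop _ hu) (hUtop _ hu') hne hx
            (by rw [Set.mem_singleton_iff.1 hxt]; exact hkt _ (hUtop _ hu'))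
      obtain ⟨L', h⟩ := PathType.reindex (T := fun k => {t k}) (f := k) hc'
      exact ⟨_, hS, hSn, _, L', h⟩
  · -- A long induced path: every vertex of it other than the root carries a leg.
    right
    have hcard : n ≤ (l.toFinset.erase r).card := by
      have := Finset.pred_card_le_card_erase (s := l.toFinset) (a := r)
      rw [List.toFinset_card_of_nodup hl.nodup] at this
      omega
    obtain ⟨U, hU, hUn⟩ := Finset.exists_subset_card_eq hcard
    have hUl : ∀ u ∈ U, u ∈ l := fun u hu => by
      simpa using Finset.mem_of_mem_erase (hU hu)
    have hUtop : ∀ u ∈ U, u ∈ topSet G H r := fun u hu =>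
      (hlX u (hUl u hu)).resolve_left (Finset.ne_of_mem_erase (hU hu))
    obtain ⟨hS, hSn⟩ := himg U hUtop hUn
    have hc' : PathType G H (fun u => {t (k u)}) U l L := by
      constructor
      · exact hl
      · intro x hx
        rcases hlX x hx with rfl | hx
        · exact hr
        · exact hx.1
      · exact fun u hu => (hLsub u (hUtop u hu)).trans (dominated_subset _)
      · intro u hu
        rcases hL u (hUtop u hu) with ⟨h1, h2⟩ | ⟨h1, h2, h3⟩
        · exact Or.inl ⟨h1, u, hUl u hu, h2⟩
        · exact Or.inr ⟨h1, h2.mono (by simpa using hUl u hu) subset_rfl, _, h3, rfl⟩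
      · intro u hu x hx hxL
        have hxd := hLsub u (hUtop u hu) hxL
        rcases hlX x hx with rfl | hx
        · exact root_notMem_dominated _ hxd
        · by_cases hxu : x = u
          · subst hxu
            exact hLnot _ hx hxL
          · exact topSet_disjoint hH hr hx (hUtop u hu) hxu (hself x hx) hxd
      · intro u hu u' hu' hne x hx y hy
        exact topSet_not_adj hH hr (hUtop u hu) (hUtop _ hu') hne
          (hLsub u (hUtop u hu) hx) (by rintro rfl; exact hLnot _ (hUtop _ hu) hx)
          (hLsub u' (hUtop u' hu') hy)
      · intro u hu u' hu' hne x hx hxt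
        exact topSet_disjoint hH hr (hUtop _ hu) (hUtop _ hu') hne (hLsub u (hUtop u hu) hx)
          (by rw [Set.mem_singleton_iff.1 hxt]; exact hkt _ (hUtop _ hu'))
    obtain ⟨L', h⟩ := PathType.reindex (T := fun k => {t k}) (f := k) hc'
    exact ⟨_, hS, hSn, _, L', h⟩

end

section
variable {V : Type u} {G : SimpleGraph V} {H : Set V} {r : V} {κ : Type v}

theorem IsInducedPath.adj_iff_getLast {l : List V} {c : V} (h : IsInducedPath G (l ++ [c])) :
    ∀ x ∈ l, x ≠ c ∧ (G.Adj x c ↔ l.getLast? = some x) := by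
  intro x hx
  have h' := h.reverse
  rw [List.reverse_append] at h'
  have := h'.1 x (List.mem_reverse.2 hx)
  refine ⟨this.1.symm, ?_⟩
  rw [G.adj_comm, this.2]
  simp

/-- An induced path with legs below a top vertex `c`, starting at `c`, extends to one starting at
the root. -/
theorem PathType.prepend [Finite V] (hH : Conn G H) (hr : r ∈ H) {c : V} (hc : c ∈ topSet G H r)
    {T : κ → Set V} {S : Finset κ} {Q : List V} {L : κ → Set V}
    (h : PathType G (dominated G H r c) T S Q L) (hQ : Q.head? = some c) :
    ∃ P : List V, P.head? = some r ∧ P.Nodup ∧ (∀ x ∈ P, x ∈ insert r (topSet G H r)) ∧ c ∉ P ∧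
      PathType G H T S (P ++ Q) L := by
  have hcd := mem_dominated_self (G := G) hc.1 hc.2.1
  obtain ⟨l, a, b, hl, hlX, h1, h2, rfl, rfl, -⟩ := (conn_insert_topSet hH hr).exists_path
    (S := {r}) (T := {c}) ⟨r, Or.inl rfl, rfl⟩ ⟨c, Or.inr hc, rfl⟩
  have hne : l ≠ [] := by rintro rfl; simp at h1
  obtain ⟨P, z, rfl⟩ := (List.eq_nil_or_concat l).resolve_left hne
  rw [List.concat_eq_append] at *
  simp at h2
  subst h2
  have hadj := hl.adj_iff_getLast
  have hPX : ∀ x ∈ P, x ∈ insert a (topSet G H a) := fun x hx => hlX x (List.mem_append_left _ hx)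
  have hPd : ∀ x ∈ P, x ∈ H ∧ x ∉ dominated G H a z := by
    intro x hx
    rcases hPX x hx with rfl | hxt
    · exact ⟨hr, root_notMem_dominated _⟩
    · exact ⟨hxt.1, topSet_disjoint hH hr hxt hc (hadj x hx).1
        (mem_dominated_self hxt.1 hxt.2.1)⟩
  have hsub : ∀ x ∈ Q, x ∈ P ++ Q := fun x hx => List.mem_append_right _ hx
  refine ⟨P, ?_, hl.left.nodup, hPX, fun hm => (hadj z hm).1 rfl, ?_⟩
  · cases P with
    | nil => exact absurd (by simpa using h1) hc.2.1
    | cons p P => simpa using h1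
  constructor
  · refine hl.left.append h.path fun x hx y hy => ?_
    have hyd := h.path_sub y hy
    refine ⟨by rintro rfl; exact (hPd _ hx).2 hyd, ?_⟩
    rw [hQ, Option.some.injEq]
    constructor
    · intro e
      have := eq_of_adj_dominated (hPd x hx).1 (hPd x hx).2 (hadj x hx).1 hyd e
      subst this
      exact ⟨(hadj x hx).2.1 e, rfl⟩
    · rintro ⟨h3, rfl⟩
      exact (hadj x hx).2.2 h3
  · intro x hx
    rcases List.mem_append.1 hx with hx | hx
    · exact (hPd x hx).1
    · exact (h.path_sub x hx).1
  · exact fun k hk => (h.leg_sub k hk).trans (dominated_subset _)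
  · intro k hk
    rcases h.leg k hk with ⟨h3, x, h4, h5⟩ | ⟨h3, h4, h5⟩
    · exact Or.inl ⟨h3, x, hsub x h4, h5⟩
    · exact Or.inr ⟨h3, h4.mono hsub subset_rfl, h5⟩
  · intro k hk x hx hxL
    rcases List.mem_append.1 hx with hx | hx
    · exact (hPd x hx).2 (h.leg_sub k hk hxL)
    · exact h.path_notMem k hk x hx hxL
  · exact h.leg_leg
  · exact h.leg_private

/-- If every nonroot vertex dominates a terminal and there are many terminals, then many of them are
reached through a clique or from an induced path. The third alternative is the induction: either
the top set is large, or a top vertex dominates a good share of the terminals, and a leg is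
gained unless it dominates all of them. -/
theorem exists_type_of_terminals (n p : ℕ) : ∃ F : ℕ, ∀ {V : Type u} [Finite V]
    {G : SimpleGraph V} {κ : Type v} (t : κ → V) (H : Set V) (r : V) (K : Finset κ),
    Conn G H → r ∈ H → Set.InjOn t K → (∀ k ∈ K, t k ∈ H) →
    (∀ v ∈ H, v ≠ r → ∃ k ∈ K, t k ∈ dominated G H r v) → F ≤ K.card →
    (∃ S ⊆ K, S.card = n ∧ ∃ p L, CliqueType G H (fun k => {t k}) S p L) ∨
    (∃ S ⊆ K, S.card = n ∧ ∃ Q L, PathType G H (fun k => {t k}) S Q L) ∨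
      ∃ S ⊆ K, S.card = p ∧ ∃ Q L, PathType G H (fun k => {t k}) S Q L ∧ Q.head? = some r := by
  classical
  obtain ⟨M, hM⟩ := exists_type_of_topSet_large.{u, v} n
  induction p with
  | zero =>
    refine ⟨0, fun {V} _ {G κ} t H r K _ hr _ _ _ _ => ?_⟩
    refine Or.inr (Or.inr ⟨∅, by simp, rfl, [r], fun _ => ∅, ?_, rfl⟩)
    constructor <;> simp [IsInducedPath, hr]
  | succ p ih =>
    obtain ⟨F, hF⟩ := ih
    refine ⟨M * F + 2, fun {V} _ {G κ} t => ?_⟩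
    suffices ∀ (m : ℕ) (H : Set V), H.ncard = m → ∀ (r : V) (K : Finset κ),
        Conn G H → r ∈ H → Set.InjOn t K → (∀ k ∈ K, t k ∈ H) →
        (∀ v ∈ H, v ≠ r → ∃ k ∈ K, t k ∈ dominated G H r v) → M * F + 2 ≤ K.card →
        (∃ S ⊆ K, S.card = n ∧ ∃ p L, CliqueType G H (fun k => {t k}) S p L) ∨
        (∃ S ⊆ K, S.card = n ∧ ∃ Q L, PathType G H (fun k => {t k}) S Q L) ∨
        ∃ S ⊆ K, S.card = p + 1 ∧
          ∃ Q L, PathType G H (fun k => {t k}) S Q L ∧ Q.head? = some r from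
      fun H => this _ H rfl
    intro m
    induction m using Nat.strong_induction_on with
    | _ m ihm =>
    intro H hm r K hH hr hinj htH hess hK
    by_cases hbig : M ≤ (topSet G H r).ncard
    · rcases hM K t hH hr hess hbig with h | h
      · exact Or.inl h
      · exact Or.inr (Or.inl h)
    -- A top vertex `c` that dominates many terminals.
    let K₀ := K.filter fun k => ¬ t k = r
    have hK₀ : M * F + 1 ≤ K₀.card := by
      have h1 : (K.filter fun k => t k = r).card ≤ 1 := by
        refine Finset.card_le_one.2 fun a ha b hb => ?_
        rw [Finset.mem_filter] at ha hb
        exact hinj ha.1 hb.1 (ha.2.trans hb.2.symm)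
      have h2 := Finset.card_filter_add_card_filter_not (s := K) (fun k => t k = r)
      simp only [K₀]
      omega
    obtain ⟨c, hcE, K₁, hK₁, hK₁F, hK₁c⟩ := exists_common_value (K := K₀)
      (E := (Set.toFinite (topSet G H r)).toFinset) (R := fun k c => t k ∈ dominated G H r c)
      (c := M) (n := F)
      (by rw [← Set.ncard_eq_toFinset_card _ (Set.toFinite _)]; omega)
      (fun k hk => by
        obtain ⟨hk1, hk2⟩ := Finset.mem_filter.1 hk
        obtain ⟨c, hc, h⟩ := exists_topSet hH hr (htH k hk1) hk2
        exact ⟨c, by simpa using hc, h⟩) hK₀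
    have hc : c ∈ topSet G H r := by simpa using hcE
    have hcd := mem_dominated_self (G := G) hc.1 hc.2.1
    let K₂ := K.filter fun k => t k ∈ dominated G H r c
    have hK₂ : F ≤ K₂.card := by
      rw [← hK₁F]
      refine Finset.card_le_card fun k hk => Finset.mem_filter.2 ⟨?_, hK₁c k hk⟩
      exact (Finset.mem_filter.1 (hK₁ hk)).1
    have hK₂K : K₂ ⊆ K := Finset.filter_subset _ _
    have hK₂d : ∀ k ∈ K₂, t k ∈ dominated G H r c := fun k hk => (Finset.mem_filter.1 hk).2
    have hess₂ : ∀ v ∈ dominated G H r c, v ≠ c →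
        ∃ k ∈ K₂, t k ∈ dominated G (dominated G H r c) c v := by
      intro v hv hvc
      obtain ⟨k, hk, hkt⟩ := hess v hv.1 (by rintro rfl; exact root_notMem_dominated _ hv)
      exact ⟨k, Finset.mem_filter.2 ⟨hk, dominated_trans hv hkt⟩,
        dominated_subset_dominated_dominated hH hr hc.1 hc.2.1 hv hvc hkt⟩
    have hconn := conn_dominated hH hr hc.1 hc.2.1
    have hinj₂ : Set.InjOn t K₂ := hinj.mono (by exact_mod_cast hK₂K)
    by_cases hgain : (∃ k ∈ K, t k = r) ∨ ∃ c' ∈ topSet G H r, c' ≠ c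
    swap
    · -- The vertex `c` dominates all terminals.
      push Not at hgain
      have hK₂eq : K₂ = K := by
        refine Finset.Subset.antisymm hK₂K fun k hk => Finset.mem_filter.2 ⟨hk, ?_⟩
        obtain ⟨d, hd, hkd⟩ := exists_topSet hH hr (htH k hk) (hgain.1 k hk)
        rwa [← hgain.2 d hd]
      have hlt : (dominated G H r c).ncard < m := by
        rw [← hm]
        exact Set.ncard_lt_ncard ⟨dominated_subset c,
          fun h => root_notMem_dominated (G := G) (H := H) c (h hr)⟩ (Set.toFinite _)
      rcases ihm _ hlt _ rfl c K₂ hconn hcd hinj₂ hK₂d hess₂ (by rw [hK₂eq]; exact hK) with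
        ⟨S, hS, hn, q, L, h⟩ | ⟨S, hS, hn, Q, L, h⟩ | ⟨S, hS, hn, Q, L, h, hQ⟩
      · exact Or.inl ⟨S, hS.trans hK₂K, hn, q, L, h.mono (dominated_subset c) (by simp)⟩
      · exact Or.inr (Or.inl ⟨S, hS.trans hK₂K, hn, Q, L, h.mono (dominated_subset c) (by simp)⟩)
      · obtain ⟨P, hP, -, -, -, h'⟩ := h.prepend hH hr hc hQ
        refine Or.inr (Or.inr ⟨S, hS.trans hK₂K, hn, P ++ Q, L, h', ?_⟩)
        rw [List.head?_append, hP]; rfl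
    rcases hF t _ c K₂ hconn hcd hinj₂ hK₂d hess₂ hK₂ with
        ⟨S, hS, hn, q, L, h⟩ | ⟨S, hS, hn, Q, L, h⟩ | ⟨S, hS, hn, Q, L, h, hQ⟩
    · exact Or.inl ⟨S, hS.trans hK₂K, hn, q, L, h.mono (dominated_subset c) (by simp)⟩
    · exact Or.inr (Or.inl ⟨S, hS.trans hK₂K, hn, Q, L, h.mono (dominated_subset c) (by simp)⟩)
    obtain ⟨P, hP, hPnd, hPX, hcP, h'⟩ := h.prepend hH hr hc hQ
    have hhead : (P ++ Q).head? = some r := by rw [List.head?_append, hP]; rfl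
    have hrP : r ∈ P := head?_mem hP
    have hcQ : c ∈ Q := head?_mem hQ
    have hSd : ∀ k ∈ S, t k ∈ dominated G H r c := fun k hk => hK₂d k (hS hk)
    have hLd : ∀ k ∈ S, ∀ x ∈ L k, x ∈ dominated G H r c ∧ x ≠ c := fun k hk x hx =>
      ⟨h.leg_sub k hk hx, by rintro rfl; exact h.path_notMem k hk _ hcQ hx⟩
    suffices ∃ k₀ ∈ K, k₀ ∉ S ∧ ∃ L', PathType G H (fun k => {t k}) (insert k₀ S) (P ++ Q) L' by
      obtain ⟨k₀, hk₀, hk₀S, L', hL'⟩ := this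
      refine Or.inr (Or.inr ⟨insert k₀ S, ?_, ?_, P ++ Q, L', hL', hhead⟩)
      · intro k hk
        rcases Finset.mem_insert.1 hk with rfl | hk
        · exact hk₀
        · exact hK₂K (hS hk)
      · rw [Finset.card_insert_of_notMem hk₀S, hn]
    rcases hgain with ⟨k₀, hk₀, hkr⟩ | ⟨c', hc', hcc'⟩
    · have hk₀S : k₀ ∉ S := fun hm => root_notMem_dominated _ (hkr ▸ hSd k₀ hm)
      refine ⟨k₀, hk₀, hk₀S, _, h'.insert_leg hk₀S (M := ∅) (Set.empty_subset _)
        (Or.inl ⟨rfl, r, List.mem_append_left _ hrP, hkr.symm⟩) (by simp)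
        (fun _ _ x hx => hx.elim) (by simp) ?_⟩
      intro k hk x hx hxt
      have : x = r := hxt.trans hkr
      subst this
      exact root_notMem_dominated _ (hLd k hk x hx).1
    · have hX := conn_insert_topSet hH hr
      -- A leg below a top vertex other than `c` on the path or next to it.
      have key : ∃ d ∈ topSet G H r, d ≠ c ∧ ∃ k₀ ∈ K, t k₀ ∈ dominated G H r d ∧
          ∃ N ⊆ dominated G H r d, ((N = ∅ ∧ ∃ x ∈ P ++ Q, x = t k₀) ∨
            (Conn G N ∧ Touches G {x | x ∈ P ++ Q} N ∧ t k₀ ∈ N)) ∧ ∀ x ∈ P ++ Q, x ∉ N := by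
        by_cases hd : ∃ d ∈ P, d ≠ r
        · obtain ⟨d, hdP, hdr⟩ := hd
          have hdt := (hPX d hdP).resolve_left hdr
          have hdc : d ≠ c := by rintro rfl; exact hcP hdP
          obtain ⟨k₀, hk₀, hkt⟩ := hess d hdt.1 hdt.2.1
          obtain ⟨N, hN, hdN, hleg⟩ := exists_leg hH hr hdt.1 hdt.2.1 hkt
          refine ⟨d, hdt, hdc, k₀, hk₀, hkt, N, hN, ?_, ?_⟩
          · rcases hleg with ⟨h1, h2⟩ | ⟨h1, h2, h3⟩
            · exact Or.inl ⟨h1, d, List.mem_append_left _ hdP, h2⟩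
            · exact Or.inr ⟨h1, h2.mono (by simp [hdP]) subset_rfl, h3⟩
          · intro x hx hxN
            rcases List.mem_append.1 hx with hx | hx
            · rcases hPX x hx with rfl | hxt
              · exact root_notMem_dominated _ (hN hxN)
              · by_cases hxd : x = d
                · subst hxd; exact hdN hxN
                · exact topSet_disjoint hH hr hxt hdt hxd
                    (mem_dominated_self hxt.1 hxt.2.1) (hN hxN)
            · exact topSet_disjoint hH hr hc hdt hdc.symm (h.path_sub x hx) (hN hxN)
        · push Not at hd
          obtain ⟨x, hx, d, hd', hxY, hdY, e⟩ := hX.exists_edge (Y := {r, c}) (Or.inl rfl)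
            (Or.inr hc') (Or.inl rfl) (by
              rintro (rfl | h)
              · exact hc'.2.1 rfl
              · exact hcc' h)
          have hdr : d ≠ r := by rintro rfl; exact hdY (Or.inl rfl)
          have hdc : d ≠ c := by rintro rfl; exact hdY (Or.inr rfl)
          have hdt := hd'.resolve_left hdr
          obtain ⟨k₀, hk₀, hkt⟩ := hess d hdt.1 hdt.2.1
          refine ⟨d, hdt, hdc, k₀, hk₀, hkt, _, subset_rfl, Or.inr
            ⟨conn_dominated hH hr hdt.1 hdt.2.1, ⟨x, ?_, d, mem_dominated_self hdt.1 hdt.2.1, e⟩,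
              hkt⟩, ?_⟩
          · rcases hxY with rfl | hxc
            · exact List.mem_append_left _ hrP
            · rw [Set.mem_singleton_iff.1 hxc]
              exact List.mem_append_right _ hcQ
          · intro y hy hyN
            rcases List.mem_append.1 hy with hy | hy
            · rw [hd y hy] at hyN
              exact root_notMem_dominated _ hyN
            · exact topSet_disjoint hH hr hc hdt hdc.symm (h.path_sub y hy) hyN
      obtain ⟨d, hdt, hdc, k₀, hk₀, hkt, N, hN, hleg, hNQ⟩ := key
      have hk₀S : k₀ ∉ S := fun hm => topSet_disjoint hH hr hc hdt hdc.symm (hSd k₀ hm) hkt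
      refine ⟨k₀, hk₀, hk₀S, _, h'.insert_leg hk₀S (M := N) (hN.trans (dominated_subset _)) ?_ hNQ
        ?_ ?_ ?_⟩
      · rcases hleg with h1 | ⟨h1, h2, h3⟩
        · exact Or.inl h1
        · exact Or.inr ⟨h1, h2, _, h3, rfl⟩
      · intro k hk x hx y hy
        have := topSet_not_adj hH hr hc hdt hdc.symm (hLd k hk y hy).1 (hLd k hk y hy).2 (hN hx)
        exact ⟨this.1.symm, fun e => this.2 e.symm⟩
      · intro k hk x hx hxt
        rw [Set.mem_singleton_iff.1 hxt] at hx
        exact topSet_disjoint hH hr hc hdt hdc.symm (hSd k hk) (hN hx)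
      · intro k hk x hx hxt
        rw [Set.mem_singleton_iff.1 hxt] at hx
        exact topSet_disjoint hH hr hc hdt hdc.symm (hLd k hk _ hx).1 hkt

/-- A connected set that meets many terminal sets reaches many of them through a clique or from
an induced path. -/
theorem exists_type (n : ℕ) : ∃ F : ℕ, ∀ {V : Type u} [Finite V] {G : SimpleGraph V}
    {κ : Type v} (T : κ → Set V) (H : Set V) (K : Finset κ), Conn G H → H.Nonempty →
    (∀ k ∈ K, ∃ x ∈ H, x ∈ T k) → F ≤ K.card →
    (∃ S ⊆ K, S.card = n ∧ ∃ p L, CliqueType G H T S p L) ∨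
      ∃ S ⊆ K, S.card = n ∧ ∃ Q L, PathType G H T S Q L := by
  classical
  obtain ⟨F, hF⟩ := exists_type_of_terminals.{u, v} n n
  refine ⟨(F + 1) * n + 1, fun {V} _ {G κ} T H₁ K hH₁ hne₁ hT₁ hK => ?_⟩
  -- Pass to a minimal connected subset `H` that meets all terminal sets.
  obtain ⟨H, ⟨hHsub, hH, ⟨r, hr⟩, hT⟩, hmin⟩ := Set.exists_min_image
    {H | H ⊆ H₁ ∧ Conn G H ∧ H.Nonempty ∧ ∀ k ∈ K, ∃ x ∈ H, x ∈ T k} Set.ncard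
    (Set.toFinite _) ⟨H₁, subset_rfl, hH₁, hne₁, hT₁⟩
  suffices (∃ S ⊆ K, S.card = n ∧ ∃ p L, CliqueType G H T S p L) ∨
      ∃ S ⊆ K, S.card = n ∧ ∃ Q L, PathType G H T S Q L by
    rcases this with ⟨S, hS, hn, p, L, h⟩ | ⟨S, hS, hn, Q, L, h⟩
    · exact Or.inl ⟨S, hS, hn, p, L, h.mono hHsub (by simp)⟩
    · exact Or.inr ⟨S, hS, hn, Q, L, h.mono hHsub (by simp)⟩
  have hown : ∀ v ∈ H, v ≠ r → ∃ k ∈ K, ∀ x ∈ H, x ∈ T k → x ∈ dominated G H r v := by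
    intro v hv hvr
    by_contra hcon
    push Not at hcon
    have h1 := hmin (H \ dominated G H r v) ⟨Set.sdiff_subset.trans hHsub,
      conn_diff_dominated v, ⟨r, hr, root_notMem_dominated v⟩, fun k hk => by
        obtain ⟨x, h1, h2, h3⟩ := hcon k hk
        exact ⟨x, ⟨h1, h3⟩, h2⟩⟩
    have h2 : (H \ dominated G H r v).ncard < H.ncard :=
      Set.ncard_lt_ncard ⟨Set.sdiff_subset, fun h => (h hv).2 (mem_dominated_self hv hvr)⟩
        (Set.toFinite _)
    omega
  let leaves : Set V := {v | v ∈ H ∧ v ≠ r ∧ dominated G H r v = {v}}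
  have hleaf : ∀ v ∈ H, v ≠ r → ∃ w ∈ leaves, w ∈ dominated G H r v := by
    intro v hv hvr
    obtain ⟨w, hw, hwmin⟩ := Set.exists_min_image (dominated G H r v)
      (fun w => (dominated G H r w).ncard) (Set.toFinite _) ⟨v, mem_dominated_self hv hvr⟩
    have hwr : w ≠ r := by rintro rfl; exact root_notMem_dominated _ hw
    have hww := mem_dominated_self (G := G) hw.1 hwr
    refine ⟨w, ⟨hw.1, hwr, ?_⟩, hw⟩
    refine Set.eq_singleton_iff_unique_mem.2 ⟨hww, fun x hx => ?_⟩
    by_contra hxw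
    have h1 := hwmin x (dominated_trans hw hx)
    have h2 : (dominated G H r x).ncard < (dominated G H r w).ncard :=
      Set.ncard_lt_ncard ⟨dominated_trans hx,
        fun h => dominated_antisymm hH hr hw.1 hwr hx hxw (h hww)⟩ (Set.toFinite _)
    omega
  by_cases hmany : F ≤ leaves.ncard
  · -- Many leaves: each leaf is the only vertex of some terminal set.
    have hκ : ∀ v ∈ leaves, ∃ k ∈ K, ∀ x ∈ H, x ∈ T k ↔ x = v := by
      intro v hv
      obtain ⟨k, hk, h⟩ := hown v hv.1 hv.2.1
      have h' : ∀ x ∈ H, x ∈ T k → x = v := fun x hx hxT => by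
        have := h x hx hxT
        rwa [hv.2.2] at this
      refine ⟨k, hk, fun x hx => ⟨h' x hx, ?_⟩⟩
      rintro rfl
      obtain ⟨y, hy, hyT⟩ := hT k hk
      rwa [← h' y hy hyT]
    by_cases hκne : Nonempty κ
    swap
    · have : n = 0 := by
        by_contra hn
        obtain ⟨k, -⟩ := Finset.card_pos.1 (show 0 < K.card by omega)
        exact hκne ⟨k⟩
      subst this
      exact Or.inr ⟨∅, by simp, rfl, [], fun _ => ∅, by constructor <;> simp [IsInducedPath]⟩
    choose! f hfK hf using hκ
    have : Nonempty V := ⟨r⟩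
    let U := (Set.toFinite leaves).toFinset
    have hU : ∀ v, v ∈ U ↔ v ∈ leaves := fun v => by simp [U]
    obtain ⟨t, ht⟩ := exists_section U f
    have hfinj : Set.InjOn f U := by
      intro a ha b hb e
      have ha' := (hU a).1 ha
      have hb' := (hU b).1 hb
      have h1 := (hf a ha' a ha'.1).2 rfl
      rw [e] at h1
      exact (hf b hb' a ha'.1).1 h1
    have htf : ∀ v ∈ U, t (f v) = v := fun v hv =>
      hfinj (ht _ (Finset.mem_image_of_mem f hv)).1 hv (ht _ (Finset.mem_image_of_mem f hv)).2
    have hKsub : U.image f ⊆ K := by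
      intro k hk
      obtain ⟨v, hv, rfl⟩ := Finset.mem_image.1 hk
      exact hfK v ((hU v).1 hv)
    have hTt : ∀ k ∈ U.image f, ∀ x ∈ H, x ∈ ({t k} : Set V) ↔ x ∈ T k := by
      intro k hk x hx
      have h1 := hf (t k) ((hU _).1 (ht k hk).1) x hx
      rw [(ht k hk).2] at h1
      exact h1.symm
    rcases hF t H r (U.image f) hH hr (fun a ha b hb e => by
          rw [← (ht a ha).2, ← (ht b hb).2, e])
        (fun k hk => ((hU _).1 (ht k hk).1).1) (fun v hv hvr => by
          obtain ⟨w, hw, hwd⟩ := hleaf v hv hvr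
          exact ⟨f w, Finset.mem_image_of_mem f ((hU w).2 hw), by rwa [htf w ((hU w).2 hw)]⟩)
        (by rw [Finset.card_image_of_injOn hfinj,
              ← Set.ncard_eq_toFinset_card _ (Set.toFinite _)]; exact hmany) with
      ⟨S, hS, hn, p, L, h⟩ | ⟨S, hS, hn, Q, L, h⟩ | ⟨S, hS, hn, Q, L, h, -⟩
    · exact Or.inl ⟨S, hS.trans hKsub, hn, p, L, h.mono subset_rfl fun k hk => hTt k (hS hk)⟩
    · exact Or.inr ⟨S, hS.trans hKsub, hn, Q, L, h.mono subset_rfl fun k hk => hTt k (hS hk)⟩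
    · exact Or.inr ⟨S, hS.trans hKsub, hn, Q, L, h.mono subset_rfl fun k hk => hTt k (hS hk)⟩
  · -- Few leaves: the paths from the root to the leaves cover `H`.
    right
    have hpath : ∀ w ∈ insert r leaves, ∃ l : List V, IsInducedPath G l ∧ (∀ x ∈ l, x ∈ H) ∧
        ∀ x, (x = r ∨ w ∈ dominated G H r x) → x ∈ l := by
      intro w hw
      have hwH : w ∈ H := by
        rcases hw with rfl | hw
        · exact hr
        · exact hw.1
      obtain ⟨l, a, b, hl, hlH, h1, h2, rfl, rfl, -⟩ := hH.exists_path (S := {r}) (T := {w})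
        ⟨r, hr, rfl⟩ ⟨w, hwH, rfl⟩
      refine ⟨l, hl, hlH, ?_⟩
      rintro x (rfl | hx)
      · exact head?_mem h1
      · by_contra hxl
        have hsub : {y | y ∈ l} ⊆ H \ {x} := fun y hy =>
          ⟨hlH y hy, by rintro rfl; exact hxl hy⟩
        exact hx.2 ((hl.conn a (head?_mem h1) b (getLast?_mem h2)).mono hsub)
    choose! l hl hlH hlx using hpath
    obtain ⟨w, hwE, S, hS, hSn, hSw⟩ := exists_common_value (K := K)
      (E := (Set.toFinite (insert r leaves)).toFinset) (R := fun k w => ∃ x ∈ l w, x ∈ T k)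
      (c := F + 1) (n := n) (by
        rw [← Set.ncard_eq_toFinset_card _ (Set.toFinite _)]
        have := Set.ncard_insert_le r leaves
        omega)
      (fun k hk => by
        obtain ⟨x, hx, hxT⟩ := hT k hk
        by_cases hxr : x = r
        · exact ⟨r, by simp, x, hlx r (Or.inl rfl) x (Or.inl hxr), hxT⟩
        · obtain ⟨w, hw, hwd⟩ := hleaf x hx hxr
          exact ⟨w, by simp [hw], x, hlx w (Or.inr hw) x (Or.inr hwd), hxT⟩) hK
    have hw : w ∈ insert r leaves := by simpa using hwE
    refine ⟨S, hS, hSn, l w, fun _ => ∅, ?_⟩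
    constructor
    · exact hl w hw
    · exact hlH w hw
    · simp
    · exact fun k hk => Or.inl ⟨rfl, hSw k hk⟩
    · simp
    · exact fun _ _ _ _ _ x hx => hx.elim
    · simp

end

/-! ### Sets of positions on a path -/

section
variable {κ : Type v}

/-- Greedy choice by right ends: among many intervals `[f k, e k]` many are pairwise disjoint or
many share a point. -/
theorem exists_disjoint_or_common (n M : ℕ) (K : Finset κ) (f e : κ → ℕ)
    (hfe : ∀ k ∈ K, f k ≤ e k) (hK : n * M ≤ K.card) :
    (∃ K' ⊆ K, K'.card = n ∧ ∀ k ∈ K', ∀ l ∈ K', k ≠ l → e k < f l ∨ e l < f k) ∨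
      ∃ x, ∃ K' ⊆ K, K'.card = M ∧ ∀ k ∈ K', f k ≤ x ∧ x ≤ e k := by
  classical
  induction n generalizing K with
  | zero => exact Or.inl ⟨∅, by simp, rfl, by simp⟩
  | succ n ih =>
    rcases K.eq_empty_or_nonempty with rfl | hne
    · simp only [Finset.card_empty, Nat.le_zero, Nat.mul_eq_zero, Nat.succ_ne_zero, false_or] at hK
      exact Or.inr ⟨0, ∅, by simp, by simp [hK], by simp⟩
    · obtain ⟨k₀, hk₀, hmin⟩ := Finset.exists_min_image K e hne
      by_cases hJ : M ≤ (K.filter fun k => f k ≤ e k₀).card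
      · obtain ⟨K', hK', hM⟩ := Finset.exists_subset_card_eq hJ
        refine Or.inr ⟨e k₀, K', hK'.trans (Finset.filter_subset _ _), hM, fun k hk => ?_⟩
        have := Finset.mem_filter.1 (hK' hk)
        exact ⟨this.2, hmin k this.1⟩
      · have h2 := Finset.card_filter_add_card_filter_not (s := K) (fun k => f k ≤ e k₀)
        have hsub : (K.filter fun k => ¬ f k ≤ e k₀) ⊆ K := Finset.filter_subset _ _
        rcases ih (K.filter fun k => ¬ f k ≤ e k₀) (fun k hk => hfe k (hsub hk))
          (by rw [Nat.succ_mul] at hK; omega) with ⟨K', hK', hn, h⟩ | ⟨x, K', hK', hM, h⟩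
        · have hlt : ∀ k ∈ K', e k₀ < f k := fun k hk =>
            not_le.1 (Finset.mem_filter.1 (hK' hk)).2
          have hk₀K' : k₀ ∉ K' := fun hm => absurd (hlt k₀ hm) (not_lt.2 (hfe k₀ hk₀))
          refine Or.inl ⟨insert k₀ K', ?_, by rw [Finset.card_insert_of_notMem hk₀K', hn], ?_⟩
          · exact Finset.insert_subset hk₀ (hK'.trans hsub)
          · intro k hk l hl hkl
            rcases Finset.mem_insert.1 hk with rfl | hkK <;>
              rcases Finset.mem_insert.1 hl with rfl | hlK
            · exact absurd rfl hkl
            · exact Or.inl (hlt l hlK)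
            · exact Or.inr (hlt k hkK)
            · exact h k hkK l hlK hkl
        · exact Or.inr ⟨x, K', hK'.trans hsub, hM, h⟩

/-- Given many sets of positions that meet an interval, either one position lies in many of them,
or many of them occupy disjoint stretches of some subinterval, or many of them meet each of `m`
separated subintervals. -/
theorem exists_position_structure (s n m : ℕ) : ∃ F : ℕ, ∀ {κ : Type v} (K : Finset κ)
    (S : κ → Set ℕ) (a b : ℕ), F ≤ K.card → (∀ k ∈ K, ∃ x ∈ S k, a ≤ x ∧ x ≤ b) →
    (∃ x, a ≤ x ∧ x ≤ b ∧ ∃ K' ⊆ K, K'.card = s ∧ ∀ k ∈ K', x ∈ S k) ∨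
    (∃ K' ⊆ K, K'.card = n ∧ ∃ a' b', a ≤ a' ∧ b' ≤ b ∧
      (∀ k ∈ K', ∃ x ∈ S k, a' ≤ x ∧ x ≤ b') ∧ ∀ k ∈ K', ∀ l ∈ K', k ≠ l →
        (∀ x ∈ S k, ∀ y ∈ S l, a' ≤ x → x ≤ b' → a' ≤ y → y ≤ b' → x < y) ∨
        (∀ x ∈ S k, ∀ y ∈ S l, a' ≤ x → x ≤ b' → a' ≤ y → y ≤ b' → y < x)) ∨
    (∃ K' ⊆ K, K'.card = n ∧ ∃ lo hi : ℕ → ℕ,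
      (∀ i < m, a ≤ lo i ∧ hi i ≤ b ∧ ∀ k ∈ K', ∃ x ∈ S k, lo i ≤ x ∧ x ≤ hi i) ∧
      ∀ i j, i < j → j < m → hi i + 1 < lo j) := by
  classical
  induction m with
  | zero =>
    refine ⟨n, fun K S a b hK _ => ?_⟩
    obtain ⟨K', hK', hn⟩ := Finset.exists_subset_card_eq hK
    exact Or.inr (Or.inr ⟨K', hK', hn, id, id, by simp, by simp⟩)
  | succ m ih =>
    obtain ⟨F, hF⟩ := ih
    refine ⟨n * (F + s + 1) + 1, fun {κ} K S a b hK hS => ?_⟩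
    have hmin : ∀ k ∈ K, ∃ x ∈ S k, a ≤ x ∧ x ≤ b ∧ ∀ y ∈ S k, a ≤ y → y ≤ b → x ≤ y := by
      intro k hk
      obtain ⟨x, hx, hxa, hxb⟩ := hS k hk
      obtain ⟨y, hy, h⟩ := Set.exists_min_image (S k ∩ Set.Icc a b) id
        ((Set.finite_Icc a b).inter_of_right _) ⟨x, hx, hxa, hxb⟩
      exact ⟨y, hy.1, hy.2.1, hy.2.2, fun z hz hza hzb => h z ⟨hz, hza, hzb⟩⟩
    have hmax : ∀ k ∈ K, ∃ x ∈ S k, a ≤ x ∧ x ≤ b ∧ ∀ y ∈ S k, a ≤ y → y ≤ b → y ≤ x := by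
      intro k hk
      obtain ⟨x, hx, hxa, hxb⟩ := hS k hk
      obtain ⟨y, hy, h⟩ := Set.exists_max_image (S k ∩ Set.Icc a b) id
        ((Set.finite_Icc a b).inter_of_right _) ⟨x, hx, hxa, hxb⟩
      exact ⟨y, hy.1, hy.2.1, hy.2.2, fun z hz hza hzb => h z ⟨hz, hza, hzb⟩⟩
    choose! f hfS hfa hfb hf using hmin
    choose! e heS hea heb he using hmax
    rcases exists_disjoint_or_common n (F + s + 1) K f e (fun k hk => hf k hk _ (heS k hk)
      (hea k hk) (heb k hk)) (by omega) with ⟨K', hK', hn, h⟩ | ⟨x, J, hJ, hJc, hJx⟩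
    · refine Or.inr (Or.inl ⟨K', hK', hn, a, b, le_rfl, le_rfl, fun k hk => hS k (hK' hk), ?_⟩)
      intro k hk l hl hkl
      refine (h k hk l hl hkl).imp ?_ ?_
      · intro hlt x hx y hy hxa hxb hya hyb
        exact (he k (hK' hk) x hx hxa hxb).trans_lt (hlt.trans_le (hf l (hK' hl) y hy hya hyb))
      · intro hlt x hx y hy hxa hxb hya hyb
        exact (he l (hK' hl) y hy hya hyb).trans_lt (hlt.trans_le (hf k (hK' hk) x hx hxa hxb))
    · by_cases hs : s ≤ (J.filter fun k => x ∈ S k).card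
      · rcases J.eq_empty_or_nonempty.symm with ⟨k, hk⟩ | hJ0
        · obtain ⟨K', hK', hs'⟩ := Finset.exists_subset_card_eq hs
          exact Or.inl ⟨x, (hfa k (hJ hk)).trans (hJx k hk).1, (hJx k hk).2.trans (heb k (hJ hk)),
            K', (hK'.trans (Finset.filter_subset _ _)).trans hJ, hs',
            fun k hk => (Finset.mem_filter.1 (hK' hk)).2⟩
        · simp [hJ0] at hJc
      · have h2 := Finset.card_filter_add_card_filter_not (s := J) (fun k => x ∈ S k)
        have hsub : (J.filter fun k => ¬ x ∈ S k) ⊆ J := Finset.filter_subset _ _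
        have hlt : ∀ k ∈ J.filter (fun k => ¬ x ∈ S k), f k < x ∧ x < e k := by
          intro k hk
          have hkJ := hsub hk
          have hx := (Finset.mem_filter.1 hk).2
          refine ⟨lt_of_le_of_ne (hJx k hkJ).1 ?_, lt_of_le_of_ne (hJx k hkJ).2 ?_⟩
          · intro e; exact hx (e ▸ hfS k (hJ hkJ))
          · intro e'; exact hx (e' ▸ heS k (hJ hkJ))
        obtain ⟨k₁, hk₁⟩ : (J.filter fun k => ¬ x ∈ S k).Nonempty :=
          Finset.card_pos.1 (by omega)
        have hx₁ := hlt k₁ hk₁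
        have hxa := hfa k₁ (hJ (hsub hk₁))
        have hxb := heb k₁ (hJ (hsub hk₁))
        rcases hF (J.filter fun k => ¬ x ∈ S k) S (x + 1) b (by omega) (fun k hk =>
            ⟨e k, heS k (hJ (hsub hk)), (hlt k hk).2, heb k (hJ (hsub hk))⟩) with
          ⟨y, h1, h2, K', hK', h⟩ | ⟨K', hK', hn, a', b', h1, h2, h⟩ | ⟨K', hK', hn, lo, hi, h1, h2⟩
        · exact Or.inl ⟨y, by omega, h2, K', (hK'.trans hsub).trans hJ, h⟩
        · refine Or.inr (Or.inl ⟨K', (hK'.trans hsub).trans hJ, hn, a', b', ?_, h2, h⟩)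
          omega
        · have hcut : ∀ k ∈ K', f k < x ∧ x < e k := fun k hk => hlt k (hK' hk)
          refine Or.inr (Or.inr ⟨K', (hK'.trans hsub).trans hJ, hn,
            fun i => if i = 0 then a else lo (i - 1), fun i => if i = 0 then x - 1 else hi (i - 1),
            ?_, ?_⟩)
          · rintro (_ | i) hi'
            · refine ⟨by simp, by simp; omega, fun k hk => ⟨f k, ?_, ?_, ?_⟩⟩
              · exact hfS k (hJ (hsub (hK' hk)))
              · simpa using hfa k (hJ (hsub (hK' hk)))
              · have := (hcut k hk).1
                simp; omega
            · obtain ⟨h3, h4, h5⟩ := h1 i (by omega)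
              exact ⟨by simp; omega, by simpa using h4, by simpa using h5⟩
          · rintro (_ | i) (_ | j) hij hj
            · omega
            · have := (h1 j (by omega)).1
              simp; omega
            · omega
            · simpa using h2 i j (by omega) (by omega)

end

/-! ### Links and constellations -/

/-- The nonempty induced path `σ` is the interior of an induced path from `a` to `b`: its first
vertex is its only neighbour of `a` and its last vertex is its only neighbour of `b`. -/
structure IsLink {V : Type u} (G : SimpleGraph V) (a b : V) (σ : List V) : Prop where
  path : IsInducedPath G σ
  ne_nil : σ ≠ []
  left : ∀ x ∈ σ, a ≠ x ∧ (G.Adj a x ↔ σ.head? = some x)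
  right : ∀ x ∈ σ, b ≠ x ∧ (G.Adj b x ↔ σ.getLast? = some x)

/-- All values `(a + b - d) / 2` with `a`, `b`, `d` in `C`. -/
def halfDiffs (C : Finset ℕ) : Finset ℕ :=
  (C ×ˢ C ×ˢ C).image fun p => (p.1 + p.2.1 - p.2.2) / 2

theorem card_halfDiffs_le (C : Finset ℕ) : (halfDiffs C).card ≤ C.card ^ 3 := by
  refine Finset.card_image_le.trans ?_
  rw [Finset.card_product, Finset.card_product]
  exact (by ring : C.card * (C.card * C.card) = C.card ^ 3).le

/-- The pairwise sums of three numbers determine each of them. -/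
theorem mem_halfDiffs {C : Finset ℕ} {x y z : ℕ} (h1 : x + y ∈ C) (h2 : x + z ∈ C)
    (h3 : y + z ∈ C) : x ∈ halfDiffs C := by
  refine Finset.mem_image.2 ⟨(x + y, x + z, y + z), by simp [h1, h2, h3], ?_⟩
  simp only
  omega

section
variable {V : Type u} {G : SimpleGraph V} {κ : Type v}

theorem IsLink.reverse {a b : V} {σ : List V} (h : IsLink G a b σ) : IsLink G b a σ.reverse where
  path := h.path.reverse
  ne_nil := by simpa using h.ne_nil
  left x hx := by simpa using h.right x (List.mem_reverse.1 hx)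
  right x hx := by simpa using h.left x (List.mem_reverse.1 hx)

theorem IsLink.isInducedPath {a b : V} {σ : List V} (hσ : IsLink G a b σ) (hab : a ≠ b)
    (hadj : ¬ G.Adj a b) : IsInducedPath G (a :: σ ++ [b]) := by
  have h1 : IsInducedPath G (a :: σ) := ⟨hσ.left, hσ.path⟩
  refine h1.append (isInducedPath_singleton b) fun x hx y hy => ?_
  rw [List.mem_singleton] at hy
  subst hy
  obtain ⟨d, σ', rfl⟩ := List.exists_cons_of_ne_nil hσ.ne_nil
  rw [List.getLast?_cons_cons]
  rcases List.mem_cons.1 hx with rfl | hxσ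
  · refine ⟨hab, ⟨fun e => absurd e hadj, fun e => ?_⟩⟩
    exact absurd rfl (hσ.left x (getLast?_mem e.1)).1
  · obtain ⟨h3, h4⟩ := hσ.right x hxσ
    refine ⟨h3.symm, ?_⟩
    rw [G.adj_comm, h4]
    simp

theorem IsLink.exists_cycle {a b : V} {σ τ : List V} (hσ : IsLink G a b σ) (hτ : IsLink G a b τ)
    (hab : a ≠ b) (hadj : ¬ G.Adj a b) (h : Anticomplete G {x | x ∈ σ} {x | x ∈ τ}) :
    ∃ l, IsInducedCycle G l ∧ l.length = (σ.length + 1) + (τ.length + 1) := by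
  have h2 := hσ.isInducedPath hab hadj
  obtain ⟨l, hl, hlen⟩ := h2.exists_cycle (l₂ := τ.reverse) hτ.path.reverse (by simp)
    (by simpa using hτ.ne_nil) (by
      intro x hx y hy
      rw [List.mem_reverse] at hy
      rw [List.head?_reverse, List.getLast?_reverse]
      have hlast : (a :: σ ++ [b]).getLast? = some b := List.getLast?_concat
      have hhead : (a :: σ ++ [b]).head? = some a := rfl
      rw [hlast, hhead, Option.some.injEq, Option.some.injEq]
      rcases List.mem_append.1 hx with hx | hx
      · rcases List.mem_cons.1 hx with rfl | hxσ
        · obtain ⟨h3, h4⟩ := hτ.left y hy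
          refine ⟨h3, h4.trans ⟨fun e => Or.inr ⟨rfl, e⟩, ?_⟩⟩
          rintro (⟨h5, -⟩ | ⟨-, h5⟩)
          · exact absurd h5.symm hab
          · exact h5
        · refine ⟨(h x hxσ y hy).1, ⟨fun e => absurd e (h x hxσ y hy).2, ?_⟩⟩
          rintro (⟨h5, -⟩ | ⟨h5, -⟩)
          · exact absurd h5 (hσ.right x hxσ).1
          · exact absurd h5 (hσ.left x hxσ).1
      · rw [List.mem_singleton] at hx
        subst hx
        obtain ⟨h3, h4⟩ := hτ.right y hy
        refine ⟨h3, h4.trans ⟨fun e => Or.inl ⟨rfl, e⟩, ?_⟩⟩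
        rintro (⟨-, h5⟩ | ⟨h5, -⟩)
        · exact h5
        · exact absurd h5 hab)
  exact ⟨l, hl, by rw [hlen]; simp; omega⟩

theorem Conn.exists_isLink {X : Set V} (hX : Conn G X) {a b : V} (ha : a ∉ X) (hb : b ∉ X)
    (haX : ∃ x ∈ X, G.Adj a x) (hbX : ∃ x ∈ X, G.Adj b x) :
    ∃ σ, IsLink G a b σ ∧ ∀ x ∈ σ, x ∈ X := by
  obtain ⟨l, p, q, hl, hlX, h1, h2, h3, h4, h5, h6⟩ :=
    hX.exists_path (S := {x | G.Adj a x}) (T := {x | G.Adj b x}) haX hbX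
  refine ⟨l, ⟨hl, by rintro rfl; simp at h1, fun x hx => ⟨?_, ?_⟩, fun x hx => ⟨?_, ?_⟩⟩, hlX⟩
  · rintro rfl; exact ha (hlX _ hx)
  · rw [h1, Option.some.injEq]
    exact ⟨fun e => (h5 x hx e).symm, by rintro rfl; exact h3⟩
  · rintro rfl; exact hb (hlX _ hx)
  · rw [h2, Option.some.injEq]
    exact ⟨fun e => (h6 x hx e).symm, by rintro rfl; exact h4⟩

theorem IndFree.false_of_biclique {t : ℕ} (hfree : IndFree G (biclique t)) {X Y : Finset V}
    (hX : X.card = t) (hY : Y.card = t) (hXX : ∀ x ∈ X, ∀ y ∈ X, ¬ G.Adj x y)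
    (hYY : ∀ x ∈ Y, ∀ y ∈ Y, ¬ G.Adj x y) (hXY : ∀ x ∈ X, ∀ y ∈ Y, G.Adj x y) : False := by
  apply hfree
  let f := (X.equivFinOfCardEq hX).symm
  let g := (Y.equivFinOfCardEq hY).symm
  refine ⟨⟨⟨Sum.elim (fun i => (f i : V)) (fun i => (g i : V)), ?_⟩, ?_⟩⟩
  · rintro (i | i) (j | j) h
    · simpa using f.injective (Subtype.ext h)
    · exact absurd h (hXY _ (f i).2 _ (g j).2).ne
    · exact absurd h (hXY _ (f j).2 _ (g i).2).ne.symm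
    · simpa using g.injective (Subtype.ext h)
  · rintro (i | i) (j | j)
    · exact iff_of_false (hXX _ (f i).2 _ (f j).2) (by simp)
    · exact iff_of_true (hXY _ (f i).2 _ (g j).2) (by simp)
    · exact iff_of_true (hXY _ (f j).2 _ (g i).2).symm (by simp)
    · exact iff_of_false (hYY _ (g i).2 _ (g j).2) (by simp)

theorem exists_prefix {α : Type*} (p : List α → Prop) {l : List α} (hl : p l) (h0 : ¬ p []) :
    ∃ l₁ x l₂, l = l₁ ++ x :: l₂ ∧ p (l₁ ++ [x]) ∧ ¬ p l₁ := by
  induction l using List.reverseRecOn with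
  | nil => exact absurd hl h0
  | append_singleton m x ih =>
    by_cases hm : p m
    · obtain ⟨l₁, y, l₂, rfl, h1, h2⟩ := ih hm
      exact ⟨l₁, y, l₂ ++ [x], by simp, h1, h2⟩
    · exact ⟨m, x, [], rfl, hl, hm⟩

/-- If the lengths of links through an induced path take few values, then some vertex of the path
is adjacent to many of the outer vertices: on the shortest prefix that meets all
neighbourhoods, the links to the vertex met last have pairwise different first vertices as soon
as their lengths differ. -/
theorem exists_common_neighbour {t e : ℕ} (ht : 1 ≤ t) {E : Finset ℕ} (hE : E.card ≤ e)
    {K : Finset κ} {b : κ → V} {P : List V} (hP : IsInducedPath G P)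
    (hbP : ∀ k ∈ K, ∀ x ∈ P, b k ≠ x) (htouch : ∀ k ∈ K, ∃ x ∈ P, G.Adj (b k) x)
    (hlen : ∀ k ∈ K, ∀ l ∈ K, k ≠ l → ∀ σ, IsLink G (b k) (b l) σ → (∀ x ∈ σ, x ∈ P) →
      σ.length + 1 ∈ E) (hK : e * t + 2 ≤ K.card) :
    ∃ x ∈ P, ∃ K' ⊆ K, K'.card = t ∧ ∀ k ∈ K', G.Adj (b k) x := by
  classical
  obtain ⟨k₁, hk₁⟩ : K.Nonempty := Finset.card_pos.1 (by omega)
  obtain ⟨l₁, x, l₂, hPl, hτ, hl₁⟩ := exists_prefix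
    (fun l => ∀ k ∈ K, ∃ x ∈ l, G.Adj (b k) x) htouch (fun h => by simpa using h k₁ hk₁)
  push Not at hl₁
  obtain ⟨s, hs, hsl⟩ := hl₁
  have hPτ : P = (l₁ ++ [x]) ++ l₂ := by simpa using hPl
  have hτP : ∀ y ∈ l₁ ++ [x], y ∈ P := fun y hy => by rw [hPτ]; exact List.mem_append_left _ hy
  have hsx : ∀ y ∈ l₁ ++ [x], G.Adj (b s) y ↔ y = x := by
    have h1 : ∀ y ∈ l₁ ++ [x], G.Adj (b s) y → y = x := by
      intro y hy e
      rcases List.mem_append.1 hy with hy | hy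
      · exact absurd e (hsl y hy)
      · exact List.mem_singleton.1 hy
    intro y hy
    refine ⟨h1 y hy, ?_⟩
    rintro rfl
    obtain ⟨z, hz, e⟩ := hτ s hs
    rwa [← h1 z hz e]
  have hτpath : IsInducedPath G (l₁ ++ [x]) := by
    rw [hPτ] at hP
    exact hP.left
  obtain ⟨j, -, K', hK', hKt, hR⟩ := exists_common_value (K := K.erase s) (E := E)
    (R := fun k j => ∃ u y w, l₁ ++ [x] = u ++ y :: w ∧ (y :: w).length + 1 = j ∧ G.Adj (b k) y)
    (n := t) hE (by
      intro k hk
      have hkK := Finset.mem_of_mem_erase hk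
      obtain ⟨u, y, w, hu, hy, hw⟩ := exists_split_last (fun y => G.Adj (b k) y) (hτ k hkK)
      have hsub : ∀ z ∈ y :: w, z ∈ l₁ ++ [x] := fun z hz => by
        rw [hu]; exact List.mem_append_right _ hz
      have hlast : (y :: w).getLast? = some x := by
        have := congrArg List.getLast? hu
        rw [List.getLast?_append_cons, List.getLast?_append_cons] at this
        rw [← this]; simp
      refine ⟨_, hlen k hkK s hs (Finset.ne_of_mem_erase hk) (y :: w)
        ⟨?_, by simp, fun z hz => ⟨hbP k hkK z (hτP z (hsub z hz)), ?_⟩,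
          fun z hz => ⟨hbP s hs z (hτP z (hsub z hz)), ?_⟩⟩ fun z hz => hτP z (hsub z hz),
        u, y, w, hu, rfl, hy⟩
      · rw [hu] at hτpath
        exact hτpath.right
      · simp only [List.head?_cons, Option.some.injEq]
        constructor
        · intro e
          rcases List.mem_cons.1 hz with rfl | hz
          · rfl
          · exact absurd e (hw z hz)
        · rintro rfl; exact hy
      · rw [hsx z (hsub z hz), hlast, Option.some.injEq]
        exact eq_comm)
    (by rw [Finset.card_erase_of_mem hs]; omega)
  obtain ⟨k₂, hk₂⟩ : K'.Nonempty := Finset.card_pos.1 (by omega)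
  obtain ⟨u, y, w, hu, hj, -⟩ := hR k₂ hk₂
  refine ⟨y, hτP y (by rw [hu]; simp), K', hK'.trans (Finset.erase_subset _ _), hKt, ?_⟩
  intro k hk
  obtain ⟨u', y', w', hu', hj', hadj⟩ := hR k hk
  have := (List.append_inj' (hu.symm.trans hu') (by omega)).2
  simp only [List.cons.injEq] at this
  rw [this.1]
  exact hadj

/-- A large constellation, that is, many independent vertices and many pairwise anticomplete induced
paths each of which meets all their neighbourhoods, cannot exist in a biclique-free graph with few
induced cycle lengths. -/
theorem exists_constellation_bound (c t : ℕ) (ht : 1 ≤ t) : ∃ n m : ℕ, ∀ {V : Type u}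
    {G : SimpleGraph V} {C : Finset ℕ} {κ : Type v} (K : Finset κ) (b : κ → V) (P : ℕ → List V),
    C.card ≤ c → (∀ l, IsInducedCycle G l → l.length ∈ C) → IndFree G (biclique t) →
    n ≤ K.card → (∀ k ∈ K, ∀ l ∈ K, k ≠ l → b k ≠ b l ∧ ¬ G.Adj (b k) (b l)) →
    (∀ i < m, IsInducedPath G (P i)) →
    (∀ i < m, ∀ j < m, i ≠ j → Anticomplete G {x | x ∈ P i} {x | x ∈ P j}) →
    (∀ i < m, ∀ k ∈ K, ∀ x ∈ P i, b k ≠ x) →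
    (∀ i < m, ∀ k ∈ K, ∃ x ∈ P i, G.Adj (b k) x) → False := by
  classical
  refine ⟨c ^ 3 * t + 2, (c ^ 3 * t + 2).choose t * t + 3, ?_⟩
  intro V G C κ K₁ b P hCc hC hfree hK₁ hb₁ hP hPP hbP₁ htouch₁
  obtain ⟨K, hKK, hK⟩ := Finset.exists_subset_card_eq hK₁
  have hb := fun k hk l hl => hb₁ k (hKK hk) l (hKK hl)
  have hbP := fun i hi k hk => hbP₁ i hi k (hKK hk)
  have htouch := fun i hi k hk => htouch₁ i hi k (hKK hk)
  set m := (c ^ 3 * t + 2).choose t * t + 3 with hm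
  have hlink : ∀ i < m, ∀ k ∈ K, ∀ l ∈ K, ∃ σ, IsLink G (b k) (b l) σ ∧ ∀ x ∈ σ, x ∈ P i :=
    fun i hi k hk l hl => (hP i hi).conn.exists_isLink (fun h => hbP i hi k hk _ h rfl)
      (fun h => hbP i hi l hl _ h rfl) (htouch i hi k hk) (htouch i hi l hl)
  have hsum : ∀ i < m, ∀ j < m, i ≠ j → ∀ k ∈ K, ∀ l ∈ K, k ≠ l → ∀ σ τ,
      IsLink G (b k) (b l) σ → (∀ x ∈ σ, x ∈ P i) → IsLink G (b k) (b l) τ →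
      (∀ x ∈ τ, x ∈ P j) → (σ.length + 1) + (τ.length + 1) ∈ C := by
    intro i hi j hj hij k hk l hl hkl σ τ hσ hσP hτ hτP
    obtain ⟨l, h1, h2⟩ := hσ.exists_cycle hτ (hb k hk l hl hkl).1 (hb k hk l hl hkl).2
      ((hPP i hi j hj hij).mono hσP hτP)
    exact h2 ▸ hC l h1
  have hE : ∀ i < m, ∀ k ∈ K, ∀ l ∈ K, k ≠ l → ∀ σ, IsLink G (b k) (b l) σ →
      (∀ x ∈ σ, x ∈ P i) → σ.length + 1 ∈ halfDiffs C := by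
    intro i hi k hk l hl hkl σ hσ hσP
    obtain ⟨j, j', hj, hj', h1, h2, h3⟩ : ∃ j j', j < m ∧ j' < m ∧ i ≠ j ∧ i ≠ j' ∧ j ≠ j' := by
      rcases i with _ | _ | i
      · exact ⟨1, 2, by omega, by omega, by omega, by omega, by omega⟩
      · exact ⟨0, 2, by omega, by omega, by omega, by omega, by omega⟩
      · exact ⟨0, 1, by omega, by omega, by omega, by omega, by omega⟩
    obtain ⟨τ, hτ, hτP⟩ := hlink j hj k hk l hl
    obtain ⟨υ, hυ, hυP⟩ := hlink j' hj' k hk l hl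
    exact mem_halfDiffs (hsum i hi j hj h1 k hk l hl hkl σ τ hσ hσP hτ hτP)
      (hsum i hi j' hj' h2 k hk l hl hkl σ υ hσ hσP hυ hυP)
      (hsum j hj j' hj' h3 k hk l hl hkl τ υ hτ hτP hυ hυP)
  have hcom : ∀ i < m, ∃ x ∈ P i, ∃ K' ⊆ K, K'.card = t ∧ ∀ k ∈ K', G.Adj (b k) x := fun i hi =>
    exists_common_neighbour ht ((card_halfDiffs_le C).trans (Nat.pow_le_pow_left hCc 3)) (hP i hi)
      (hbP i hi) (htouch i hi) (hE i hi) hK.ge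
  obtain ⟨Y, hY, I, hI, hIt, hIY⟩ := exists_common_value (K := Finset.range m)
    (E := K.powersetCard t) (R := fun i Y => ∃ x ∈ P i, ∀ k ∈ Y, G.Adj (b k) x)
    (c := (c ^ 3 * t + 2).choose t) (n := t) (by rw [Finset.card_powersetCard, hK])
    (fun i hi => by
      obtain ⟨x, hx, K', hK', hKt, h⟩ := hcom i (Finset.mem_range.1 hi)
      exact ⟨K', Finset.mem_powersetCard.2 ⟨hK', hKt⟩, x, hx, h⟩)
    (by rw [Finset.card_range]; omega)
  obtain ⟨hYK, hYt⟩ := Finset.mem_powersetCard.1 hY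
  have : Nonempty V := by
    obtain ⟨i, hi⟩ : I.Nonempty := Finset.card_pos.1 (by omega)
    exact ⟨(hIY i hi).choose⟩
  choose! x hxP hxY using hIY
  have hIm : ∀ i ∈ I, i < m := fun i hi => Finset.mem_range.1 (hI hi)
  refine hfree.false_of_biclique (X := I.image x) (Y := Y.image b) ?_ ?_ ?_ ?_ ?_
  · rw [Finset.card_image_of_injOn, hIt]
    intro i hi j hj e
    by_contra hne
    exact (hPP i (hIm i hi) j (hIm j hj) hne _ (hxP i hi) _ (hxP j hj)).1 e
  · rw [Finset.card_image_of_injOn, hYt]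
    intro k hk l hl e
    by_contra hne
    exact (hb k (hYK hk) l (hYK hl) hne).1 e
  · simp only [Finset.mem_image]
    rintro _ ⟨i, hi, rfl⟩ _ ⟨j, hj, rfl⟩ e
    by_cases hij : i = j
    · subst hij; exact e.ne rfl
    · exact (hPP i (hIm i hi) j (hIm j hj) hij _ (hxP i hi) _ (hxP j hj)).2 e
  · simp only [Finset.mem_image]
    rintro _ ⟨k, hk, rfl⟩ _ ⟨l, hl, rfl⟩ e
    by_cases hkl : k = l
    · subst hkl; exact e.ne rfl
    · exact (hb k (hYK hk) l (hYK hl) hkl).2 e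
  · simp only [Finset.mem_image]
    rintro _ ⟨i, hi, rfl⟩ _ ⟨k, hk, rfl⟩
    exact (hxY i hi k hk).symm

end

/-! ### Linking many connected sets through one connected set -/

/-- The stretch of the list `Q` from position `a` to position `b`, both included. -/
def segment {α : Type*} (Q : List α) (a b : ℕ) : List α := (Q.drop a).take (b + 1 - a)

section
variable {V : Type u} {G : SimpleGraph V} {κ : Type v}

theorem mem_segment {α : Type*} {Q : List α} {a b : ℕ} {x : α} :
    x ∈ segment Q a b ↔ ∃ i, a ≤ i ∧ i ≤ b ∧ Q[i]? = some x := by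
  rw [segment, List.mem_iff_getElem?]
  constructor
  · rintro ⟨i, hi⟩
    rw [List.getElem?_take] at hi
    split_ifs at hi with h
    rw [List.getElem?_drop] at hi
    exact ⟨a + i, by omega, by omega, hi⟩
  · rintro ⟨i, h1, h2, h3⟩
    refine ⟨i - a, ?_⟩
    rw [List.getElem?_take, if_pos (by omega), List.getElem?_drop]
    rwa [show a + (i - a) = i by omega]

theorem IsInducedPath.segment {Q : List V} (h : IsInducedPath G Q) (a b : ℕ) :
    IsInducedPath G (segment Q a b) := by
  rw [← List.take_append_drop a Q] at h
  have h' := h.right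
  rw [← List.take_append_drop (b + 1 - a) (Q.drop a)] at h'
  exact h'.left

theorem length_segment {α : Type*} {Q : List α} {a b : ℕ} (hb : b < Q.length) :
    (segment Q a b).length = b + 1 - a := by
  rw [segment, List.length_take, List.length_drop]
  omega

theorem head?_segment {α : Type*} {Q : List α} {a b : ℕ} (hab : a ≤ b) :
    (segment Q a b).head? = Q[a]? := by
  rw [segment, List.head?_eq_getElem?, List.getElem?_take, if_pos (by omega), List.getElem?_drop]
  simp

theorem getLast?_segment {α : Type*} {Q : List α} {a b : ℕ} (hab : a ≤ b) (hb : b < Q.length) :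
    (segment Q a b).getLast? = Q[b]? := by
  rw [List.getLast?_eq_getElem?, length_segment hb, segment, List.getElem?_take,
    if_pos (by omega), List.getElem?_drop]
  congr 1
  omega

theorem IsInducedPath.getElem?_inj {Q : List V} (h : IsInducedPath G Q) {i j : ℕ} {x : V}
    (hi : Q[i]? = some x) (hj : Q[j]? = some x) : i = j := by
  obtain ⟨hi1, hi2⟩ := List.getElem?_eq_some_iff.1 hi
  obtain ⟨hj1, hj2⟩ := List.getElem?_eq_some_iff.1 hj
  exact (List.Nodup.getElem_inj_iff h.nodup).1 (hi2.trans hj2.symm)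

theorem IsInducedPath.anticomplete_segment {Q : List V} (h : IsInducedPath G Q) {a b a' b' : ℕ}
    (hsep : b + 1 < a') :
    Anticomplete G {x | x ∈ InducedCycles.segment Q a b}
      {x | x ∈ InducedCycles.segment Q a' b'} := by
  intro x hx y hy
  obtain ⟨i, hi1, hi2, hi3⟩ := mem_segment.1 hx
  obtain ⟨j, hj1, hj2, hj3⟩ := mem_segment.1 hy
  refine ⟨?_, ?_⟩
  · rintro rfl
    have := h.getElem?_inj hi3 hj3
    omega
  · intro e
    obtain ⟨hi4, rfl⟩ := List.getElem?_eq_some_iff.1 hi3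
    obtain ⟨hj4, rfl⟩ := List.getElem?_eq_some_iff.1 hj3
    have := (h.getElem_adj i j hi4 hj4).1 e
    omega

theorem exists_extremes (K : Finset κ) (S : κ → Set ℕ) (a b : ℕ)
    (h : ∀ k ∈ K, ∃ x ∈ S k, a ≤ x ∧ x ≤ b) : ∃ f e : κ → ℕ, ∀ k ∈ K, f k ∈ S k ∧ e k ∈ S k ∧
      a ≤ f k ∧ e k ≤ b ∧ f k ≤ e k ∧ ∀ i ∈ S k, a ≤ i → i ≤ b → f k ≤ i ∧ i ≤ e k := by
  have : ∀ k ∈ K, ∃ f e, f ∈ S k ∧ e ∈ S k ∧ a ≤ f ∧ e ≤ b ∧ f ≤ e ∧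
      ∀ i ∈ S k, a ≤ i → i ≤ b → f ≤ i ∧ i ≤ e := by
    intro k hk
    obtain ⟨x, hx, hxa, hxb⟩ := h k hk
    have hfin : (S k ∩ Set.Icc a b).Finite := (Set.finite_Icc a b).inter_of_right _
    obtain ⟨f, hf, hfm⟩ := Set.exists_min_image (S k ∩ Set.Icc a b) id hfin ⟨x, hx, hxa, hxb⟩
    obtain ⟨e, he, hem⟩ := Set.exists_max_image (S k ∩ Set.Icc a b) id hfin ⟨x, hx, hxa, hxb⟩
    exact ⟨f, e, hf.1, he.1, hf.2.1, he.2.2, hfm e he,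
      fun i hi hia hib => ⟨hfm i ⟨hi, hia, hib⟩, hem i ⟨hi, hia, hib⟩⟩⟩
  choose! f e hfe using this
  exact ⟨f, e, hfe⟩

/-- The positions on `Q` of the neighbours of `x`. -/
def positions (G : SimpleGraph V) (Q : List V) (x : V) : Set ℕ :=
  {i | ∃ q, Q[i]? = some q ∧ G.Adj x q}

theorem lt_length_of_mem_positions {Q : List V} {x : V} {i : ℕ} (h : i ∈ positions G Q x) :
    i < Q.length := by
  obtain ⟨q, h, -⟩ := h
  exact (List.getElem?_eq_some_iff.1 h).1

/-- Pairwise distinct, pairwise nonadjacent vertices off an induced path `Q`, all with neighbours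
in many separated stretches of `Q`, form a constellation. -/
theorem exists_stretches_bound (c t : ℕ) (ht : 1 ≤ t) : ∃ n m : ℕ, ∀ {V : Type u}
    {G : SimpleGraph V} {C : Finset ℕ} {κ : Type v} (K : Finset κ) (b : κ → V) (Q : List V)
    (lo hi : ℕ → ℕ), C.card ≤ c → (∀ l, IsInducedCycle G l → l.length ∈ C) →
    IndFree G (biclique t) → n ≤ K.card →
    (∀ k ∈ K, ∀ l ∈ K, k ≠ l → b k ≠ b l ∧ ¬ G.Adj (b k) (b l)) → IsInducedPath G Q →
    (∀ k ∈ K, b k ∉ Q) → (∀ i < m, ∀ k ∈ K, ∃ x ∈ positions G Q (b k), lo i ≤ x ∧ x ≤ hi i) →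
    (∀ i j, i < j → j < m → hi i + 1 < lo j) → False := by
  obtain ⟨n, m, h⟩ := exists_constellation_bound.{u, v} c t ht
  refine ⟨n, m, fun {V G C κ} K b Q lo hi hCc hC hfree hK hb hQ hbQ hmeet hsep => ?_⟩
  refine h K b (fun i => segment Q (lo i) (hi i)) hCc hC hfree hK hb (fun i _ => hQ.segment _ _)
    ?_ ?_ ?_
  · intro i hi j hj hij
    rcases Nat.lt_or_gt_of_ne hij with hlt | hlt
    · exact hQ.anticomplete_segment (hsep i j hlt hj)
    · exact (hQ.anticomplete_segment (hsep j i hlt hi)).symm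
  · rintro i hi k hk x hx rfl
    obtain ⟨j, -, -, h3⟩ := mem_segment.1 hx
    exact hbQ k hk (List.mem_of_getElem? h3)
  · intro i hi k hk
    obtain ⟨j, ⟨q, hq, e⟩, h1, h2⟩ := hmeet i hi k hk
    exact ⟨q, mem_segment.2 ⟨j, h1, h2, hq⟩, e⟩

/-- The conclusion of the linkage lemma. For `k ∈ K` there is a start vertex `b k ∈ U k`, and any
two start vertices are joined by an induced path through `H` and the two sets `B k`, `B l` that
meets `U k` and `U l` only in its ends. Its length splits as `g k + g l + α k l`, where `α` is
subject to a four-point inequality whenever `ord`, or its negation, holds for all pairs of the four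
indices in their order. -/
structure IsLinkage (G : SimpleGraph V) (H : Set V) (B U : κ → Set V) (K : Finset κ) (b : κ → V)
    (g : κ → ℕ) (α : κ → κ → ℕ) (ord : κ → κ → Prop) : Prop where
  start : ∀ k ∈ K, b k ∈ U k
  link : ∀ k ∈ K, ∀ l ∈ K, k ≠ l → ∃ M : List V, IsInducedPath G M ∧ M.head? = some (b k) ∧
    M.getLast? = some (b l) ∧ (∀ x ∈ M, x ∈ H ∨ x ∈ B k ∨ x ∈ B l) ∧
    (∀ x ∈ M, x ∈ U k → x = b k) ∧ (∀ x ∈ M, x ∈ U l → x = b l) ∧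
    M.length = g k + g l + α k l
  quad : ∀ k₁ ∈ K, ∀ k₂ ∈ K, ∀ k₃ ∈ K, ∀ k₄ ∈ K, [k₁, k₂, k₃, k₄].Nodup →
    ([k₁, k₂, k₃, k₄].Pairwise ord ∨ [k₁, k₂, k₃, k₄].Pairwise fun k l => ¬ ord k l) →
    α k₁ k₂ + α k₃ k₄ ≤ α k₁ k₃ + α k₂ k₄

/-- Concatenation of two disjoint induced paths and a stretch of a third one between their last
vertices. -/
theorem exists_concat {Q β γ : List V} (hQ : IsInducedPath G Q) (hβ : IsInducedPath G β)
    (hγ : IsInducedPath G γ) {p q : V} (hp : β.getLast? = some p) (hq : γ.getLast? = some q)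
    (hβγ : Anticomplete G {x | x ∈ β} {x | x ∈ γ}) (hβQ : ∀ x ∈ β, x ∉ Q) (hγQ : ∀ x ∈ γ, x ∉ Q)
    (hβp : ∀ x ∈ β, ∀ y ∈ Q, G.Adj x y → x = p) (hγq : ∀ x ∈ γ, ∀ y ∈ Q, G.Adj x y → x = q)
    {e f : ℕ} (hef : e ≤ f) (he : e ∈ positions G Q p) (hf : f ∈ positions G Q q)
    (hpe : ∀ i ∈ positions G Q p, e ≤ i → i ≤ f → i = e)
    (hqf : ∀ i ∈ positions G Q q, e ≤ i → i ≤ f → i = f) :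
    IsInducedPath G (β ++ segment Q e f ++ γ.reverse) := by
  have hsegQ : ∀ x ∈ segment Q e f, x ∈ Q := fun x hx => by
    obtain ⟨i, -, -, h⟩ := mem_segment.1 hx
    exact List.mem_of_getElem? h
  have hhead := head?_segment (Q := Q) hef
  have hlast := getLast?_segment hef (lt_length_of_mem_positions hf)
  have hne : segment Q e f ≠ [] := by
    intro h
    rw [h] at hhead
    obtain ⟨y, hy, -⟩ := he
    rw [hy] at hhead
    simp at hhead
  have h1 : IsInducedPath G (β ++ segment Q e f) := by
    refine hβ.append (hQ.segment e f) fun x hx y hy => ?_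
    have hyQ := hsegQ y hy
    refine ⟨by rintro rfl; exact hβQ _ hx hyQ, ?_⟩
    rw [hp, hhead, Option.some.injEq]
    constructor
    · intro hxy
      have := hβp x hx y hyQ hxy
      subst this
      obtain ⟨i, hi1, hi2, hi3⟩ := mem_segment.1 hy
      have := hpe i ⟨y, hi3, hxy⟩ hi1 hi2
      exact ⟨rfl, this ▸ hi3⟩
    · rintro ⟨rfl, h⟩
      obtain ⟨z, hz, hadj⟩ := he
      rw [hz, Option.some.injEq] at h
      exact h ▸ hadj
  refine h1.append hγ.reverse fun x hx y hy => ?_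
  rw [List.mem_reverse] at hy
  have hl : (β ++ segment Q e f).getLast? = Q[f]? := by
    rw [List.getLast?_append_of_ne_nil _ hne, hlast]
  rw [hl, List.head?_reverse, hq, Option.some.injEq]
  rcases List.mem_append.1 hx with hx | hx
  · refine ⟨(hβγ x hx y hy).1, ⟨fun h => absurd h (hβγ x hx y hy).2, ?_⟩⟩
    rintro ⟨h, -⟩
    exact absurd (List.mem_of_getElem? h) (hβQ x hx)
  · have hxQ := hsegQ x hx
    refine ⟨by rintro rfl; exact hγQ _ hy hxQ, ?_⟩
    constructor
    · intro hxy
      have := hγq y hy x hxQ hxy.symm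
      subst this
      obtain ⟨i, hi1, hi2, hi3⟩ := mem_segment.1 hx
      have := hqf i ⟨x, hi3, hxy.symm⟩ hi1 hi2
      exact ⟨this ▸ hi3, rfl⟩
    · rintro ⟨h, rfl⟩
      obtain ⟨z, hz, hadj⟩ := hf
      rw [hz, Option.some.injEq] at h
      exact h ▸ hadj.symm

/-- Linkage along an induced path `Q`: the neighbours of the last vertices `s k` of the paths `β k`
occupy comparable stretches of `Q` between positions `a` and `a'`. -/
theorem exists_linkage_of_path {H : Set V} {B U Z : κ → Set V} {K : Finset κ} {Q : List V}
    {b s : κ → V} {β : κ → List V} (hQ : IsInducedPath G Q) (hQH : ∀ x ∈ Q, x ∈ H)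
    (hUB : ∀ k ∈ K, U k ⊆ B k) (hBH : ∀ k ∈ K, ∀ x ∈ B k, x ∉ H) (hBZ : ∀ k ∈ K, B k ⊆ Z k)
    (hZ : ∀ k ∈ K, Z k ⊆ H ∪ B k) (hZQ : ∀ k ∈ K, ∀ x ∈ Z k, x ∉ Q)
    (hZZ : ∀ k ∈ K, ∀ l ∈ K, k ≠ l → Anticomplete G (Z k) (Z l))
    (hβ : ∀ k ∈ K, IsInducedPath G (β k)) (hβZ : ∀ k ∈ K, ∀ x ∈ β k, x ∈ Z k)
    (hhead : ∀ k ∈ K, (β k).head? = some (b k)) (hlast : ∀ k ∈ K, (β k).getLast? = some (s k))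
    (hb : ∀ k ∈ K, b k ∈ U k) (hβU : ∀ k ∈ K, ∀ x ∈ β k, x ∈ U k → x = b k)
    (hβQ : ∀ k ∈ K, ∀ x ∈ β k, ∀ y ∈ Q, G.Adj x y → x = s k) {a a' : ℕ}
    (hpos : ∀ k ∈ K, ∃ x ∈ positions G Q (s k), a ≤ x ∧ x ≤ a')
    (hcomp : ∀ k ∈ K, ∀ l ∈ K, k ≠ l →
      (∀ x ∈ positions G Q (s k), ∀ y ∈ positions G Q (s l), a ≤ x → x ≤ a' → a ≤ y → y ≤ a' →
        x ≤ y) ∨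
      (∀ x ∈ positions G Q (s k), ∀ y ∈ positions G Q (s l), a ≤ x → x ≤ a' → a ≤ y → y ≤ a' →
        y ≤ x)) :
    ∃ g α ord, IsLinkage G H B U K b g α ord := by
  classical
  obtain ⟨f, e, hfe⟩ := exists_extremes K (fun k => positions G Q (s k)) a a' hpos
  have hcomp' : ∀ k ∈ K, ∀ l ∈ K, k ≠ l → e k ≤ f l ∨ e l ≤ f k := by
    intro k hk l hl hkl
    obtain ⟨h1, h2, h3, h4, h5, -⟩ := hfe k hk
    obtain ⟨h1', h2', h3', h4', h5', -⟩ := hfe l hl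
    rcases hcomp k hk l hl hkl with h | h
    · exact Or.inl (h _ h2 _ h1' (by omega) (by omega) (by omega) (by omega))
    · exact Or.inr (h _ h1 _ h2' (by omega) (by omega) (by omega) (by omega))
  have key : ∀ k ∈ K, ∀ l ∈ K, k ≠ l → e k ≤ f l → ∃ M : List V, IsInducedPath G M ∧
      M.head? = some (b k) ∧ M.getLast? = some (b l) ∧ (∀ x ∈ M, x ∈ H ∨ x ∈ B k ∨ x ∈ B l) ∧
      (∀ x ∈ M, x ∈ U k → x = b k) ∧ (∀ x ∈ M, x ∈ U l → x = b l) ∧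
      M.length = (β k).length + (β l).length + (f l + 1 - e k) := by
    intro k hk l hl hkl hef
    obtain ⟨h1, h2, h3, h4, h5, h6⟩ := hfe k hk
    obtain ⟨h1', h2', h3', h4', h5', h6'⟩ := hfe l hl
    have hanti := hZZ k hk l hl hkl
    have hmem : ∀ x ∈ β k ++ segment Q (e k) (f l) ++ (β l).reverse,
        x ∈ β k ∨ x ∈ Q ∨ x ∈ β l := by
      intro x hx
      rcases List.mem_append.1 hx with hx | hx
      · rcases List.mem_append.1 hx with hx | hx
        · exact Or.inl hx
        · obtain ⟨i, -, -, h⟩ := mem_segment.1 hx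
          exact Or.inr (Or.inl (List.mem_of_getElem? h))
      · exact Or.inr (Or.inr (List.mem_reverse.1 hx))
    have hin : ∀ k ∈ K, ∀ x ∈ β k, x ∈ H ∨ x ∈ B k := fun k hk x hx => hZ k hk (hβZ k hk x hx)
    refine ⟨β k ++ segment Q (e k) (f l) ++ (β l).reverse,
      exists_concat hQ (hβ k hk) (hβ l hl) (hlast k hk) (hlast l hl)
        (hanti.mono (hβZ k hk) (hβZ l hl)) (fun x hx => hZQ k hk x (hβZ k hk x hx))
        (fun x hx => hZQ l hl x (hβZ l hl x hx)) (hβQ k hk) (hβQ l hl) hef h2 h1'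
        (fun i hi h7 h8 => ?_) (fun i hi h7 h8 => ?_), ?_, ?_, ?_, ?_, ?_, ?_⟩
    · have := (h6 i hi (by omega) (by omega)).2
      omega
    · have := (h6' i hi (by omega) (by omega)).1
      omega
    · rw [List.append_assoc, List.head?_append, hhead k hk]; rfl
    · have hne : (β l).reverse ≠ [] := by
        intro h
        rw [List.reverse_eq_nil_iff] at h
        have := hhead l hl
        rw [h] at this
        simp at this
      rw [List.getLast?_append_of_ne_nil _ hne, List.getLast?_reverse, hhead l hl]
    · intro x hx
      rcases hmem x hx with hx | hx | hx
      · exact (hin k hk x hx).imp id Or.inl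
      · exact Or.inl (hQH x hx)
      · exact (hin l hl x hx).imp id Or.inr
    · intro x hx hxU
      rcases hmem x hx with hx | hx | hx
      · exact hβU k hk x hx hxU
      · exact absurd (hQH x hx) (hBH k hk x (hUB k hk hxU))
      · exact absurd rfl (hanti x (hBZ k hk (hUB k hk hxU)) x (hβZ l hl x hx)).1
    · intro x hx hxU
      rcases hmem x hx with hx | hx | hx
      · exact absurd rfl (hanti x (hβZ k hk x hx) x (hBZ l hl (hUB l hl hxU))).1
      · exact absurd (hQH x hx) (hBH l hl x (hUB l hl hxU))
      · exact hβU l hl x hx hxU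
    · rw [List.length_append, List.length_append, List.length_reverse,
        length_segment (lt_length_of_mem_positions h1')]
      omega
  refine ⟨fun k => (β k).length, fun k l => if e k ≤ f l then f l + 1 - e k else f k + 1 - e l,
    fun k l => e k ≤ f l, hb, ?_, ?_⟩
  · intro k hk l hl hkl
    by_cases hord : e k ≤ f l
    · obtain ⟨M, h⟩ := key k hk l hl hkl hord
      exact ⟨M, by simpa [hord] using h⟩
    · obtain ⟨M, h1, h2, h3, h4, h5, h6, h7⟩ :=
        key l hl k hk hkl.symm ((hcomp' k hk l hl hkl).resolve_left hord)
      refine ⟨M.reverse, h1.reverse, by rw [List.head?_reverse, h3],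
        by rw [List.getLast?_reverse, h2], ?_, ?_, ?_, ?_⟩
      · intro x hx
        have := h4 x (List.mem_reverse.1 hx)
        tauto
      · exact fun x hx => h6 x (List.mem_reverse.1 hx)
      · exact fun x hx => h5 x (List.mem_reverse.1 hx)
      · rw [List.length_reverse, h7, if_neg hord]
        omega
  · intro k₁ hk₁ k₂ hk₂ k₃ hk₃ k₄ hk₄ hnd hord
    have h₁ := hfe k₁ hk₁
    have h₂ := hfe k₂ hk₂
    have h₃ := hfe k₃ hk₃
    have h₄ := hfe k₄ hk₄
    simp only [List.nodup_cons, List.mem_cons, List.not_mem_nil, or_false, not_or] at hnd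
    have c₁₂ := hcomp' k₁ hk₁ k₂ hk₂ hnd.1.1
    have c₁₃ := hcomp' k₁ hk₁ k₃ hk₃ hnd.1.2.1
    have c₂₃ := hcomp' k₂ hk₂ k₃ hk₃ hnd.2.1.1
    have c₂₄ := hcomp' k₂ hk₂ k₄ hk₄ hnd.2.1.2
    have c₃₄ := hcomp' k₃ hk₃ k₄ hk₄ hnd.2.2.1
    rcases hord with hord | hord
    · simp only [List.pairwise_cons, List.mem_cons, List.not_mem_nil, or_false,
        forall_eq_or_imp, forall_eq] at hord
      obtain ⟨⟨o₁₂, o₁₃, o₁₄⟩, ⟨o₂₃, o₂₄⟩, o₃₄, -⟩ := hord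
      simp only [o₁₂, o₃₄, o₁₃, o₂₄, if_true]
      omega
    · simp only [List.pairwise_cons, List.mem_cons, List.not_mem_nil, or_false,
        forall_eq_or_imp, forall_eq] at hord
      obtain ⟨⟨o₁₂, o₁₃, o₁₄⟩, ⟨o₂₃, o₂₄⟩, o₃₄, -⟩ := hord
      simp only [o₁₂, o₃₄, o₁₃, o₂₄, if_false]
      omega

end

section
variable {V : Type u} {G : SimpleGraph V} {κ : Type v}

/-- The vertices adjacent to the set `B`. -/
def contact (G : SimpleGraph V) (B : Set V) : Set V := {x | ∃ y ∈ B, G.Adj x y}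

/-- Linkage through a clique: a link runs down one leg, along an edge of the clique and up another
leg, so that `α` can be taken constant. -/
theorem CliqueType.exists_linkage {H : Set V} {B U : κ → Set V} {K : Finset κ} {p : κ → V}
    {L : κ → Set V} (h : CliqueType G H (fun k => contact G (B k)) K p L)
    (hB : ∀ k ∈ K, Conn G (B k)) (hBB : ∀ k ∈ K, ∀ l ∈ K, k ≠ l → Anticomplete G (B k) (B l))
    (hBH : ∀ k ∈ K, ∀ x ∈ B k, x ∉ H) (hUB : ∀ k ∈ K, U k ⊆ B k)
    (hU : ∀ k ∈ K, (U k).Nonempty) : ∃ b g α ord, IsLinkage G H B U K b g α ord := by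
  classical
  have hBL : ∀ k ∈ K, ∀ l ∈ K, k ≠ l → Anticomplete G (B k) (L l) := by
    intro k hk l hl hkl x hx y hy
    refine ⟨by rintro rfl; exact hBH k hk _ hx (h.leg_sub l hl hy), fun e => ?_⟩
    exact h.leg_private l hl k hk hkl.symm y hy ⟨x, hx, e.symm⟩
  have hBp : ∀ k ∈ K, ∀ l ∈ K, k ≠ l → Anticomplete G (B k) {p l} := by
    rintro k hk l hl hkl x hx _ rfl
    refine ⟨by rintro rfl; exact hBH k hk _ hx (h.port_mem l hl), fun e => ?_⟩
    exact h.port_private l hl k hk hkl.symm ⟨x, hx, e.symm⟩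
  have hconn : ∀ k ∈ K, Conn G (B k ∪ (L k ∪ {p k})) := by
    intro k hk
    rcases h.leg k hk with ⟨h1, y, hy, e⟩ | ⟨h1, h2, x, hx, y, hy, e⟩
    · rw [h1, Set.empty_union]
      exact (hB k hk).union (conn_singleton _) ⟨y, hy, _, rfl, e.symm⟩
    · exact (hB k hk).union (h1.union (conn_singleton _) h2.symm) ⟨y, hy, x, Or.inl hx, e.symm⟩
  have hpath : ∀ k ∈ K, ∃ (β : List V) (b : V), IsInducedPath G β ∧
      (∀ x ∈ β, x ∈ B k ∪ (L k ∪ {p k})) ∧ β.head? = some b ∧ β.getLast? = some (p k) ∧ b ∈ U k ∧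
      (∀ x ∈ β, x ∈ U k → x = b) := by
    intro k hk
    obtain ⟨u, hu⟩ := hU k hk
    obtain ⟨β, b, q, h1, h2, h3, h4, h5, h6, h7, -⟩ := (hconn k hk).exists_path (S := U k)
      (T := {p k}) ⟨u, Or.inl (hUB k hk hu), hu⟩ ⟨p k, Or.inr (Or.inr rfl), rfl⟩
    exact ⟨β, b, h1, h2, h3, by rw [h4, Set.mem_singleton_iff.1 h6], h5, h7⟩
  rcases K.eq_empty_or_nonempty with rfl | ⟨k₀, hk₀⟩
  · by_cases hκ : Nonempty (κ → V)
    · obtain ⟨b⟩ := hκ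
      exact ⟨b, fun _ => 0, fun _ _ => 0, fun _ _ => True, by constructor <;> simp⟩
    · exact absurd ⟨p⟩ hκ
  have : Nonempty V := ⟨p k₀⟩
  choose! β b hβ hβZ hhead hlast hb hβU using hpath
  refine ⟨b, fun k => (β k).length, fun _ _ => 0, fun _ _ => True, hb, ?_, by simp⟩
  intro k hk l hl hkl
  have hanti : ∀ x ∈ β k, ∀ y ∈ β l, x ≠ y ∧ (G.Adj x y ↔ x = p k ∧ y = p l) := by
    have aux : ∀ x y, Anticomplete G {x} {y} → ¬ (x = p k ∧ y = p l) →
        x ≠ y ∧ (G.Adj x y ↔ x = p k ∧ y = p l) := fun x y h1 h2 =>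
      ⟨(h1 x rfl y rfl).1, ⟨fun e => absurd e (h1 x rfl y rfl).2, fun e => absurd e h2⟩⟩
    have single : ∀ {X : Set V} {x : V}, x ∈ X → {x} ⊆ X := fun hx => by simpa using hx
    have hpB : ∀ k ∈ K, p k ∉ B k := fun k hk hx => hBH k hk _ hx (h.port_mem k hk)
    intro x hx y hy
    rcases hβZ k hk x hx with hx | hx | hx <;> rcases hβZ l hl y hy with hy | hy | hy
    · exact aux x y ((hBB k hk l hl hkl).mono (single hx) (single hy))
        (by rintro ⟨rfl, -⟩; exact hpB k hk hx)
    · exact aux x y ((hBL k hk l hl hkl).mono (single hx) (single hy))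
        (by rintro ⟨rfl, -⟩; exact hpB k hk hx)
    · exact aux x y ((hBp k hk l hl hkl).mono (single hx) (single hy))
        (by rintro ⟨rfl, -⟩; exact hpB k hk hx)
    · exact aux x y ((hBL l hl k hk hkl.symm).symm.mono (single hx) (single hy))
        (by rintro ⟨-, rfl⟩; exact hpB l hl hy)
    · exact aux x y ((h.leg_leg k hk l hl hkl).mono (single hx) (single hy))
        (by rintro ⟨rfl, -⟩; exact h.port_notMem k hk hx)
    · exact aux x y ((h.port_leg l hl k hk hkl.symm).symm.mono (single hx) (single hy))
        (by rintro ⟨rfl, -⟩; exact h.port_notMem k hk hx)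
    · exact aux x y ((hBp l hl k hk hkl.symm).symm.mono (single hx) (single hy))
        (by rintro ⟨-, rfl⟩; exact hpB l hl hy)
    · exact aux x y ((h.port_leg k hk l hl hkl).mono (single hx) (single hy))
        (by rintro ⟨-, rfl⟩; exact h.port_notMem l hl hy)
    · rw [Set.mem_singleton_iff] at hx hy
      subst hx hy
      have e := h.adj k hk l hl hkl
      exact ⟨e.ne, by simpa using e⟩
  have hin : ∀ k ∈ K, ∀ x ∈ β k, x ∈ H ∨ x ∈ B k := by
    intro k hk x hx
    rcases hβZ k hk x hx with hx | hx | hx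
    · exact Or.inr hx
    · exact Or.inl (h.leg_sub k hk hx)
    · exact Or.inl (Set.mem_singleton_iff.1 hx ▸ h.port_mem k hk)
  have hcross : ∀ k ∈ K, ∀ l ∈ K, k ≠ l → ∀ x ∈ β k, x ∉ U l := by
    intro k hk l hl hkl x hx hxU
    rcases hβZ k hk x hx with hx | hx | hx
    · exact (hBB k hk l hl hkl x hx x (hUB l hl hxU)).1 rfl
    · exact hBH l hl x (hUB l hl hxU) (h.leg_sub k hk hx)
    · exact hBH l hl x (hUB l hl hxU) (Set.mem_singleton_iff.1 hx ▸ h.port_mem k hk)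
  have hne : (β l).reverse ≠ [] := by
    intro h
    rw [List.reverse_eq_nil_iff] at h
    have := hhead l hl
    rw [h] at this
    simp at this
  refine ⟨β k ++ (β l).reverse, (hβ k hk).append (hβ l hl).reverse ?_, ?_, ?_, ?_, ?_, ?_, ?_⟩
  · intro x hx y hy
    obtain ⟨h1, h2⟩ := hanti x hx y (List.mem_reverse.1 hy)
    refine ⟨h1, ?_⟩
    rw [h2, hlast k hk, List.head?_reverse, hlast l hl, Option.some.injEq, Option.some.injEq,
      eq_comm, @eq_comm _ y]
  · rw [List.head?_append, hhead k hk]; rfl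
  · rw [List.getLast?_append_of_ne_nil _ hne, List.getLast?_reverse, hhead l hl]
  · intro x hx
    rcases List.mem_append.1 hx with hx | hx
    · exact (hin k hk x hx).imp id Or.inl
    · exact (hin l hl x (List.mem_reverse.1 hx)).imp id Or.inr
  · intro x hx hxU
    rcases List.mem_append.1 hx with hx | hx
    · exact hβU k hk x hx hxU
    · exact absurd hxU (hcross l hl k hk hkl.symm x (List.mem_reverse.1 hx))
  · intro x hx hxU
    rcases List.mem_append.1 hx with hx | hx
    · exact absurd hxU (hcross k hk l hl hkl x hx)
    · exact hβU l hl x (List.mem_reverse.1 hx) hxU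
  · simp

/-- Many connected sets that all touch a connected set `H` can be linked through `H`. If they are
reached from a clique, then `α` is constant. If they are reached from a path, then many of them
attach to it in one common position or in disjoint stretches, and `α` measures the distance between
the stretches. -/
theorem exists_linkage (c t : ℕ) (ht : 1 ≤ t) (n : ℕ) : ∃ F : ℕ, ∀ {V : Type u} [Finite V]
    {G : SimpleGraph V} {C : Finset ℕ} {κ : Type v} (K : Finset κ) (B U : κ → Set V) (H : Set V),
    C.card ≤ c → (∀ l, IsInducedCycle G l → l.length ∈ C) → IndFree G (biclique t) →
    F ≤ K.card → Conn G H → H.Nonempty → (∀ k ∈ K, Conn G (B k)) →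
    (∀ k ∈ K, ∀ l ∈ K, k ≠ l → Anticomplete G (B k) (B l)) → (∀ k ∈ K, ∀ x ∈ B k, x ∉ H) →
    (∀ k ∈ K, Touches G H (B k)) → (∀ k ∈ K, U k ⊆ B k) → (∀ k ∈ K, (U k).Nonempty) →
    ∃ K' ⊆ K, K'.card = n ∧ ∃ b g α ord, IsLinkage G H B U K' b g α ord := by
  classical
  obtain ⟨nc, mc, hconst⟩ := exists_stretches_bound.{u, v} c t ht
  obtain ⟨Fp, hFp⟩ := exists_position_structure.{v} n (n + nc) mc
  obtain ⟨F, hF⟩ := exists_type.{u, v} (Fp + n)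
  refine ⟨F, ?_⟩
  intro V _ G C κ K B U H hCc hC hfree hK hH hHne hB hBB hBH hBt hUB hU
  rcases hF (fun k => contact G (B k)) H K hH hHne (fun k hk => hBt k hk) hK with
    ⟨S, hS, hSn, p, L, h⟩ | ⟨S, hS, hSn, Q, L, h⟩
  · obtain ⟨K', hK', hn⟩ := Finset.exists_subset_card_eq (show n ≤ S.card by omega)
    have h' := h.subset hK'
    have hsub : K' ⊆ K := hK'.trans hS
    exact ⟨K', hsub, hn, h'.exists_linkage (fun k hk => hB k (hsub hk))
      (fun k hk l hl => hBB k (hsub hk) l (hsub hl)) (fun k hk => hBH k (hsub hk))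
      (fun k hk => hUB k (hsub hk)) (fun k hk => hU k (hsub hk))⟩
  · have hZZ : ∀ k ∈ S, ∀ l ∈ S, k ≠ l → Anticomplete G (B k ∪ L k) (B l ∪ L l) := by
      have hBL : ∀ k ∈ S, ∀ l ∈ S, k ≠ l → Anticomplete G (B k) (L l) := by
        intro k hk l hl hkl x hx y hy
        refine ⟨by rintro rfl; exact hBH k (hS hk) _ hx (h.leg_sub l hl hy), fun e => ?_⟩
        exact h.leg_private l hl k hk hkl.symm y hy ⟨x, hx, e.symm⟩
      intro k hk l hl hkl
      exact ((hBB k (hS hk) l (hS hl) hkl).union_right (hBL k hk l hl hkl)).union_left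
        ((hBL l hl k hk hkl.symm).symm.union_right (h.leg_leg k hk l hl hkl))
    have hZQ : ∀ k ∈ S, ∀ x ∈ B k ∪ L k, x ∉ Q := by
      rintro k hk x (hx | hx) hxQ
      · exact hBH k (hS hk) x hx (h.path_sub x hxQ)
      · exact h.path_notMem k hk x hxQ hx
    have hconn : ∀ k ∈ S, Conn G (B k ∪ L k) := by
      intro k hk
      rcases h.leg k hk with ⟨h1, -⟩ | ⟨h1, h2, x, hx, y, hy, e⟩
      · rw [h1, Set.union_empty]; exact hB k (hS hk)
      · exact (hB k (hS hk)).union h1 ⟨y, hy, x, hx, e.symm⟩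
    have htouch : ∀ k ∈ S, ∃ x ∈ B k ∪ L k, x ∈ contact G {q | q ∈ Q} := by
      intro k hk
      rcases h.leg k hk with ⟨h1, q, hq, y, hy, e⟩ | ⟨h1, ⟨q, hq, x, hx, e⟩, h3⟩
      · exact ⟨y, Or.inl hy, q, hq, e.symm⟩
      · exact ⟨x, Or.inr hx, q, hq, e.symm⟩
    have hpath : ∀ k ∈ S, ∃ (β : List V) (b s : V), IsInducedPath G β ∧
        (∀ x ∈ β, x ∈ B k ∪ L k) ∧ β.head? = some b ∧ β.getLast? = some s ∧ b ∈ U k ∧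
        s ∈ contact G {q | q ∈ Q} ∧ (∀ x ∈ β, x ∈ U k → x = b) ∧
        (∀ x ∈ β, x ∈ contact G {q | q ∈ Q} → x = s) := by
      intro k hk
      obtain ⟨u, hu⟩ := hU k (hS hk)
      exact (hconn k hk).exists_path (S := U k) (T := contact G {q | q ∈ Q})
        ⟨u, Or.inl (hUB k (hS hk) hu), hu⟩ (htouch k hk)
    have : Nonempty V := hHne.to_type
    choose! β b s hβ hβZ hhead hlast hb hs hβU hβs using hpath
    have hpos : ∀ k ∈ S, ∃ x ∈ positions G Q (s k), 0 ≤ x ∧ x ≤ Q.length := by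
      intro k hk
      obtain ⟨q, hq, e⟩ := hs k hk
      obtain ⟨i, hi⟩ := List.mem_iff_getElem?.1 hq
      have hi' : i ∈ positions G Q (s k) := ⟨q, hi, e⟩
      exact ⟨i, hi', Nat.zero_le _, (lt_length_of_mem_positions hi').le⟩
    have build : ∀ (K' : Finset κ), K' ⊆ S → ∀ a a' : ℕ,
        (∀ k ∈ K', ∃ x ∈ positions G Q (s k), a ≤ x ∧ x ≤ a') →
        (∀ k ∈ K', ∀ l ∈ K', k ≠ l →
        (∀ x ∈ positions G Q (s k), ∀ y ∈ positions G Q (s l), a ≤ x → x ≤ a' → a ≤ y → y ≤ a' →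
          x ≤ y) ∨
        (∀ x ∈ positions G Q (s k), ∀ y ∈ positions G Q (s l), a ≤ x → x ≤ a' → a ≤ y → y ≤ a' →
          y ≤ x)) → ∃ g α ord, IsLinkage G H B U K' b g α ord := by
      intro K' hK' a a' h1 h2
      exact exists_linkage_of_path (Z := fun k => B k ∪ L k) (s := s) (β := β) h.path h.path_sub
        (fun k hk => hUB k (hS (hK' hk))) (fun k hk => hBH k (hS (hK' hk)))
        (fun k _ => Set.subset_union_left)
        (fun k hk => Set.union_subset Set.subset_union_right
          ((h.leg_sub k (hK' hk)).trans Set.subset_union_left))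
        (fun k hk => hZQ k (hK' hk)) (fun k hk l hl => hZZ k (hK' hk) l (hK' hl))
        (fun k hk => hβ k (hK' hk)) (fun k hk => hβZ k (hK' hk)) (fun k hk => hhead k (hK' hk))
        (fun k hk => hlast k (hK' hk)) (fun k hk => hb k (hK' hk)) (fun k hk => hβU k (hK' hk))
        (fun k hk x hx y hy e => hβs k (hK' hk) x hx ⟨y, hy, e⟩) h1 h2
    rcases hFp S (fun k => positions G Q (s k)) 0 Q.length (by omega) hpos with
      ⟨x, -, -, K', hK', hn, hx⟩ | ⟨K₁, hK₁, hn₁, a, a', -, -, h1, h2⟩ |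
      ⟨K₁, hK₁, hn₁, lo, hi, h1, h2⟩
    · obtain ⟨g, α, ord, h'⟩ := build K' hK' x x (fun k hk => ⟨x, hx k hk, le_rfl, le_rfl⟩)
        (fun k _ l _ _ => Or.inl fun i _ j _ _ _ _ _ => by omega)
      exact ⟨K', hK'.trans hS, hn, b, g, α, ord, h'⟩
    · obtain ⟨K', hK', hn⟩ := Finset.exists_subset_card_eq (show n ≤ K₁.card by omega)
      obtain ⟨g, α, ord, h'⟩ := build K' (hK'.trans hK₁) a a' (fun k hk => h1 k (hK' hk))
        (fun k hk l hl hkl => (h2 k (hK' hk) l (hK' hl) hkl).imp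
          (fun h x hx y hy h3 h4 h5 h6 => (h x hx y hy h3 h4 h5 h6).le)
          (fun h x hx y hy h3 h4 h5 h6 => (h x hx y hy h3 h4 h5 h6).le))
      exact ⟨K', (hK'.trans hK₁).trans hS, hn, b, g, α, ord, h'⟩
    · exfalso
      have hsZ : ∀ k ∈ S, s k ∈ B k ∪ L k := fun k hk => hβZ k hk _ (getLast?_mem (hlast k hk))
      exact hconst K₁ s Q lo hi hCc hC hfree (by omega)
        (fun k hk l hl hkl => hZZ k (hK₁ hk) l (hK₁ hl) hkl _ (hsZ k (hK₁ hk)) _ (hsZ l (hK₁ hl)))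
        h.path (fun k hk => hZQ k (hK₁ hk) _ (hsZ k (hK₁ hk)))
        (fun i hi k hk => (h1 i hi).2.2 k hk) h2

end

section
variable {V : Type u} {G : SimpleGraph V} {κ : Type v}

/-! ### Hubs -/

/-- An induced path `M` together with a stretch of an induced path `Q` between the only neighbours
on the stretch of its two ends closes up to an induced cycle. -/
theorem exists_cycle_of_segment {Q M : List V} (hQ : IsInducedPath G Q) (hM : IsInducedPath G M)
    {p q : V} (hp : M.head? = some p) (hq : M.getLast? = some q) (hpq : p ≠ q)
    (hMQ : ∀ x ∈ M, x ∉ Q) (hadj : ∀ x ∈ M, ∀ y ∈ Q, G.Adj x y → x = p ∨ x = q) {e f : ℕ}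
    (hef : e ≤ f) (he : e ∈ positions G Q p) (hf : f ∈ positions G Q q)
    (hpe : ∀ i ∈ positions G Q p, e ≤ i → i ≤ f → i = e)
    (hqf : ∀ i ∈ positions G Q q, e ≤ i → i ≤ f → i = f) :
    ∃ l, IsInducedCycle G l ∧ l.length = M.length + (f + 1 - e) := by
  have hflen := lt_length_of_mem_positions hf
  have hhead := head?_segment (Q := Q) hef
  have hlast := getLast?_segment hef hflen
  obtain ⟨l, hl, hlen⟩ := hM.exists_cycle (l₂ := (segment Q e f).reverse)
    (hQ.segment e f).reverse (by
      rcases M with _ | ⟨a, _ | ⟨b, M⟩⟩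
      · simp at hp
      · simp at hp hq
        exact absurd (hp.symm.trans hq) hpq
      · simp) (by
      intro h
      have := congrArg List.length h
      rw [List.length_reverse, length_segment hflen] at this
      simp at this
      omega) (by
      intro x hx y hy
      rw [List.mem_reverse] at hy
      obtain ⟨i, hi1, hi2, hi3⟩ := mem_segment.1 hy
      have hyQ := List.mem_of_getElem? hi3
      rw [List.head?_reverse, List.getLast?_reverse, hlast, hhead, hp, hq, Option.some.injEq,
        Option.some.injEq]
      refine ⟨by rintro rfl; exact hMQ _ hx hyQ, fun h => ?_, ?_⟩
      · rcases hadj x hx y hyQ h with rfl | rfl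
        · exact Or.inr ⟨rfl, hpe i ⟨y, hi3, h⟩ hi1 hi2 ▸ hi3⟩
        · exact Or.inl ⟨rfl, hqf i ⟨y, hi3, h⟩ hi1 hi2 ▸ hi3⟩
      · rintro (⟨rfl, h⟩ | ⟨rfl, h⟩)
        · obtain ⟨z, hz, hz'⟩ := hf
          rw [hz, Option.some.injEq] at h
          exact h ▸ hz'
        · obtain ⟨z, hz, hz'⟩ := he
          rw [hz, Option.some.injEq] at h
          exact h ▸ hz')
  exact ⟨l, hl, by rw [hlen, List.length_reverse, length_segment hflen]⟩

/-- Of two anticomplete connected sets `H` and `H'` that touch many connected sets `B k`, the first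
one reaches many of the `B k` through a clique or from a single vertex. If it only reached them
from a path, then a linkage through `H'` would close up to cycles whose lengths satisfy a strict
four-point inequality on disjoint stretches of the path, while Ramsey's theorem makes these
lengths equal. -/
theorem exists_hub (c t : ℕ) (ht : 1 ≤ t) (n : ℕ) : ∃ F : ℕ, ∀ {V : Type u} [Finite V]
    {G : SimpleGraph V} {C : Finset ℕ} {κ : Type v} (K : Finset κ) (B : κ → Set V) (H H' : Set V),
    C.card ≤ c → (∀ l, IsInducedCycle G l → l.length ∈ C) → IndFree G (biclique t) →
    F ≤ K.card → Conn G H → H.Nonempty → Conn G H' → H'.Nonempty → Anticomplete G H H' →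
    (∀ k ∈ K, Conn G (B k)) → (∀ k ∈ K, ∀ l ∈ K, k ≠ l → Anticomplete G (B k) (B l)) →
    (∀ k ∈ K, ∀ x ∈ B k, x ∉ H) → (∀ k ∈ K, ∀ x ∈ B k, x ∉ H') →
    (∀ k ∈ K, Touches G H (B k)) → (∀ k ∈ K, Touches G H' (B k)) →
    ∃ K' ⊆ K, K'.card = n ∧
      ((∃ p L, CliqueType G H (fun k => contact G (B k)) K' p L) ∨
        ∃ v L, PathType G H (fun k => contact G (B k)) K' [v] L) := by
  classical
  obtain ⟨R, hR⟩ := exists_homogeneous_list.{v, 0} 4 (c * 4)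
  obtain ⟨nc, mc, hconst⟩ := exists_stretches_bound.{u, v} c t ht
  obtain ⟨Fp, hFp⟩ := exists_position_structure.{v} n (R + nc) mc
  obtain ⟨Fl, hFl⟩ := exists_linkage.{u, v} c t ht Fp
  obtain ⟨F, hF⟩ := exists_type.{u, v} (Fl + n + 1)
  refine ⟨F, ?_⟩
  intro V _ G C κ K B H H' hCc hC hfree hK hH hHne hH' hHne' hHH hB hBB hBH hBH' hBt hBt'
  rcases hF (fun k => contact G (B k)) H K hH hHne (fun k hk => hBt k hk) hK with
    ⟨S, hS, hSn, p, L, h⟩ | ⟨S, hS, hSn, Q, L, h⟩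
  · obtain ⟨K', hK', hn⟩ := Finset.exists_subset_card_eq (show n ≤ S.card by omega)
    exact ⟨K', hK'.trans hS, hn, Or.inl ⟨p, L, h.subset hK'⟩⟩
  let Z : κ → Set V := fun k => B k ∪ L k
  by_cases hrich : ∃ q ∈ Q, n ≤ (S.filter fun k => q ∈ contact G (Z k)).card
  · -- A vertex of the path that is adjacent to many extended sets.
    obtain ⟨q, hq, hqn⟩ := hrich
    obtain ⟨K', hK', hn⟩ := Finset.exists_subset_card_eq hqn
    have hK'S : K' ⊆ S := hK'.trans (Finset.filter_subset _ _)
    refine ⟨K', hK'S.trans hS, hn,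
      Or.inr ⟨q, fun k => if q ∈ contact G (B k) then ∅ else L k, ?_⟩⟩
    have hsub : ∀ k, (if q ∈ contact G (B k) then (∅ : Set V) else L k) ⊆ L k := by
      intro k
      split_ifs
      · exact Set.empty_subset _
      · exact subset_rfl
    constructor
    · exact isInducedPath_singleton q
    · intro x hx
      rw [List.mem_singleton.1 hx]
      exact h.path_sub q hq
    · exact fun k hk => (hsub k).trans (h.leg_sub k (hK'S hk))
    · intro k hk
      by_cases hqB : q ∈ contact G (B k)
      · exact Or.inl ⟨by simp [hqB], q, by simp, hqB⟩
      · right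
        simp only [hqB, if_false]
        obtain ⟨y, hy, e⟩ := (Finset.mem_filter.1 (hK' hk)).2
        rcases hy with hy | hy
        · exact absurd ⟨y, hy, e⟩ hqB
        · rcases h.leg k (hK'S hk) with ⟨h1, -⟩ | ⟨h1, -, h3⟩
          · rw [h1] at hy; exact hy.elim
          · exact ⟨h1, ⟨q, by simp, y, hy, e⟩, h3⟩
    · intro k hk x hx hxL
      rw [List.mem_singleton.1 hx] at hxL
      exact h.path_notMem k (hK'S hk) q hq (hsub k hxL)
    · exact fun k hk l hl hkl => (h.leg_leg k (hK'S hk) l (hK'S hl) hkl).mono (hsub k) (hsub l)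
    · exact fun k hk l hl hkl x hx => h.leg_private k (hK'S hk) l (hK'S hl) hkl x (hsub k hx)
  exfalso
  push Not at hrich
  have hZZ : ∀ k ∈ S, ∀ l ∈ S, k ≠ l → Anticomplete G (Z k) (Z l) := by
    have hBL : ∀ k ∈ S, ∀ l ∈ S, k ≠ l → Anticomplete G (B k) (L l) := by
      intro k hk l hl hkl x hx y hy
      refine ⟨by rintro rfl; exact hBH k (hS hk) _ hx (h.leg_sub l hl hy), fun e => ?_⟩
      exact h.leg_private l hl k hk hkl.symm y hy ⟨x, hx, e.symm⟩
    intro k hk l hl hkl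
    exact ((hBB k (hS hk) l (hS hl) hkl).union_right (hBL k hk l hl hkl)).union_left
      ((hBL l hl k hk hkl.symm).symm.union_right (h.leg_leg k hk l hl hkl))
  have hZQ : ∀ k ∈ S, ∀ x ∈ Z k, x ∉ Q := by
    rintro k hk x (hx | hx) hxQ
    · exact hBH k (hS hk) x hx (h.path_sub x hxQ)
    · exact h.path_notMem k hk x hxQ hx
  have hZconn : ∀ k ∈ S, Conn G (Z k) := by
    intro k hk
    rcases h.leg k hk with ⟨h1, -⟩ | ⟨h1, h2, x, hx, y, hy, e⟩
    · simp only [Z]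
      rw [h1, Set.union_empty]; exact hB k (hS hk)
    · exact (hB k (hS hk)).union h1 ⟨y, hy, x, hx, e.symm⟩
  let U : κ → Set V := fun k => {x | x ∈ Z k ∧ x ∈ contact G {q | q ∈ Q}}
  have hUne : ∀ k ∈ S, (U k).Nonempty := by
    intro k hk
    rcases h.leg k hk with ⟨h1, q, hq, y, hy, e⟩ | ⟨h1, ⟨q, hq, x, hx, e⟩, h3⟩
    · exact ⟨y, Or.inl hy, q, hq, e.symm⟩
    · exact ⟨x, Or.inr hx, q, hq, e.symm⟩
  obtain ⟨K₁, hK₁, hK₁n, b, g, α, ord, hlink⟩ := hFl S Z U H' hCc hC hfree (by omega) hH' hHne'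
    hZconn hZZ (by
      rintro k hk x (hx | hx) hxH
      · exact hBH' k (hS hk) x hx hxH
      · exact (hHH x (h.leg_sub k hk hx) x hxH).1 rfl)
    (fun k hk => (hBt' k (hS hk)).mono subset_rfl Set.subset_union_left)
    (fun k _ x hx => hx.1) hUne
  have hbZ : ∀ k ∈ K₁, b k ∈ Z k := fun k hk => (hlink.start k hk).1
  have hbb : ∀ k ∈ K₁, ∀ l ∈ K₁, k ≠ l → b k ≠ b l ∧ ¬ G.Adj (b k) (b l) := fun k hk l hl hkl =>
    hZZ k (hK₁ hk) l (hK₁ hl) hkl _ (hbZ k hk) _ (hbZ l hl)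
  have hpos : ∀ k ∈ K₁, ∃ x ∈ positions G Q (b k), 0 ≤ x ∧ x ≤ Q.length := by
    intro k hk
    obtain ⟨q, hq, e⟩ := (hlink.start k hk).2
    obtain ⟨i, hi⟩ := List.mem_iff_getElem?.1 hq
    have hi' : i ∈ positions G Q (b k) := ⟨q, hi, e⟩
    exact ⟨i, hi', Nat.zero_le _, (lt_length_of_mem_positions hi').le⟩
  rcases hFp K₁ (fun k => positions G Q (b k)) 0 Q.length (by omega) hpos with
    ⟨x, -, -, K', hK', hn, hx⟩ | ⟨K₂, hK₂, hn₂, a, a', -, -, h1, h2⟩ |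
    ⟨K₂, hK₂, hn₂, lo, hi, h1, h2⟩
  · rcases K'.eq_empty_or_nonempty with rfl | ⟨k, hk⟩
    · obtain ⟨k, hk⟩ : S.Nonempty := Finset.card_pos.1 (by omega)
      obtain ⟨u, hu⟩ := hUne k hk
      obtain ⟨q, hq, -⟩ := hu.2
      have := hrich q hq
      simp at hn
      omega
    · obtain ⟨q, hq, -⟩ := hx k hk
      have hqQ := List.mem_of_getElem? hq
      have hsub : K' ⊆ S.filter fun k => q ∈ contact G (Z k) := by
        intro l hl
        obtain ⟨q', hq', e⟩ := hx l hl
        rw [hq, Option.some.injEq] at hq'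
        subst hq'
        exact Finset.mem_filter.2 ⟨hK₁ (hK' hl), b l, hbZ l (hK' hl), e.symm⟩
      have := Finset.card_le_card hsub
      have := hrich q hqQ
      omega
  · -- Disjoint stretches: the lengths of the cycles through two of the sets cannot all agree.
    obtain ⟨f, e, hfe⟩ := exists_extremes K₂ (fun k => positions G Q (b k)) a a' h1
    have hcomp : ∀ k ∈ K₂, ∀ l ∈ K₂, k ≠ l → e k < f l ∨ e l < f k := by
      intro k hk l hl hkl
      obtain ⟨h3, h4, h5, h6, h7, -⟩ := hfe k hk
      obtain ⟨h3', h4', h5', h6', h7', -⟩ := hfe l hl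
      rcases h2 k hk l hl hkl with h | h
      · exact Or.inl (h _ h4 _ h3' (by omega) (by omega) (by omega) (by omega))
      · exact Or.inr (h _ h3 _ h4' (by omega) (by omega) (by omega) (by omega))
    let Φ : κ → κ → ℕ := fun k l =>
      g k + g l + α k l + if e k < f l then f l + 1 - e k else f k + 1 - e l
    have hΦ : ∀ k ∈ K₂, ∀ l ∈ K₂, k ≠ l → Φ k l ∈ C := by
      intro k hk l hl hkl
      obtain ⟨M, hM, hMh, hMl, hMin, hMk, hMl', hMlen⟩ :=
        hlink.link k (hK₂ hk) l (hK₂ hl) hkl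
      have hkS := hK₁ (hK₂ hk)
      have hlS := hK₁ (hK₂ hl)
      have hMQ : ∀ x ∈ M, x ∉ Q := by
        intro x hx hxQ
        rcases hMin x hx with h3 | h3 | h3
        · exact (hHH x (h.path_sub x hxQ) x h3).1 rfl
        · exact hZQ k hkS x h3 hxQ
        · exact hZQ l hlS x h3 hxQ
      have hadj : ∀ x ∈ M, ∀ y ∈ Q, G.Adj x y → x = b k ∨ x = b l := by
        intro x hx y hy hxy
        rcases hMin x hx with h3 | h3 | h3
        · exact absurd hxy.symm (hHH y (h.path_sub y hy) x h3).2
        · exact Or.inl (hMk x hx ⟨h3, y, hy, hxy⟩)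
        · exact Or.inr (hMl' x hx ⟨h3, y, hy, hxy⟩)
      obtain ⟨h3, h4, h5, h6, h7, h8⟩ := hfe k hk
      obtain ⟨h3', h4', h5', h6', h7', h8'⟩ := hfe l hl
      have hne := (hbb k (hK₂ hk) l (hK₂ hl) hkl).1
      by_cases hord : e k < f l
      · obtain ⟨l', hl', hlen'⟩ := exists_cycle_of_segment h.path hM hMh hMl hne hMQ hadj hord.le
          h4 h3' (fun i hi h9 h10 => by
            have := (h8 i hi (by omega) (by omega)).2
            omega) (fun i hi h9 h10 => by
            have := (h8' i hi (by omega) (by omega)).1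
            omega)
        have := hC l' hl'
        rw [hlen', hMlen] at this
        simpa [Φ, hord] using this
      · have hord' := (hcomp k hk l hl hkl).resolve_left hord
        obtain ⟨l', hl', hlen'⟩ := exists_cycle_of_segment h.path hM.reverse
          (by rw [List.head?_reverse, hMl]) (by rw [List.getLast?_reverse, hMh]) hne.symm
          (fun x hx => hMQ x (List.mem_reverse.1 hx))
          (fun x hx y hy hxy => (hadj x (List.mem_reverse.1 hx) y hy hxy).symm) hord'.le
          h4' h3 (fun i hi h9 h10 => by
            have := (h8' i hi (by omega) (by omega)).2
            omega) (fun i hi h9 h10 => by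
            have := (h8 i hi (by omega) (by omega)).1
            omega)
        have := hC l' hl'
        rw [hlen', List.length_reverse, hMlen] at this
        simpa [Φ, hord] using this
    obtain ⟨l, hnd, hlen, hlK, j, hj⟩ := hR K₂ (fun k l => (Φ k l, e k < f l, ord k l))
      (C ×ˢ ({True, False} ×ˢ {True, False})) (by
        rw [Finset.card_product, Finset.card_product]
        refine Nat.mul_le_mul hCc ?_
        exact Nat.mul_le_mul (Finset.card_le_two) (Finset.card_le_two))
      (fun k hk l hl hkl => by
        simp only [Finset.mem_product, Finset.mem_insert, Finset.mem_singleton]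
        refine ⟨hΦ k hk l hl hkl, ?_, ?_⟩
        · by_cases h : e k < f l <;> simp [h]
        · by_cases h : ord k l <;> simp [h]) (by omega)
    obtain ⟨k₁, k₂, k₃, k₄, rfl⟩ : ∃ k₁ k₂ k₃ k₄, l = [k₁, k₂, k₃, k₄] := by
      rcases l with _ | ⟨k₁, _ | ⟨k₂, _ | ⟨k₃, _ | ⟨k₄, _ | ⟨k₅, l⟩⟩⟩⟩⟩ <;>
        simp at hlen ⊢
    obtain ⟨j₁, j₂, j₃⟩ := j
    have hk₁ := hlK k₁ (by simp)
    have hk₂ := hlK k₂ (by simp)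
    have hk₃ := hlK k₃ (by simp)
    have hk₄ := hlK k₄ (by simp)
    have hquad := hlink.quad k₁ (hK₂ hk₁) k₂ (hK₂ hk₂) k₃ (hK₂ hk₃) k₄ (hK₂ hk₄) hnd (by
      by_cases h3 : j₃
      · refine Or.inl (hj.imp fun {x y} hxy => ?_)
        simp only [Prod.mk.injEq] at hxy
        exact hxy.2.2 ▸ h3
      · refine Or.inr (hj.imp fun {x y} hxy => ?_)
        simp only [Prod.mk.injEq] at hxy
        exact hxy.2.2 ▸ h3)
    have h₁ := hfe k₁ hk₁
    have h₂ := hfe k₂ hk₂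
    have h₃ := hfe k₃ hk₃
    have h₄ := hfe k₄ hk₄
    simp only [List.nodup_cons, List.mem_cons, List.not_mem_nil, or_false, not_or] at hnd
    have c₁₂ := hcomp k₁ hk₁ k₂ hk₂ hnd.1.1
    have c₁₃ := hcomp k₁ hk₁ k₃ hk₃ hnd.1.2.1
    have c₂₃ := hcomp k₂ hk₂ k₃ hk₃ hnd.2.1.1
    have c₂₄ := hcomp k₂ hk₂ k₄ hk₄ hnd.2.1.2
    have c₃₄ := hcomp k₃ hk₃ k₄ hk₄ hnd.2.2.1
    simp only [List.pairwise_cons, List.mem_cons, List.not_mem_nil, or_false,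
      forall_eq_or_imp, forall_eq, Prod.mk.injEq, Φ] at hj
    obtain ⟨⟨⟨o₁₂, p₁₂, -⟩, ⟨o₁₃, p₁₃, -⟩, -⟩, ⟨⟨o₂₃, p₂₃, -⟩, o₂₄, p₂₄, -⟩, ⟨o₃₄, p₃₄, -⟩, -⟩ := hj
    by_cases h2 : j₂
    · simp only [h2, eq_iff_iff, iff_true] at p₁₂ p₁₃ p₂₃ p₂₄ p₃₄
      rw [if_pos p₁₂] at o₁₂
      rw [if_pos p₁₃] at o₁₃
      rw [if_pos p₂₄] at o₂₄
      rw [if_pos p₃₄] at o₃₄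
      omega
    · simp only [h2, eq_iff_iff, iff_false] at p₁₂ p₁₃ p₂₃ p₂₄ p₃₄
      rw [if_neg p₁₂] at o₁₂
      rw [if_neg p₁₃] at o₁₃
      rw [if_neg p₂₄] at o₂₄
      rw [if_neg p₃₄] at o₃₄
      omega
  · exact hconst K₂ b Q lo hi hCc hC hfree (by omega)
      (fun k hk l hl => hbb k (hK₂ hk) l (hK₂ hl)) h.path
      (fun k hk => hZQ k (hK₁ (hK₂ hk)) _ (hbZ k (hK₂ hk)))
      (fun i hi k hk => (h1 i hi).2.2 k hk) h2

end

/-! ### Cyclic chains of segments -/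

/-- For every column `k` and all rows `i ≠ j` the induced path `seg k i j` leads from row `i` to
row `j`. Two segments of different columns with different first rows and different last rows are
joined by an edge from the last vertex of one to the first vertex of the other if the last row of
the former is the first row of the latter, and by no other edge. -/
structure Segments {V : Type u} {κ : Type v} (G : SimpleGraph V) (I : Finset ℕ) (K : Finset κ)
    (seg : κ → ℕ → ℕ → List V) : Prop where
  path : ∀ k ∈ K, ∀ i ∈ I, ∀ j ∈ I, i ≠ j → IsInducedPath G (seg k i j)
  two_le : ∀ k ∈ K, ∀ i ∈ I, ∀ j ∈ I, i ≠ j → 2 ≤ (seg k i j).length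
  symm : ∀ k ∈ K, ∀ i ∈ I, ∀ j ∈ I, i ≠ j → (seg k i j).length = (seg k j i).length
  cross : ∀ k ∈ K, ∀ l ∈ K, k ≠ l → ∀ i ∈ I, ∀ j ∈ I, ∀ i' ∈ I, ∀ j' ∈ I,
    i ≠ j → i' ≠ j' → i ≠ i' → j ≠ j' → ∀ x ∈ seg k i j, ∀ y ∈ seg l i' j',
      x ≠ y ∧ (G.Adj x y ↔
        (j = i' ∧ (seg k i j).getLast? = some x ∧ (seg l i' j').head? = some y) ∨
        (i = j' ∧ (seg k i j).head? = some x ∧ (seg l i' j').getLast? = some y))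

section
variable {V : Type u} {G : SimpleGraph V} {κ : Type v} {I : Finset ℕ} {K : Finset κ}
  {seg : κ → ℕ → ℕ → List V}

theorem Segments.mono {I' : Finset ℕ} {K' : Finset κ} (h : Segments G I K seg) (hI : I' ⊆ I)
    (hK : K' ⊆ K) : Segments G I' K' seg where
  path k hk i hi j hj := h.path k (hK hk) i (hI hi) j (hI hj)
  two_le k hk i hi j hj := h.two_le k (hK hk) i (hI hi) j (hI hj)
  symm k hk i hi j hj := h.symm k (hK hk) i (hI hi) j (hI hj)
  cross k hk l hl hkl i hi j hj i' hi' j' hj' :=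
    h.cross k (hK hk) l (hK hl) hkl i (hI hi) j (hI hj) i' (hI hi') j' (hI hj')

/-- The chain of the first `m` segments along a sequence `r` of rows and a sequence `q` of
columns. -/
def chain (seg : κ → ℕ → ℕ → List V) (r : ℕ → ℕ) (q : ℕ → κ) : ℕ → List V
  | 0 => []
  | m + 1 => chain seg r q m ++ seg (q m) (r m) (r (m + 1))

theorem mem_chain {r : ℕ → ℕ} {q : ℕ → κ} {m : ℕ} {x : V} :
    x ∈ chain seg r q m ↔ ∃ s < m, x ∈ seg (q s) (r s) (r (s + 1)) := by
  induction m with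
  | zero => simp [chain]
  | succ m ih =>
    rw [chain, List.mem_append, ih]
    constructor
    · rintro (⟨s, hs, h⟩ | h)
      · exact ⟨s, by omega, h⟩
      · exact ⟨m, by omega, h⟩
    · rintro ⟨s, hs, h⟩
      rcases Nat.lt_succ_iff_lt_or_eq.1 hs with hs | rfl
      · exact Or.inl ⟨s, hs, h⟩
      · exact Or.inr h

theorem length_chain {r : ℕ → ℕ} {q : ℕ → κ} {m d : ℕ}
    (hd : ∀ s < m, (seg (q s) (r s) (r (s + 1))).length = d) :
    (chain seg r q m).length = m * d := by
  induction m with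
  | zero => simp [chain]
  | succ m ih =>
    rw [chain, List.length_append, ih fun s hs => hd s (by omega), hd m (by omega)]
    ring

variable {r : ℕ → ℕ} {q : ℕ → κ} {N : ℕ}

theorem getLast?_chain {m : ℕ} (hne : seg (q m) (r m) (r (m + 1)) ≠ []) :
    (chain seg r q (m + 1)).getLast? = (seg (q m) (r m) (r (m + 1))).getLast? := by
  rw [chain, List.getLast?_append_of_ne_nil _ hne]

theorem head?_chain {m : ℕ} (hne : seg (q 0) (r 0) (r 1) ≠ []) :
    (chain seg r q (m + 1)).head? = (seg (q 0) (r 0) (r 1)).head? := by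
  induction m with
  | zero => simp [chain]
  | succ m ih =>
    rw [chain, List.head?_append, ih]
    obtain ⟨a, l, h⟩ := List.exists_cons_of_ne_nil hne
    rw [h]
    rfl

/-- Segments along distinct rows and columns, closed by a segment that returns to the first row,
form an induced cycle. -/
theorem Segments.exists_cycle (h : Segments G I K seg) (hr : ∀ s ≤ N, r s ∈ I)
    (hq : ∀ s ≤ N, q s ∈ K) (hri : ∀ s ≤ N, ∀ s' ≤ N, r s = r s' → s = s')
    (hqi : ∀ s ≤ N, ∀ s' ≤ N, q s = q s' → s = s') (hN : 1 ≤ N) {d : ℕ}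
    (hd : ∀ k ∈ K, ∀ s ≤ N, ∀ s' ≤ N, s ≠ s' → (seg k (r s) (r s')).length = d) :
    ∃ l, IsInducedCycle G l ∧ l.length = (N + 1) * d := by
  have hne : ∀ m < N, seg (q m) (r m) (r (m + 1)) ≠ [] := by
    intro m hm e
    have := h.two_le (q m) (hq m hm.le) (r m) (hr m hm.le) (r (m + 1)) (hr _ hm) (fun e => by
      have := hri _ hm.le _ hm e
      omega)
    rw [e] at this
    simp at this
  have hcross : ∀ s < N, ∀ m ≤ N, s < m → ∀ b ≤ N, m ≠ b → s + 1 ≠ b →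
      ∀ x ∈ seg (q s) (r s) (r (s + 1)), ∀ y ∈ seg (q m) (r m) (r b), x ≠ y ∧ (G.Adj x y ↔
        (s + 1 = m ∧ (seg (q s) (r s) (r (s + 1))).getLast? = some x ∧
          (seg (q m) (r m) (r b)).head? = some y) ∨
        (s = b ∧ (seg (q s) (r s) (r (s + 1))).head? = some x ∧
          (seg (q m) (r m) (r b)).getLast? = some y)) := by
    intro s hs m hm hsm b hb hmb hsb x hx y hy
    have := h.cross (q s) (hq s hs.le) (q m) (hq m hm) (fun e => hsm.ne (hqi _ hs.le _ hm e))
      (r s) (hr s hs.le) (r (s + 1)) (hr _ hs) (r m) (hr m hm) (r b) (hr b hb)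
      (fun e => by have := hri _ hs.le _ hs e; omega) (fun e => hmb (hri _ hm _ hb e))
      (fun e => hsm.ne (hri _ hs.le _ hm e)) (fun e => hsb (hri _ hs _ hb e)) x hx y hy
    have h1 : r (s + 1) = r m ↔ s + 1 = m := ⟨fun e => hri _ hs _ hm e, fun e => by rw [e]⟩
    have h2 : r s = r b ↔ s = b := ⟨fun e => hri _ hs.le _ hb e, fun e => by rw [e]⟩
    rwa [h1, h2] at this
  have hpath : ∀ m ≤ N, IsInducedPath G (chain seg r q m) := by
    intro m hm
    induction m with
    | zero => trivial
    | succ m ih =>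
      refine (ih (by omega)).append (h.path (q m) (hq m (by omega)) (r m) (hr m (by omega)) _
        (hr _ hm) fun e => by have := hri _ (by omega) _ hm e; omega) ?_
      intro x hx y hy
      obtain ⟨s, hs, hxs⟩ := mem_chain.1 hx
      obtain ⟨h1, h2⟩ := hcross s (by omega) m (by omega) hs (m + 1) hm (by omega) (by omega) x hxs
        y hy
      refine ⟨h1, h2.trans ⟨?_, fun ⟨h3, h4⟩ => ?_⟩⟩
      · rintro (⟨rfl, h3, h4⟩ | ⟨h3, -⟩)
        · exact ⟨by rw [getLast?_chain (hne s (by omega)), h3], h4⟩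
        · omega
      · obtain ⟨m, rfl⟩ : ∃ m', m = m' + 1 := ⟨m - 1, by omega⟩
        rw [getLast?_chain (hne m (by omega))] at h3
        rcases Nat.lt_succ_iff_lt_or_eq.1 hs with hs' | rfl
        · exact absurd rfl (hcross s (by omega) m (by omega) hs' (m + 1) (by omega) (by omega)
            (by omega) x hxs x (getLast?_mem h3)).1
        · exact Or.inl ⟨rfl, h3, h4⟩
  have hrN : r N ≠ r 0 := fun e => by
    have := hri N le_rfl 0 (Nat.zero_le _) e
    omega
  have hlen : (chain seg r q N).length = N * d := length_chain fun s hs =>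
    hd _ (hq s hs.le) s hs.le (s + 1) hs (by omega)
  have hcl := h.two_le (q N) (hq N le_rfl) (r N) (hr N le_rfl) (r 0) (hr 0 (Nat.zero_le _)) hrN
  have hdN := hd (q N) (hq N le_rfl) N le_rfl 0 (Nat.zero_le _) (by omega)
  obtain ⟨M, rfl⟩ : ∃ M, N = M + 1 := ⟨N - 1, by omega⟩
  obtain ⟨l, hl, hl'⟩ := (hpath (M + 1) le_rfl).exists_cycle
    (h.path (q (M + 1)) (hq _ le_rfl) (r (M + 1)) (hr _ le_rfl) (r 0) (hr 0 (Nat.zero_le _)) hrN)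
    (by rw [hlen]; nlinarith) (fun e => by rw [e] at hcl; simp at hcl) (by
      intro x hx y hy
      obtain ⟨s, hs, hxs⟩ := mem_chain.1 hx
      obtain ⟨h1, h2⟩ := hcross s hs (M + 1) le_rfl hs 0 (Nat.zero_le _) (by omega) (by omega) x
        hxs y hy
      rw [getLast?_chain (hne M (by omega)), head?_chain (hne 0 (by omega))]
      refine ⟨h1, h2.trans ⟨?_, ?_⟩⟩
      · rintro (⟨h3, h4⟩ | ⟨rfl, h4⟩)
        · obtain rfl : s = M := by omega
          exact Or.inl h4
        · exact Or.inr h4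
      · rintro (⟨h3, h4⟩ | ⟨h3, h4⟩)
        · rcases Nat.lt_succ_iff_lt_or_eq.1 hs with hs' | rfl
          · exact absurd rfl (hcross s hs M (by omega) hs' (M + 1) le_rfl (by omega)
              (by omega) x hxs x (getLast?_mem h3)).1
          · exact Or.inl ⟨rfl, h3, h4⟩
        · rcases Nat.eq_zero_or_pos s with rfl | hs'
          · exact Or.inr ⟨rfl, h3, h4⟩
          · exact absurd rfl (hcross 0 (by omega) s (by omega) hs' (s + 1) hs (by omega)
              (by omega) x (head?_mem h3) x hxs).1)
  refine ⟨l, hl, ?_⟩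
  rw [hl', hlen, hdN]
  ring

/-- The lengths of segments take few values, because two segments of different columns between the
same rows close up to an induced cycle. -/
theorem Segments.length_mem (h : Segments G I K seg) {C : Finset ℕ}
    (hC : ∀ l, IsInducedCycle G l → l.length ∈ C) (hK : 3 ≤ K.card) {k : κ} (hk : k ∈ K) {i j : ℕ}
    (hi : i ∈ I) (hj : j ∈ I) (hij : i ≠ j) : (seg k i j).length ∈ halfDiffs C := by
  classical
  have hsum : ∀ k ∈ K, ∀ l ∈ K, k ≠ l → (seg k i j).length + (seg l i j).length ∈ C := by
    intro k hk l hl hkl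
    have hlen := h.two_le l hl j hj i hi hij.symm
    obtain ⟨w, hw, hw'⟩ := (h.path k hk i hi j hj hij).exists_cycle
      (h.path l hl j hj i hi hij.symm) (h.two_le k hk i hi j hj hij)
      (fun e => by rw [e] at hlen; simp at hlen) (fun x hx y hy => by
        simpa using h.cross k hk l hl hkl i hi j hj j hj i hi hij hij.symm hij hij.symm x hx y hy)
    rw [h.symm l hl i hi j hj hij, ← hw']
    exact hC w hw
  have h1 := Finset.card_erase_of_mem hk
  obtain ⟨a, b, ha, hb, hab⟩ := Finset.one_lt_card_iff.1 (show 1 < (K.erase k).card by omega)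
  obtain ⟨hak, ha⟩ := Finset.mem_erase.1 ha
  obtain ⟨hbk, hb⟩ := Finset.mem_erase.1 hb
  exact mem_halfDiffs (hsum k hk a ha hak.symm) (hsum k hk b hb hbk.symm) (hsum a ha b hb hab)

/-- Many rows and columns of segments give many lengths of induced cycles: by Ramsey's theorem
all segments of some of the rows and columns have the same length `d`, and then there are induced
cycles of lengths `2 * d`, `3 * d`, and so on. -/
theorem exists_segments_bound (c : ℕ) : ∃ n N : ℕ, ∀ {V : Type u} {G : SimpleGraph V}
    {C : Finset ℕ} {κ : Type v} (I : Finset ℕ) (K : Finset κ) (seg : κ → ℕ → ℕ → List V),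
    C.card < c → (∀ l, IsInducedCycle G l → l.length ∈ C) → n ≤ I.card → N ≤ K.card →
    Segments G I K seg → False := by
  classical
  obtain ⟨n, hn⟩ := exists_homogeneous_list.{0, v} (c + 1) ((c ^ 3) ^ (c ^ 3 * (c + 1) + 3))
  refine ⟨n, c ^ 3 * (c + 1) + 3, ?_⟩
  intro V G C κ I K₀ seg hCc hC hI hK₀ hseg₀
  obtain ⟨K, hK, hKcard⟩ := Finset.exists_subset_card_eq hK₀
  have hseg := hseg₀.mono subset_rfl hK
  have hE : (halfDiffs C).card ≤ c ^ 3 :=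
    (card_halfDiffs_le C).trans (Nat.pow_le_pow_left hCc.le 3)
  obtain ⟨rows, hnd, hlen, hrI, g, hg⟩ := hn I
    (fun i j (k : κ) (_ : k ∈ K) => (seg k i j).length) (K.pi fun _ => halfDiffs C)
    (by
      rw [Finset.card_pi, Finset.prod_const, hKcard]
      exact Nat.pow_le_pow_left hE _)
    (fun i hi j hj hij => Finset.mem_pi.2 fun k hk =>
      hseg.length_mem hC (by omega) hk hi hj hij) hI
  let r : ℕ → ℕ := fun s => rows.getD s 0
  have hr : ∀ s ≤ c, ∃ hs : s < rows.length, r s = rows[s] := fun s hs =>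
    ⟨by omega, List.getD_eq_getElem _ _ (by omega)⟩
  have hrmem : ∀ s ≤ c, r s ∈ I := by
    intro s hs
    obtain ⟨h1, h2⟩ := hr s hs
    rw [h2]
    exact hrI _ (List.getElem_mem _)
  have hrinj : ∀ s ≤ c, ∀ s' ≤ c, r s = r s' → s = s' := by
    intro s hs s' hs' e
    obtain ⟨h1, h2⟩ := hr s hs
    obtain ⟨h1', h2'⟩ := hr s' hs'
    rw [h2, h2'] at e
    exact (List.Nodup.getElem_inj_iff hnd).1 e
  have hlt : ∀ k (hk : k ∈ K), ∀ s s', s < s' → s' ≤ c →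
      (seg k (r s) (r s')).length = g k hk := by
    intro k hk s s' hss hs'
    obtain ⟨h1, h2⟩ := hr s (by omega)
    obtain ⟨h1', h2'⟩ := hr s' hs'
    rw [h2, h2']
    exact congrFun (congrFun (List.pairwise_iff_getElem.1 hg s s' h1 h1' hss) k) hk
  have hgE : ∀ k (hk : k ∈ K), g k hk ∈ halfDiffs C := by
    intro k hk
    have hc : 1 ≤ c := by omega
    rw [← hlt k hk 0 1 one_pos hc]
    exact hseg.length_mem hC (by omega) hk (hrmem 0 (by omega)) (hrmem 1 hc) fun e => by
      have := hrinj 0 (by omega) 1 hc e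
      omega
  obtain ⟨d, -, K', hK', hK'card, hd⟩ := exists_common_value (E := halfDiffs C)
    (R := fun k d => ∃ hk : k ∈ K, g k hk = d) (c := c ^ 3) (n := c + 1) hE
    (fun k hk => ⟨g k hk, hgE k hk, hk, rfl⟩) (by omega)
  have hd' : ∀ k ∈ K', ∀ s ≤ c, ∀ s' ≤ c, s ≠ s' → (seg k (r s) (r s')).length = d := by
    intro k hk s hs s' hs' hss
    obtain ⟨hkK, rfl⟩ := hd k hk
    rcases lt_or_gt_of_ne hss with h | h
    · exact hlt k hkK s s' h hs'
    · rw [hseg.symm k hkK _ (hrmem s hs) _ (hrmem s' hs') fun e => hss (hrinj s hs s' hs' e)]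
      exact hlt k hkK s' s h hs
  let e := (K'.equivFinOfCardEq hK'card).symm
  let q : ℕ → κ := fun s => if h : s < c + 1 then e ⟨s, h⟩ else e 0
  have hq : ∀ s (h : s < c + 1), q s = e ⟨s, h⟩ := fun s h => dif_pos h
  have hqmem : ∀ s ≤ c, q s ∈ K' := fun s hs => by
    rw [hq s (by omega)]
    exact (e _).2
  have hqinj : ∀ s ≤ c, ∀ s' ≤ c, q s = q s' → s = s' := by
    intro s hs s' hs' h
    rw [hq s (by omega), hq s' (by omega)] at h
    simpa using e.injective (Subtype.ext h)
  have hcyc : ∀ m ∈ Finset.Icc 1 c, (m + 1) * d ∈ C := by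
    intro m hm
    obtain ⟨hm1, hmc⟩ := Finset.mem_Icc.1 hm
    obtain ⟨l, hl, hl'⟩ := (hseg.mono subset_rfl hK').exists_cycle (r := r) (q := q) (N := m)
      (fun s hs => hrmem s (by omega)) (fun s hs => hqmem s (by omega))
      (fun s hs s' hs' => hrinj s (by omega) s' (by omega))
      (fun s hs s' hs' => hqinj s (by omega) s' (by omega)) hm1
      (fun k hk s hs s' hs' => hd' k hk s (by omega) s' (by omega))
    rw [← hl']
    exact hC l hl
  have hdpos : 0 < d := by
    have hc : 1 ≤ c := by omega
    have h01 : r 0 ≠ r 1 := fun e => by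
      have := hrinj 0 (by omega) 1 hc e
      omega
    rw [← hd' (q 0) (hqmem 0 (by omega)) 0 (by omega) 1 hc (by omega)]
    have := hseg.two_le (q 0) (hK' (hqmem 0 (by omega))) _ (hrmem 0 (by omega)) _ (hrmem 1 hc) h01
    omega
  have := Finset.card_le_card_of_injOn (fun m => (m + 1) * d) hcyc (by
    intro a _ b _ e
    have := Nat.eq_of_mul_eq_mul_right hdpos e
    omega)
  rw [Nat.card_Icc] at this
  omega

end

/-! ### Hubs in all rows -/

/-- In every row `A i`, `i ∈ I`, there are ports `p i k` that see the columns `B k`, `k ∈ K`. The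
ports of a row are either one and the same vertex, or pairwise adjacent vertices each of which sees
only its own column. -/
structure Hubs {V : Type u} {κ : Type v} (G : SimpleGraph V) (I : Finset ℕ) (K : Finset κ)
    (A : ℕ → Set V) (B : κ → Set V) (p : ℕ → κ → V) : Prop where
  conn : ∀ k ∈ K, Conn G (B k)
  anti : ∀ k ∈ K, ∀ l ∈ K, k ≠ l → Anticomplete G (B k) (B l)
  port_mem : ∀ i ∈ I, ∀ k ∈ K, p i k ∈ A i
  port_notMem : ∀ i ∈ I, ∀ k ∈ K, ∀ l ∈ K, p i k ∉ B l
  port_contact : ∀ i ∈ I, ∀ k ∈ K, p i k ∈ contact G (B k)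
  vertex_or_clique : ∀ i ∈ I, (∀ k ∈ K, ∀ l ∈ K, p i k = p i l) ∨
    ∀ k ∈ K, ∀ l ∈ K, k ≠ l → G.Adj (p i k) (p i l) ∧ p i k ∉ contact G (B l)

section
variable {V : Type u} {G : SimpleGraph V} {κ : Type v} {I : Finset ℕ} {K : Finset κ}
  {A : ℕ → Set V} {B : κ → Set V} {p : ℕ → κ → V}

/-- Enlarging the columns inside a new row `j` keeps the hubs of the other rows, and new ports in
row `j` complete them. -/
theorem Hubs.insert {j : ℕ} (h : Hubs G (Finset.range j) K A B p) {K' : Finset κ} (hK : K' ⊆ K)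
    (hA : ∀ i < j, Anticomplete G (A i) (A j)) (hBA : ∀ k ∈ K, ∀ x ∈ B k, x ∉ A j)
    {L : κ → Set V} {p' : κ → V} (hL : ∀ k ∈ K', L k ⊆ A j)
    (hleg : ∀ k ∈ K', (L k = ∅ ∧ p' k ∈ contact G (B k)) ∨
      (Conn G (L k) ∧ Touches G {p' k} (L k) ∧ ∃ x ∈ L k, x ∈ contact G (B k)))
    (hp : ∀ k ∈ K', p' k ∈ A j) (hpL : ∀ k ∈ K', ∀ l ∈ K', p' k ∉ L l)
    (hLL : ∀ k ∈ K', ∀ l ∈ K', k ≠ l → Anticomplete G (L k) (L l))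
    (hLB : ∀ k ∈ K', ∀ l ∈ K', k ≠ l → ∀ x ∈ L k, x ∉ contact G (B l))
    (htype : (∀ k ∈ K', ∀ l ∈ K', p' k = p' l) ∨ ∀ k ∈ K', ∀ l ∈ K', k ≠ l →
      G.Adj (p' k) (p' l) ∧ p' k ∉ contact G (B l) ∧ p' k ∉ contact G (L l)) :
    Hubs G (Finset.range (j + 1)) K' A (fun k => B k ∪ L k)
      (fun i k => if i = j then p' k else p i k) := by
  have hBL : ∀ k ∈ K', ∀ l ∈ K', k ≠ l → Anticomplete G (B k) (L l) := by
    intro k hk l hl hkl x hx y hy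
    refine ⟨by rintro rfl; exact hBA k (hK hk) _ hx (hL l hl hy), fun e => ?_⟩
    exact hLB l hl k hk hkl.symm y hy ⟨x, hx, e.symm⟩
  have hlt : ∀ i ∈ Finset.range (j + 1), i ≠ j → i ∈ Finset.range j := by
    intro i hi hij
    have := Finset.mem_range.1 hi
    exact Finset.mem_range.2 (by omega)
  constructor
  · intro k hk
    rcases hleg k hk with ⟨h1, -⟩ | ⟨h1, -, x, hx, y, hy, e⟩
    · rw [h1, Set.union_empty]
      exact h.conn k (hK hk)
    · exact (h.conn k (hK hk)).union h1 ⟨y, hy, x, hx, e.symm⟩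
  · intro k hk l hl hkl
    exact ((h.anti k (hK hk) l (hK hl) hkl).union_right (hBL k hk l hl hkl)).union_left
      ((hBL l hl k hk hkl.symm).symm.union_right (hLL k hk l hl hkl))
  · intro i hi k hk
    by_cases hij : i = j
    · subst hij
      simpa using hp k hk
    · simpa [hij] using h.port_mem i (hlt i hi hij) k (hK hk)
  · intro i hi k hk l hl
    by_cases hij : i = j
    · subst hij
      simp only [if_true]
      rintro (h1 | h1)
      · exact hBA l (hK hl) _ h1 (hp k hk)
      · exact hpL k hk l hl h1
    · simp only [hij, if_false]
      have hi' := hlt i hi hij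
      rintro (h1 | h1)
      · exact h.port_notMem i hi' k (hK hk) l (hK hl) h1
      · exact (hA i (Finset.mem_range.1 hi') _ (h.port_mem i hi' k (hK hk)) _ (hL l hl h1)).1 rfl
  · intro i hi k hk
    by_cases hij : i = j
    · simp only [hij, if_true]
      rcases hleg k hk with ⟨-, y, hy, e⟩ | ⟨-, ⟨x, hx, y, hy, e⟩, -⟩
      · exact ⟨y, Or.inl hy, e⟩
      · rw [Set.mem_singleton_iff] at hx
        exact ⟨y, Or.inr hy, hx ▸ e⟩
    · simp only [hij, if_false]
      obtain ⟨y, hy, e⟩ := h.port_contact i (hlt i hi hij) k (hK hk)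
      exact ⟨y, Or.inl hy, e⟩
  · intro i hi
    by_cases hij : i = j
    · simp only [hij, if_true]
      refine htype.imp id fun h1 k hk l hl hkl => ?_
      obtain ⟨h2, h3, h4⟩ := h1 k hk l hl hkl
      refine ⟨h2, ?_⟩
      rintro ⟨y, hy | hy, e⟩
      · exact h3 ⟨y, hy, e⟩
      · exact h4 ⟨y, hy, e⟩
    · simp only [hij, if_false]
      have hi' := hlt i hi hij
      refine (h.vertex_or_clique i hi').imp (fun h1 k hk l hl => h1 k (hK hk) l (hK hl))
        fun h1 k hk l hl hkl => ?_
      obtain ⟨h2, h3⟩ := h1 k (hK hk) l (hK hl) hkl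
      refine ⟨h2, ?_⟩
      rintro ⟨y, hy | hy, e⟩
      · exact h3 ⟨y, hy, e⟩
      · exact (hA i (Finset.mem_range.1 hi') _ (h.port_mem i hi' k (hK hk)) y (hL l hl hy)).2 e

/-- Rows are turned into hubs one after the other, with a further row `H` as partner. The parts of a
row that lead from its ports to the columns are added to the columns. -/
theorem exists_hubs (c t : ℕ) (ht : 1 ≤ t) (j N : ℕ) : ∃ F : ℕ, ∀ {V : Type u} [Finite V]
    {G : SimpleGraph V} {C : Finset ℕ} {κ : Type v} (K : Finset κ) (A : ℕ → Set V) (B : κ → Set V)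
    (H : Set V), C.card ≤ c → (∀ l, IsInducedCycle G l → l.length ∈ C) → IndFree G (biclique t) →
    F ≤ K.card → (∀ i < j, Conn G (A i) ∧ (A i).Nonempty) → Conn G H → H.Nonempty →
    (∀ i < j, ∀ i' < j, i ≠ i' → Anticomplete G (A i) (A i')) →
    (∀ i < j, Anticomplete G (A i) H) →
    (∀ k ∈ K, Conn G (B k)) → (∀ k ∈ K, ∀ l ∈ K, k ≠ l → Anticomplete G (B k) (B l)) →
    (∀ k ∈ K, ∀ x ∈ B k, x ∉ H ∧ ∀ i < j, x ∉ A i) →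
    (∀ k ∈ K, Touches G H (B k) ∧ ∀ i < j, Touches G (A i) (B k)) →
    ∃ K' ⊆ K, K'.card = N ∧ ∃ B' p, (∀ k ∈ K', B k ⊆ B' k) ∧
      (∀ k ∈ K', ∀ x ∈ B' k, x ∈ B k ∨ ∃ i < j, x ∈ A i) ∧
      Hubs G (Finset.range j) K' A B' p := by
  classical
  induction j generalizing N with
  | zero =>
    refine ⟨N, ?_⟩
    intro V _ G C κ K A B H _ _ _ hK _ _ hH _ _ hB hBB _ _
    obtain ⟨K', hK', hn⟩ := Finset.exists_subset_card_eq hK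
    obtain ⟨x, -⟩ := hH
    refine ⟨K', hK', hn, B, fun _ _ => x, fun _ _ => subset_rfl, fun k _ y hy => Or.inl hy, ?_⟩
    constructor
    · exact fun k hk => hB k (hK' hk)
    · exact fun k hk l hl => hBB k (hK' hk) l (hK' hl)
    all_goals simp
  | succ j ih =>
    obtain ⟨F₁, hF₁⟩ := exists_hub.{u, v} c t ht N
    obtain ⟨F, hF⟩ := ih F₁
    refine ⟨F, ?_⟩
    intro V _ G C κ K A B H hCc hC hfree hK hA hH hHne hAA hAH hB hBB hBA hBt
    obtain ⟨K₁, hK₁, hcard, B₁, p, hsub, hin, hhub⟩ := hF K A B H hCc hC hfree hK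
      (fun i hi => hA i (by omega)) hH hHne
      (fun i hi i' hi' => hAA i (by omega) i' (by omega)) (fun i hi => hAH i (by omega)) hB hBB
      (fun k hk x hx => ⟨(hBA k hk x hx).1, fun i hi => (hBA k hk x hx).2 i (by omega)⟩)
      (fun k hk => ⟨(hBt k hk).1, fun i hi => (hBt k hk).2 i (by omega)⟩)
    have hAj : ∀ i < j, Anticomplete G (A i) (A j) := fun i hi =>
      hAA i (by omega) j (by omega) (by omega)
    have hBj : ∀ k ∈ K₁, ∀ x ∈ B₁ k, x ∉ A j := by
      intro k hk x hx hxj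
      rcases hin k hk x hx with h | ⟨i, hi, h⟩
      · exact (hBA k (hK₁ hk) x h).2 j (by omega) hxj
      · exact (hAj i hi x h x hxj).1 rfl
    have hBH : ∀ k ∈ K₁, ∀ x ∈ B₁ k, x ∉ H := by
      intro k hk x hx hxj
      rcases hin k hk x hx with h | ⟨i, hi, h⟩
      · exact (hBA k (hK₁ hk) x h).1 hxj
      · exact (hAH i (by omega) x h x hxj).1 rfl
    obtain ⟨K₂, hK₂, hcard₂, h⟩ := hF₁ K₁ B₁ (A j) H hCc hC hfree hcard.ge (hA j (by omega)).1
      (hA j (by omega)).2 hH hHne (hAH j (by omega)) hhub.conn hhub.anti hBj hBH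
      (fun k hk => ((hBt k (hK₁ hk)).2 j (by omega)).mono subset_rfl (hsub k hk))
      (fun k hk => (hBt k (hK₁ hk)).1.mono subset_rfl (hsub k hk))
    have key : ∃ (p' : κ → V) (L : κ → Set V), (∀ k ∈ K₂, L k ⊆ A j) ∧
        Hubs G (Finset.range (j + 1)) K₂ A (fun k => B₁ k ∪ L k)
          (fun i k => if i = j then p' k else p i k) := by
      rcases h with ⟨p', L, h⟩ | ⟨v, L, h⟩
      · refine ⟨p', L, h.leg_sub, hhub.insert hK₂ hAj hBj h.leg_sub h.leg h.port_mem ?_ h.leg_leg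
          h.leg_private (Or.inr fun k hk l hl hkl => ⟨h.adj k hk l hl hkl,
            h.port_private k hk l hl hkl, ?_⟩)⟩
        · intro k hk l hl hpl
          by_cases hkl : k = l
          · subst hkl
            exact h.port_notMem k hk hpl
          · exact (h.port_leg k hk l hl hkl _ rfl _ hpl).1 rfl
        · rintro ⟨y, hy, e⟩
          exact (h.port_leg k hk l hl hkl _ rfl y hy).2 e
      · refine ⟨fun _ => v, L, h.leg_sub, hhub.insert hK₂ hAj hBj h.leg_sub ?_
          (fun k _ => h.path_sub v (by simp)) (fun k _ l hl => h.path_notMem l hl v (by simp))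
          h.leg_leg h.leg_private (Or.inl fun _ _ _ _ => rfl)⟩
        intro k hk
        simpa using h.leg k hk
    obtain ⟨p', L, hL, hhub'⟩ := key
    refine ⟨K₂, hK₂.trans hK₁, hcard₂, _, _,
      fun k hk => (hsub k (hK₂ hk)).trans Set.subset_union_left, ?_, hhub'⟩
    rintro k hk x (hx | hx)
    · rcases hin k (hK₂ hk) x hx with h | ⟨i, hi, h⟩
      · exact Or.inl h
      · exact Or.inr ⟨i, by omega, h⟩
    · exact Or.inr ⟨j, by omega, hL k hk hx⟩

/-! ### Hubs of clique type -/

/-- Hubs that are cliques: the segments lead from port to port through a column. -/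
theorem Hubs.exists_segments (h : Hubs G I K A B p)
    (hA : ∀ i ∈ I, ∀ j ∈ I, i ≠ j → Anticomplete G (A i) (A j))
    (hclique : ∀ i ∈ I, ∀ k ∈ K, ∀ l ∈ K, k ≠ l →
      G.Adj (p i k) (p i l) ∧ p i k ∉ contact G (B l)) :
    ∃ seg, Segments G I K seg := by
  classical
  have hlink : ∀ k ∈ K, ∀ i ∈ I, ∀ j ∈ I, ∃ σ, IsLink G (p i k) (p j k) σ ∧ ∀ x ∈ σ, x ∈ B k :=
    fun k hk i hi j hj => (h.conn k hk).exists_isLink (h.port_notMem i hi k hk k hk)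
      (h.port_notMem j hj k hk k hk) (h.port_contact i hi k hk) (h.port_contact j hj k hk)
  choose! σ hσ hσB using hlink
  have hpp : ∀ i ∈ I, ∀ j ∈ I, i ≠ j → ∀ k ∈ K, ∀ l ∈ K,
      p i k ≠ p j l ∧ ¬ G.Adj (p i k) (p j l) := fun i hi j hj hij k hk l hl =>
    hA i hi j hj hij _ (h.port_mem i hi k hk) _ (h.port_mem j hj l hl)
  have hpB : ∀ i ∈ I, ∀ k ∈ K, ∀ l ∈ K, k ≠ l → ∀ x ∈ B l,
      p i k ≠ x ∧ ¬ G.Adj (p i k) x := fun i hi k hk l hl hkl x hx =>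
    ⟨by rintro rfl; exact h.port_notMem i hi k hk l hl hx,
      fun e => (hclique i hi k hk l hl hkl).2 ⟨x, hx, e⟩⟩
  have hpp' : ∀ i ∈ I, ∀ j ∈ I, ∀ k ∈ K, ∀ l ∈ K, k ≠ l →
      p i k ≠ p j l ∧ (G.Adj (p i k) (p j l) ↔ i = j) := by
    intro i hi j hj k hk l hl hkl
    by_cases hij : i = j
    · subst hij
      have := (hclique i hi k hk l hl hkl).1
      exact ⟨this.ne, iff_of_true this rfl⟩
    · exact ⟨(hpp i hi j hj hij k hk l hl).1, iff_of_false (hpp i hi j hj hij k hk l hl).2 hij⟩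
  -- The link is fixed for one order of the two rows, and reversed for the other one.
  let τ : κ → ℕ → ℕ → List V := fun k i j => if i < j then σ k i j else (σ k j i).reverse
  have hτ : ∀ k ∈ K, ∀ i ∈ I, ∀ j ∈ I, IsLink G (p i k) (p j k) (τ k i j) := by
    intro k hk i hi j hj
    by_cases hij : i < j
    · simpa [τ, hij] using hσ k hk i hi j hj
    · simpa [τ, hij] using (hσ k hk j hj i hi).reverse
  have hτB : ∀ k ∈ K, ∀ i ∈ I, ∀ j ∈ I, ∀ x ∈ τ k i j, x ∈ B k := by
    intro k hk i hi j hj x hx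
    by_cases hij : i < j
    · exact hσB k hk i hi j hj x (by simpa [τ, hij] using hx)
    · exact hσB k hk j hj i hi x (by simpa [τ, hij] using hx)
  have hmem : ∀ {x k i j}, x ∈ p i k :: τ k i j ++ [p j k] ↔
      x = p i k ∨ x ∈ τ k i j ∨ x = p j k := by
    intro x k i j
    simp
  refine ⟨fun k i j => p i k :: τ k i j ++ [p j k], ?_, ?_, ?_, ?_⟩
  · intro k hk i hi j hj hij
    obtain ⟨h1, h2⟩ := hpp i hi j hj hij k hk k hk
    exact (hτ k hk i hi j hj).isInducedPath h1 h2
  · intro k hk i hi j hj hij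
    simp
  · intro k hk i hi j hj hij
    rcases lt_or_gt_of_ne hij with h1 | h1 <;> simp [τ, h1, h1.not_gt]
  · intro k hk l hl hkl i hi j hj i' hi' j' hj' hij hij' hii hjj x hx y hy
    have hhead : ∀ k i j, (p i k :: τ k i j ++ [p j k]).head? = some (p i k) := fun _ _ _ => rfl
    have hlast : ∀ k i j, (p i k :: τ k i j ++ [p j k]).getLast? = some (p j k) :=
      fun _ _ _ => List.getLast?_concat
    rw [hhead, hhead, hlast, hlast]
    simp only [Option.some.injEq]
    rw [hmem] at hx hy
    have hpne : ∀ a ∈ I, ∀ b ∈ I, ∀ m ∈ K, p a m = p b m → a = b := by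
      intro a ha b hb m hm e
      by_contra hab
      exact (hpp a ha b hb hab m hm m hm).1 e
    have hport : ∀ a ∈ I, ∀ b ∈ I, (a = i ∨ a = j) → (b = i' ∨ b = j') → x = p a k → y = p b l →
        x ≠ y ∧ (G.Adj x y ↔ (j = i' ∧ p j k = x ∧ p i' l = y) ∨
          (i = j' ∧ p i k = x ∧ p j' l = y)) := by
      rintro a ha b hb ha' hb' rfl rfl
      obtain ⟨h1, h2⟩ := hpp' a ha b hb k hk l hl hkl
      refine ⟨h1, h2.trans ⟨?_, ?_⟩⟩
      · rintro rfl
        rcases ha' with rfl | rfl <;> rcases hb' with rfl | rfl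
        · exact absurd rfl hii
        · exact Or.inr ⟨rfl, rfl, rfl⟩
        · exact Or.inl ⟨rfl, rfl, rfl⟩
        · exact absurd rfl hjj
      · rintro (⟨h3, h4, h5⟩ | ⟨h3, h4, h5⟩)
        · rw [← hpne _ hj _ ha k hk h4, ← hpne _ hi' _ hb l hl h5, h3]
        · rw [← hpne _ hi _ ha k hk h4, ← hpne _ hj' _ hb l hl h5, h3]
    have hxB : x ∈ τ k i j → ∀ a ∈ I, p a k ≠ x := by
      rintro h1 a ha rfl
      exact h.port_notMem a ha k hk k hk (hτB k hk i hi j hj _ h1)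
    have hyB : y ∈ τ l i' j' → ∀ a ∈ I, p a l ≠ y := by
      rintro h1 a ha rfl
      exact h.port_notMem a ha l hl l hl (hτB l hl i' hi' j' hj' _ h1)
    have hfin : (x ≠ y ∧ ¬ G.Adj x y) → (x ∈ τ k i j ∨ y ∈ τ l i' j') →
        x ≠ y ∧ (G.Adj x y ↔ (j = i' ∧ p j k = x ∧ p i' l = y) ∨
          (i = j' ∧ p i k = x ∧ p j' l = y)) := by
      rintro ⟨h1, h2⟩ h3
      refine ⟨h1, iff_of_false h2 ?_⟩
      rintro (⟨-, h4, h5⟩ | ⟨-, h4, h5⟩) <;> rcases h3 with h3 | h3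
      · exact hxB h3 j hj h4
      · exact hyB h3 i' hi' h5
      · exact hxB h3 i hi h4
      · exact hyB h3 j' hj' h5
    have hpy : ∀ a ∈ I, y ∈ τ l i' j' → p a k ≠ y ∧ ¬ G.Adj (p a k) y := fun a ha h1 =>
      hpB a ha k hk l hl hkl y (hτB l hl i' hi' j' hj' y h1)
    have hpx : ∀ a ∈ I, x ∈ τ k i j → x ≠ p a l ∧ ¬ G.Adj x (p a l) := fun a ha h1 => by
      obtain ⟨h2, h3⟩ := hpB a ha l hl k hk hkl.symm x (hτB k hk i hi j hj x h1)
      exact ⟨h2.symm, fun e => h3 e.symm⟩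
    rcases hx with hx | hx | hx <;> rcases hy with hy | hy | hy
    · exact hport i hi i' hi' (Or.inl rfl) (Or.inl rfl) hx hy
    · exact hfin (hx ▸ hpy i hi hy) (Or.inr hy)
    · exact hport i hi j' hj' (Or.inl rfl) (Or.inr rfl) hx hy
    · exact hfin (hy ▸ hpx i' hi' hx) (Or.inl hx)
    · exact hfin (h.anti k hk l hl hkl x (hτB k hk i hi j hj x hx) y
        (hτB l hl i' hi' j' hj' y hy)) (Or.inl hx)
    · exact hfin (hy ▸ hpx j' hj' hx) (Or.inl hx)
    · exact hport j hj i' hi' (Or.inr rfl) (Or.inl rfl) hx hy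
    · exact hfin (hx ▸ hpy j hj hy) (Or.inr hy)
    · exact hport j hj j' hj' (Or.inr rfl) (Or.inr rfl) hx hy

end

/-! ### Hubs of vertex type -/

section
variable {V : Type u} {G : SimpleGraph V} {κ : Type v}

/-- Private parts `P i` of a set `X`, any two of which form a connected set, contain links between
the vertices `a i`. -/
theorem exists_links_of_private {S : Finset ℕ} {a : ℕ → V} {X : Set V} {P : ℕ → Set V}
    (ha : ∀ i ∈ S, a i ∉ X) (hP : ∀ i ∈ S, P i ⊆ X)
    (hPP : ∀ i ∈ S, ∀ j ∈ S, i ≠ j → Conn G (P i ∪ P j))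
    (hPa : ∀ i ∈ S, ∃ x ∈ P i, x ∈ contact G {a i})
    (hpriv : ∀ i ∈ S, ∀ j ∈ S, i ≠ j → ∀ x ∈ P i, x ∉ contact G {a j}) :
    ∀ i ∈ S, ∀ j ∈ S, i ≠ j → ∃ σ, IsLink G (a i) (a j) σ ∧ (∀ x ∈ σ, x ∈ X) ∧
      ∀ h ∈ S, h ≠ i → h ≠ j → ∀ x ∈ σ, ¬ G.Adj (a h) x := by
  intro i hi j hj hij
  have hsub : P i ∪ P j ⊆ X := Set.union_subset (hP i hi) (hP j hj)
  obtain ⟨x, hx, _, rfl, ex⟩ := hPa i hi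
  obtain ⟨y, hy, _, rfl, ey⟩ := hPa j hj
  obtain ⟨σ, hσ, hσP⟩ := (hPP i hi j hj hij).exists_isLink (fun h => ha i hi (hsub h))
    (fun h => ha j hj (hsub h)) ⟨x, Or.inl hx, ex.symm⟩ ⟨y, Or.inr hy, ey.symm⟩
  refine ⟨σ, hσ, fun z hz => hsub (hσP z hz), fun h hh hhi hhj z hz e => ?_⟩
  rcases hσP z hz with h1 | h1
  · exact hpriv i hi h hh hhi.symm z h1 ⟨_, rfl, e.symm⟩
  · exact hpriv j hj h hh hhj.symm z h1 ⟨_, rfl, e.symm⟩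

/-- In a connected set `X` that sees many independent vertices `a i`, either some vertex is adjacent
to many of them, or many of them are linked in pairs through `X` away from the others. This is the
hub lemma with the roles of rows and columns exchanged. -/
theorem exists_rich_or_links (c t : ℕ) (ht : 1 ≤ t) (n : ℕ) : ∃ F : ℕ, ∀ {V : Type u} [Finite V]
    {G : SimpleGraph V} {C : Finset ℕ} (I : Finset ℕ) (a : ℕ → V) (X X' : Set V),
    C.card ≤ c → (∀ l, IsInducedCycle G l → l.length ∈ C) → IndFree G (biclique t) →
    F ≤ I.card → Conn G X → X.Nonempty → Conn G X' → X'.Nonempty → Anticomplete G X X' →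
    (∀ i ∈ I, ∀ j ∈ I, i ≠ j → a i ≠ a j ∧ ¬ G.Adj (a i) (a j)) →
    (∀ i ∈ I, a i ∉ X ∧ a i ∈ contact G X) → (∀ i ∈ I, a i ∉ X' ∧ a i ∈ contact G X') →
    ∃ I' ⊆ I, I'.card = n ∧ ((∃ v ∈ X, ∀ i ∈ I', G.Adj v (a i)) ∨
      ∀ i ∈ I', ∀ j ∈ I', i ≠ j → ∃ σ, IsLink G (a i) (a j) σ ∧ (∀ x ∈ σ, x ∈ X) ∧
        ∀ h ∈ I', h ≠ i → h ≠ j → ∀ x ∈ σ, ¬ G.Adj (a h) x) := by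
  classical
  obtain ⟨F, hF⟩ := exists_hub.{u, 0} c t ht (2 * n)
  refine ⟨F, ?_⟩
  intro V _ G C I a X X' hCc hC hfree hI hX hXne hX' hXne' hXX haa haX haX'
  have htouch : ∀ {Y : Set V} {i : ℕ}, a i ∈ contact G Y → Touches G Y {a i} := by
    rintro Y i ⟨y, hy, e⟩
    exact ⟨y, hy, _, rfl, e.symm⟩
  obtain ⟨S, hS, hScard, h⟩ := hF I (fun i => {a i}) X X' hCc hC hfree hI hX hXne hX' hXne' hXX
    (fun i _ => conn_singleton (a i))
    (fun i hi j hj hij x hx y hy => by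
      rw [Set.mem_singleton_iff.1 hx, Set.mem_singleton_iff.1 hy]
      exact haa i hi j hj hij)
    (fun i hi x hx => by rw [Set.mem_singleton_iff.1 hx]; exact (haX i hi).1)
    (fun i hi x hx => by rw [Set.mem_singleton_iff.1 hx]; exact (haX' i hi).1)
    (fun i hi => htouch (haX i hi).2) (fun i hi => htouch (haX' i hi).2)
  rcases h with ⟨p, L, h⟩ | ⟨v, L, h⟩
  · obtain ⟨I', hI', hn⟩ := Finset.exists_subset_card_eq (show n ≤ S.card by omega)
    refine ⟨I', hI'.trans hS, hn, Or.inr ?_⟩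
    have hconn : ∀ i ∈ S, Conn G (L i ∪ {p i}) := by
      intro i hi
      rcases h.leg i hi with ⟨h1, -⟩ | ⟨h1, h2, -⟩
      · rw [h1, Set.empty_union]
        exact conn_singleton _
      · exact h1.union (conn_singleton _) h2.symm
    refine exists_links_of_private (P := fun i => L i ∪ {p i})
      (fun i hi => (haX i (hS (hI' hi))).1)
      (fun i hi => Set.union_subset (h.leg_sub i (hI' hi))
        (Set.singleton_subset_iff.2 (h.port_mem i (hI' hi)))) ?_ ?_ ?_
    · intro i hi j hj hij
      exact (hconn i (hI' hi)).union (hconn j (hI' hj))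
        ⟨p i, Or.inr rfl, p j, Or.inr rfl, h.adj i (hI' hi) j (hI' hj) hij⟩
    · intro i hi
      rcases h.leg i (hI' hi) with ⟨-, h1⟩ | ⟨-, -, x, hx, h1⟩
      · exact ⟨p i, Or.inr rfl, h1⟩
      · exact ⟨x, Or.inl hx, h1⟩
    · rintro i hi j hj hij x (hx | rfl)
      · exact h.leg_private i (hI' hi) j (hI' hj) hij x hx
      · exact h.port_private i (hI' hi) j (hI' hj) hij
  · have hvX : v ∈ X := h.path_sub v (by simp)
    have hsplit := Finset.card_filter_add_card_filter_not (s := S) (fun i => G.Adj v (a i))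
    by_cases hrich : n ≤ (S.filter fun i => G.Adj v (a i)).card
    · obtain ⟨I', hI', hn⟩ := Finset.exists_subset_card_eq hrich
      exact ⟨I', (hI'.trans (Finset.filter_subset _ _)).trans hS, hn,
        Or.inl ⟨v, hvX, fun i hi => (Finset.mem_filter.1 (hI' hi)).2⟩⟩
    obtain ⟨I', hI', hn⟩ := Finset.exists_subset_card_eq
      (show n ≤ (S.filter fun i => ¬ G.Adj v (a i)).card by omega)
    have hI'S : I' ⊆ S := hI'.trans (Finset.filter_subset _ _)
    have hv : ∀ i ∈ I', v ∉ contact G {a i} := by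
      rintro i hi ⟨_, rfl, e⟩
      exact (Finset.mem_filter.1 (hI' hi)).2 e
    have hleg : ∀ i ∈ I', Conn G (L i ∪ {v}) ∧ ∃ x ∈ L i, x ∈ contact G {a i} := by
      intro i hi
      rcases h.leg i (hI'S hi) with ⟨-, x, hx, h1⟩ | ⟨h1, ⟨x, hx, y, hy, e⟩, h2⟩
      · rw [List.mem_singleton.1 hx] at h1
        exact absurd h1 (hv i hi)
      · rw [List.mem_singleton.1 hx] at e
        exact ⟨h1.union (conn_singleton _) ⟨y, hy, v, rfl, e.symm⟩, h2⟩
    refine ⟨I', hI'S.trans hS, hn, Or.inr ?_⟩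
    refine exists_links_of_private (P := fun i => L i ∪ {v})
      (fun i hi => (haX i (hS (hI'S hi))).1)
      (fun i hi => Set.union_subset (h.leg_sub i (hI'S hi)) (Set.singleton_subset_iff.2 hvX))
      ?_ ?_ ?_
    · intro i hi j hj hij
      exact (hleg i hi).1.union_of_mem (hleg j hj).1 (Or.inr rfl) (Or.inr rfl)
    · intro i hi
      obtain ⟨x, hx, h1⟩ := (hleg i hi).2
      exact ⟨x, Or.inl hx, h1⟩
    · rintro i hi j hj hij x (hx | rfl)
      · exact h.leg_private i (hI'S hi) j (hI'S hj) hij x hx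
      · exact hv j hj

/-- The previous dichotomy for many sets `X k` at once. -/
theorem exists_rich_or_links_forall (c t : ℕ) (ht : 1 ≤ t) (m n : ℕ) : ∃ F : ℕ,
    ∀ {V : Type u} [Finite V] {G : SimpleGraph V} {C : Finset ℕ} {κ : Type v} (J : Finset κ)
    (X : κ → Set V) (I : Finset ℕ) (a : ℕ → V) (X' : Set V),
    C.card ≤ c → (∀ l, IsInducedCycle G l → l.length ∈ C) → IndFree G (biclique t) →
    J.card = m → F ≤ I.card → Conn G X' → X'.Nonempty →
    (∀ i ∈ I, ∀ j ∈ I, i ≠ j → a i ≠ a j ∧ ¬ G.Adj (a i) (a j)) →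
    (∀ i ∈ I, a i ∉ X' ∧ a i ∈ contact G X') →
    (∀ k ∈ J, Conn G (X k) ∧ (X k).Nonempty ∧ Anticomplete G (X k) X') →
    (∀ k ∈ J, ∀ i ∈ I, a i ∉ X k ∧ a i ∈ contact G (X k)) →
    ∃ I' ⊆ I, I'.card = n ∧ ∀ k ∈ J, (∃ v ∈ X k, ∀ i ∈ I', G.Adj v (a i)) ∨
      ∀ i ∈ I', ∀ j ∈ I', i ≠ j → ∃ σ, IsLink G (a i) (a j) σ ∧ (∀ x ∈ σ, x ∈ X k) ∧
        ∀ h ∈ I', h ≠ i → h ≠ j → ∀ x ∈ σ, ¬ G.Adj (a h) x := by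
  classical
  induction m with
  | zero =>
    refine ⟨n, ?_⟩
    intro V _ G C κ J X I a X' _ _ _ hJ hI _ _ _ _ _ _
    obtain ⟨I', hI', hn⟩ := Finset.exists_subset_card_eq hI
    rw [Finset.card_eq_zero] at hJ
    subst hJ
    exact ⟨I', hI', hn, by simp⟩
  | succ m ih =>
    obtain ⟨F₁, hF₁⟩ := ih
    obtain ⟨F, hF⟩ := exists_rich_or_links.{u} c t ht F₁
    refine ⟨F, ?_⟩
    intro V _ G C κ J X I a X' hCc hC hfree hJ hI hX' hXne' haa haX' hX haX
    obtain ⟨k, J, hkJ, rfl, hJ'⟩ := Finset.card_eq_succ.1 hJ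
    have hk := Finset.mem_insert_self k J
    obtain ⟨I₁, hI₁, hcard₁, h₁⟩ := hF I a (X k) X' hCc hC hfree hI (hX k hk).1 (hX k hk).2.1 hX'
      hXne' (hX k hk).2.2 haa (haX k hk) haX'
    obtain ⟨I', hI', hcard, h⟩ := hF₁ J X I₁ a X' hCc hC hfree hJ' hcard₁.ge hX' hXne'
      (fun i hi j hj => haa i (hI₁ hi) j (hI₁ hj)) (fun i hi => haX' i (hI₁ hi))
      (fun l hl => hX l (Finset.mem_insert_of_mem hl))
      (fun l hl i hi => haX l (Finset.mem_insert_of_mem hl) i (hI₁ hi))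
    refine ⟨I', hI'.trans hI₁, hcard, fun l hl => ?_⟩
    rcases Finset.mem_insert.1 hl with rfl | hl
    · refine h₁.imp (fun ⟨v, hv, h2⟩ => ⟨v, hv, fun i hi => h2 i (hI' hi)⟩)
        fun h2 i hi j hj hij => ?_
      obtain ⟨σ, h3, h4, h5⟩ := h2 i (hI' hi) j (hI' hj) hij
      exact ⟨σ, h3, h4, fun h6 hh => h5 h6 (hI' hh)⟩
    · exact h l hl

/-- Hubs that are vertices: the segments lead from a hub through a column up to the next hub. -/
theorem exists_segments_of_links {I : Finset ℕ} {K : Finset κ} {a : ℕ → V} {X : κ → Set V}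
    (haa : ∀ i ∈ I, ∀ j ∈ I, i ≠ j → a i ≠ a j ∧ ¬ G.Adj (a i) (a j))
    (haX : ∀ k ∈ K, ∀ i ∈ I, a i ∉ X k)
    (hXX : ∀ k ∈ K, ∀ l ∈ K, k ≠ l → Anticomplete G (X k) (X l))
    (hlink : ∀ k ∈ K, ∀ i ∈ I, ∀ j ∈ I, i ≠ j → ∃ σ, IsLink G (a i) (a j) σ ∧
      (∀ x ∈ σ, x ∈ X k) ∧ ∀ h ∈ I, h ≠ i → h ≠ j → ∀ x ∈ σ, ¬ G.Adj (a h) x) :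
    ∃ seg, Segments G I K seg := by
  classical
  choose! σ hσ hσX hσa using hlink
  -- The link is fixed for one order of the two rows, and reversed for the other one.
  let τ : κ → ℕ → ℕ → List V := fun k i j => if i < j then σ k i j else (σ k j i).reverse
  have hτ : ∀ k ∈ K, ∀ i ∈ I, ∀ j ∈ I, i ≠ j → IsLink G (a i) (a j) (τ k i j) ∧
      (∀ x ∈ τ k i j, x ∈ X k) ∧ ∀ h ∈ I, h ≠ i → h ≠ j → ∀ x ∈ τ k i j, ¬ G.Adj (a h) x := by
    intro k hk i hi j hj hij
    by_cases h : i < j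
    · simp only [τ, h, if_true]
      exact ⟨hσ k hk i hi j hj hij, hσX k hk i hi j hj hij, hσa k hk i hi j hj hij⟩
    · simp only [τ, h, if_false, List.mem_reverse]
      exact ⟨(hσ k hk j hj i hi hij.symm).reverse, hσX k hk j hj i hi hij.symm,
        fun b hb h1 h2 => hσa k hk j hj i hi hij.symm b hb h2 h1⟩
  refine ⟨fun k i j => a i :: τ k i j, ?_, ?_, ?_, ?_⟩
  · intro k hk i hi j hj hij
    exact ⟨(hτ k hk i hi j hj hij).1.left, (hτ k hk i hi j hj hij).1.path⟩
  · intro k hk i hi j hj hij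
    have := List.length_pos_iff.2 (hτ k hk i hi j hj hij).1.ne_nil
    simp only [List.length_cons]
    omega
  · intro k hk i hi j hj hij
    rcases lt_or_gt_of_ne hij with h1 | h1 <;> simp [τ, h1, h1.not_gt]
  · intro k hk l hl hkl i hi j hj i' hi' j' hj' hij hij' hii hjj x hx y hy
    obtain ⟨h1, h2, h3⟩ := hτ k hk i hi j hj hij
    obtain ⟨h1', h2', h3'⟩ := hτ l hl i' hi' j' hj' hij'
    have hlast : (a i :: τ k i j).getLast? = (τ k i j).getLast? := by
      obtain ⟨d, s, h⟩ := List.exists_cons_of_ne_nil h1.ne_nil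
      rw [h, List.getLast?_cons_cons]
    have hlast' : (a i' :: τ l i' j').getLast? = (τ l i' j').getLast? := by
      obtain ⟨d, s, h⟩ := List.exists_cons_of_ne_nil h1'.ne_nil
      rw [h, List.getLast?_cons_cons]
    rw [hlast, hlast', List.head?_cons, List.head?_cons, Option.some.injEq, Option.some.injEq]
    have ha : ∀ b ∈ I, a b ∉ τ k i j := fun b hb h => haX k hk b hb (h2 _ h)
    have ha' : ∀ b ∈ I, a b ∉ τ l i' j' := fun b hb h => haX l hl b hb (h2' _ h)
    rcases List.mem_cons.1 hx with rfl | hx <;> rcases List.mem_cons.1 hy with rfl | hy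
    · refine ⟨(haa i hi i' hi' hii).1, iff_of_false (haa i hi i' hi' hii).2 ?_⟩
      rintro (⟨-, h4, -⟩ | ⟨-, -, h4⟩)
      · exact ha i hi (getLast?_mem h4)
      · exact ha' i' hi' (getLast?_mem h4)
    · refine ⟨by rintro rfl; exact ha' i hi hy, ?_⟩
      by_cases hij'' : i = j'
      · subst hij''
        rw [(h1'.right y hy).2]
        refine ⟨fun e => Or.inr ⟨rfl, rfl, e⟩, ?_⟩
        rintro (⟨-, h4, -⟩ | ⟨-, -, h4⟩)
        · exact absurd (getLast?_mem h4) (ha i hi)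
        · exact h4
      · refine iff_of_false (h3' i hi hii hij'' y hy) ?_
        rintro (⟨-, h4, -⟩ | ⟨h4, -⟩)
        · exact ha i hi (getLast?_mem h4)
        · exact hij'' h4
    · refine ⟨by rintro rfl; exact ha i' hi' hx, ?_⟩
      by_cases hji : j = i'
      · subst hji
        rw [G.adj_comm, (h1.right x hx).2]
        refine ⟨fun e => Or.inl ⟨rfl, e, rfl⟩, ?_⟩
        rintro (⟨-, h4, -⟩ | ⟨-, -, h4⟩)
        · exact h4
        · exact absurd (getLast?_mem h4) (ha' j hj)
      · refine iff_of_false (fun e => h3 i' hi' hii.symm (Ne.symm hji) x hx e.symm) ?_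
        rintro (⟨h4, -⟩ | ⟨-, -, h4⟩)
        · exact hji h4
        · exact ha' i' hi' (getLast?_mem h4)
    · refine ⟨(hXX k hk l hl hkl x (h2 x hx) y (h2' y hy)).1,
        iff_of_false (hXX k hk l hl hkl x (h2 x hx) y (h2' y hy)).2 ?_⟩
      rintro (⟨-, -, rfl⟩ | ⟨-, rfl, -⟩)
      · exact ha' i' hi' hy
      · exact ha i hi hx

end

/-! ### Grids of rows and columns -/

section
variable {V : Type u} {G : SimpleGraph V} {κ : Type v}

theorem Hubs.mono {I I' : Finset ℕ} {K K' : Finset κ} {A : ℕ → Set V} {B : κ → Set V}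
    {p : ℕ → κ → V} (h : Hubs G I K A B p) (hI : I' ⊆ I) (hK : K' ⊆ K) :
    Hubs G I' K' A B p where
  conn k hk := h.conn k (hK hk)
  anti k hk l hl := h.anti k (hK hk) l (hK hl)
  port_mem i hi k hk := h.port_mem i (hI hi) k (hK hk)
  port_notMem i hi k hk l hl := h.port_notMem i (hI hi) k (hK hk) l (hK hl)
  port_contact i hi k hk := h.port_contact i (hI hi) k (hK hk)
  vertex_or_clique i hi := (h.vertex_or_clique i (hI hi)).imp
    (fun h1 k hk l hl => h1 k (hK hk) l (hK hl)) fun h1 k hk l hl => h1 k (hK hk) l (hK hl)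

/-- Hubs that are vertices: many columns with a vertex adjacent to many hubs would form a biclique
with them, so most columns contain links between the hubs. -/
theorem exists_vertex_hubs_bound (c t : ℕ) (ht : 1 ≤ t) : ∃ n N : ℕ, ∀ {V : Type u} [Finite V]
    {G : SimpleGraph V} {C : Finset ℕ} {κ : Type v} (I : Finset ℕ) (K : Finset κ) (A : ℕ → Set V)
    (B : κ → Set V) (p : ℕ → κ → V), C.card < c → (∀ l, IsInducedCycle G l → l.length ∈ C) →
    IndFree G (biclique t) → n ≤ I.card → K.card = N → Hubs G I K A B p →
    (∀ k ∈ K, (B k).Nonempty) → (∀ i ∈ I, ∀ j ∈ I, i ≠ j → Anticomplete G (A i) (A j)) →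
    (∀ i ∈ I, ∀ k ∈ K, ∀ l ∈ K, p i k = p i l) → False := by
  classical
  obtain ⟨n₀, N₀, hseg⟩ := exists_segments_bound.{u, v} c
  obtain ⟨n, hn⟩ := exists_rich_or_links_forall.{u, v} c t ht (N₀ + t) (n₀ + t)
  refine ⟨n, N₀ + t + 1, ?_⟩
  intro V _ G C κ I K A B p hCc hC hfree hI hK h hB hA hp
  obtain ⟨k₀, hk₀⟩ : K.Nonempty := Finset.card_pos.1 (by omega)
  have haa : ∀ i ∈ I, ∀ j ∈ I, i ≠ j → p i k₀ ≠ p j k₀ ∧ ¬ G.Adj (p i k₀) (p j k₀) :=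
    fun i hi j hj hij => hA i hi j hj hij _ (h.port_mem i hi k₀ hk₀) _ (h.port_mem j hj k₀ hk₀)
  have haB : ∀ k ∈ K, ∀ i ∈ I, p i k₀ ∉ B k ∧ p i k₀ ∈ contact G (B k) := fun k hk i hi =>
    ⟨h.port_notMem i hi k₀ hk₀ k hk, hp i hi k hk k₀ hk₀ ▸ h.port_contact i hi k hk⟩
  have hJK : ∀ k ∈ K.erase k₀, k ∈ K := fun k hk => Finset.mem_of_mem_erase hk
  obtain ⟨I', hI', hcard, hcol⟩ := hn (K.erase k₀) B I (fun i => p i k₀) (B k₀) hCc.le hC hfree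
    (by rw [Finset.card_erase_of_mem hk₀]; omega) hI (h.conn k₀ hk₀) (hB k₀ hk₀) haa
    (haB k₀ hk₀)
    (fun k hk => ⟨h.conn k (hJK k hk), hB k (hJK k hk),
      h.anti k (hJK k hk) k₀ hk₀ (Finset.ne_of_mem_erase hk)⟩)
    (fun k hk => haB k (hJK k hk))
  have hsplit := Finset.card_filter_add_card_filter_not (s := K.erase k₀)
    (fun k => ∃ v ∈ B k, ∀ i ∈ I', G.Adj v (p i k₀))
  rw [Finset.card_erase_of_mem hk₀] at hsplit
  by_cases hrich : t ≤ ((K.erase k₀).filter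
      fun k => ∃ v ∈ B k, ∀ i ∈ I', G.Adj v (p i k₀)).card
  · obtain ⟨T, hT, hTcard⟩ := Finset.exists_subset_card_eq hrich
    obtain ⟨R, hR, hRcard⟩ := Finset.exists_subset_card_eq (show t ≤ I'.card by omega)
    have hTK : ∀ k ∈ T, k ∈ K := fun k hk => hJK k (Finset.mem_filter.1 (hT hk)).1
    have hv : ∀ k ∈ T, ∃ v ∈ B k, ∀ i ∈ I', G.Adj v (p i k₀) := fun k hk =>
      (Finset.mem_filter.1 (hT hk)).2
    have : Nonempty V := ⟨(hB k₀ hk₀).some⟩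
    choose! v hvB hv using hv
    have hvv : ∀ k ∈ T, ∀ l ∈ T, k ≠ l → v k ≠ v l ∧ ¬ G.Adj (v k) (v l) :=
      fun k hk l hl hkl => h.anti k (hTK k hk) l (hTK l hl) hkl _ (hvB k hk) _ (hvB l hl)
    refine hfree.false_of_biclique (X := T.image v) (Y := R.image fun i => p i k₀) ?_ ?_ ?_ ?_ ?_
    · rw [Finset.card_image_of_injOn, hTcard]
      intro k hk l hl e
      by_contra hne
      exact (hvv k hk l hl hne).1 e
    · rw [Finset.card_image_of_injOn, hRcard]
      intro i hi j hj e
      by_contra hne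
      exact (haa i (hI' (hR hi)) j (hI' (hR hj)) hne).1 e
    · simp only [Finset.mem_image]
      rintro _ ⟨k, hk, rfl⟩ _ ⟨l, hl, rfl⟩ e
      by_cases hkl : k = l
      · subst hkl; exact e.ne rfl
      · exact (hvv k hk l hl hkl).2 e
    · simp only [Finset.mem_image]
      rintro _ ⟨i, hi, rfl⟩ _ ⟨j, hj, rfl⟩ e
      by_cases hij : i = j
      · subst hij; exact e.ne rfl
      · exact (haa i (hI' (hR hi)) j (hI' (hR hj)) hij).2 e
    · simp only [Finset.mem_image]
      rintro _ ⟨k, hk, rfl⟩ _ ⟨i, hi, rfl⟩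
      exact hv k hk i (hR hi)
  · have hpoor := fun k
      (hk : k ∈ (K.erase k₀).filter fun k => ¬ ∃ v ∈ B k, ∀ i ∈ I', G.Adj v (p i k₀)) =>
      (hcol k (Finset.mem_filter.1 hk).1).resolve_left (Finset.mem_filter.1 hk).2
    have hsub := fun k
      (hk : k ∈ (K.erase k₀).filter fun k => ¬ ∃ v ∈ B k, ∀ i ∈ I', G.Adj v (p i k₀)) =>
      hJK k (Finset.mem_filter.1 hk).1
    obtain ⟨seg, hs⟩ := exists_segments_of_links
      (fun i hi j hj => haa i (hI' hi) j (hI' hj))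
      (fun k hk i hi => (haB k (hsub k hk) i (hI' hi)).1)
      (fun k hk l hl => h.anti k (hsub k hk) l (hsub l hl)) hpoor
    exact hseg _ _ seg hCc hC (by omega) (by omega) hs

/-- A biclique-free graph with few induced cycle lengths has no large grid of connected rows and
columns in which every row touches every column, while rows are pairwise anticomplete and so are
columns. -/
theorem exists_grid_bound (c t : ℕ) (ht : 1 ≤ t) : ∃ n N : ℕ, ∀ {V : Type u} [Finite V]
    {G : SimpleGraph V} {C : Finset ℕ} {κ : Type v} (K : Finset κ) (A : ℕ → Set V)
    (B : κ → Set V), C.card < c → (∀ l, IsInducedCycle G l → l.length ∈ C) →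
    IndFree G (biclique t) → N ≤ K.card → (∀ i ≤ n, Conn G (A i) ∧ (A i).Nonempty) →
    (∀ i ≤ n, ∀ j ≤ n, i ≠ j → Anticomplete G (A i) (A j)) →
    (∀ k ∈ K, Conn G (B k)) → (∀ k ∈ K, ∀ l ∈ K, k ≠ l → Anticomplete G (B k) (B l)) →
    (∀ k ∈ K, ∀ i ≤ n, ∀ x ∈ B k, x ∉ A i) → (∀ k ∈ K, ∀ i ≤ n, Touches G (A i) (B k)) →
    False := by
  classical
  obtain ⟨n₀, N₀, hseg⟩ := exists_segments_bound.{u, v} c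
  obtain ⟨n₁, N₁, hvertex⟩ := exists_vertex_hubs_bound.{u, v} c t ht
  obtain ⟨F, hF⟩ := exists_hubs.{u, v} c t ht (n₀ + n₁) (N₀ + N₁)
  refine ⟨n₀ + n₁, F, ?_⟩
  intro V _ G C κ K A B hCc hC hfree hK hA hAA hB hBB hBA hBt
  obtain ⟨K', hK', hcard, B', p, hsub, -, h⟩ := hF K A B (A (n₀ + n₁)) hCc.le hC hfree hK
    (fun i hi => hA i hi.le) (hA _ le_rfl).1 (hA _ le_rfl).2
    (fun i hi j hj => hAA i hi.le j hj.le) (fun i hi => hAA i hi.le _ le_rfl hi.ne) hB hBB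
    (fun k hk x hx => ⟨hBA k hk _ le_rfl x hx, fun i hi => hBA k hk i hi.le x hx⟩)
    (fun k hk => ⟨hBt k hk _ le_rfl, fun i hi => hBt k hk i hi.le⟩)
  have hlt : ∀ i ∈ Finset.range (n₀ + n₁), i ≤ n₀ + n₁ := fun i hi => (Finset.mem_range.1 hi).le
  have hsplit := Finset.card_filter_add_card_filter_not (s := Finset.range (n₀ + n₁))
    (fun i => ∀ k ∈ K', ∀ l ∈ K', p i k = p i l)
  rw [Finset.card_range] at hsplit
  by_cases hv : n₁ ≤ ((Finset.range (n₀ + n₁)).filter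
      fun i => ∀ k ∈ K', ∀ l ∈ K', p i k = p i l).card
  · obtain ⟨K₁, hK₁, hcard₁⟩ := Finset.exists_subset_card_eq (show N₁ ≤ K'.card by omega)
    have hI := Finset.filter_subset (fun i => ∀ k ∈ K', ∀ l ∈ K', p i k = p i l)
      (Finset.range (n₀ + n₁))
    refine hvertex _ K₁ A B' p hCc hC hfree hv hcard₁ (h.mono hI hK₁) ?_
      (fun i hi j hj => hAA i (hlt i (hI hi)) j (hlt j (hI hj)))
      (fun i hi k hk l hl => (Finset.mem_filter.1 hi).2 k (hK₁ hk) l (hK₁ hl))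
    intro k hk
    obtain ⟨-, -, y, hy, -⟩ := hBt k (hK' (hK₁ hk)) 0 (Nat.zero_le _)
    exact ⟨y, hsub k (hK₁ hk) hy⟩
  · have hI := Finset.filter_subset (fun i => ¬ ∀ k ∈ K', ∀ l ∈ K', p i k = p i l)
      (Finset.range (n₀ + n₁))
    obtain ⟨seg, hs⟩ := (h.mono hI subset_rfl).exists_segments
      (fun i hi j hj => hAA i (hlt i (hI hi)) j (hlt j (hI hj)))
      (fun i hi => (h.vertex_or_clique i (hI hi)).resolve_left (Finset.mem_filter.1 hi).2)
    exact hseg _ _ seg hCc hC (by omega) (by omega) hs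

theorem finite_inducedCycleLengths [Finite V] : (inducedCycleLengths G).Finite := by
  have := Fintype.ofFinite V
  refine (Set.finite_le_nat (Fintype.card V)).subset ?_
  rintro l ⟨-, ⟨f⟩⟩
  simpa using Fintype.card_le_of_injective f f.injective

end

end InducedCycles

theorem lemma3p3 (c t : ℕ) (hc : 1 ≤ c) (ht : 1 ≤ t) :
    ∃ f : ℕ, ∀ (V : Type u) [Finite V] (G : SimpleGraph V),
      InducedCycles.IndFree G (InducedCycles.biclique t) →
      InducedCycles.HasInducedMinor G (InducedCycles.biclique f) →
      c ≤ InducedCycles.cl G := by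
  obtain ⟨n, N, h⟩ := InducedCycles.exists_grid_bound.{u, 0} c t ht
  refine ⟨n + 1 + N, fun V _ G hfree hminor => ?_⟩
  by_contra hcl
  obtain ⟨φ, hφ, hφφ⟩ := hminor.exists_model
  have hfin := InducedCycles.finite_inducedCycleLengths (G := G)
  have hanti : ∀ a b, a ≠ b → ¬ (InducedCycles.biclique (n + 1 + N)).Adj a b →
      InducedCycles.Anticomplete G (φ a) (φ b) := by
    intro a b hab hadj x hx y hy
    obtain ⟨h1, h2⟩ := hφφ a b hab
    exact ⟨h1.ne_of_mem hx hy, fun e => hadj (h2.1 ⟨x, hx, y, hy, e⟩)⟩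
  -- Rows are indexed by natural numbers, of which only those below `n + 1` matter.
  let row : ℕ → Fin (n + 1 + N) := fun i => if h : i < n + 1 + N then ⟨i, h⟩ else ⟨0, by omega⟩
  have hrow : ∀ i ≤ n, ∀ j ≤ n, i ≠ j → row i ≠ row j := by
    intro i hi j hj hij
    have h1 : i < n + 1 + N := by omega
    have h2 : j < n + 1 + N := by omega
    simpa [row, h1, h2] using hij
  refine h (C := hfin.toFinset) (Finset.univ : Finset (Fin (n + 1 + N)))
    (fun i => φ (Sum.inl (row i))) (fun k => φ (Sum.inr k)) ?_
    (fun l hl => hfin.mem_toFinset.2 hl.length_mem) hfree (by simp) ?_ ?_ ?_ ?_ ?_ ?_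
  · rw [← Set.ncard_eq_toFinset_card _ hfin]
    exact not_le.1 hcl
  · exact fun i _ => ⟨(hφ _).2, (hφ _).1⟩
  · exact fun i hi j hj hij => hanti _ _ (by simpa using hrow i hi j hj hij) (by simp)
  · exact fun k _ => (hφ _).2
  · exact fun k _ l _ hkl => hanti _ _ (by simpa using hkl) (by simp)
  · exact fun k _ i _ x hx hxA =>
      (hφφ (Sum.inr k) (Sum.inl (row i)) (by simp)).1.ne_of_mem hx hxA rfl
  · exact fun k _ i _ => (hφφ (Sum.inl (row i)) (Sum.inr k) (by simp)).2.2 (by simp)
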